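/- **Setting.** Let $k\in\mathbb N$, let $\Gamma\in\mathbb R^{k\times k}$ be symmetric positive definite with smallest eigenvalue at least $\mu_{\min}$, where $0<\mu_{\min}\le 1$, and let $\Xi$ be a design space. Let $C\ge 1$, $\beta\ge 1$, let $0<p\le\min\{\tfrac23,\tfrac1\beta\}$ with $p\ne\tfrac1\beta$, and let $\boldsymbol b=(b_j)_{j\ge1}\in\ell^p(\mathbb N)$ be nonnegative. For $s\in\mathbb N$ put $\Theta_s=[-\frac12,\frac12]^s$, and let $G_s:\Theta_s\times\Xi\to\mathbb R^k$, $s\in\mathbb N$, be forward models, infinitely differentiable in $\boldsymbol\theta$ on $\Theta_s$, such that (with the Euclidean norm) $$\|\partial_{\boldsymbol\theta}^{\boldsymbol\nu}G_s(\boldsymbol\theta,\boldsymbol\xi)\|\le C(|\boldsymbol\nu|!)^\beta\,\boldsymbol b^{\boldsymbol\nu}\qquad\text{for all }s,\ \boldsymbol\theta\in\Theta_s,\ \boldsymbol\xi\in\Xi,\ \boldsymbol\nu\in\mathbb N_0^s .$$ Let $f(\boldsymbol\theta,\boldsymbol y)=f_{\boldsymbol\xi}(\boldsymbol\theta,\boldsymbol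 y)=\det(2\pi\Gamma)^{-1/2}\exp\big(-\tfrac12(\boldsymbol y-G_s(\boldsymbol\theta,\boldsymbol\xi))^{\rm T}\Gamma^{-1}(\boldsymbol y-G_s(\boldsymbol\theta,\boldsymbol\xi))\big)$, $g(x)=x\log x$, $K>0$, and $$\mathcal I_K=\int_{[-K,K]^k}g\Big(\int_{\Theta_s}f(\boldsymbol\theta,\boldsymbol y)\,d\boldsymbol\theta\Big)\,d\boldsymbol y .$$ **Cubature rules.** For positive weights $\boldsymbol\gamma=(\gamma_{\mathfrak u})_{\mathfrak u\subseteq\{1:m\}}$ let $\mathcal W_{m,\boldsymbol\gamma}$ be the space of continuous functions $F$ on $[0,1]^m$ with square-integrable weak first order mixed derivatives $\partial_{\mathfrak u}F$, $\mathfrak u\subseteq\{1:m\}$, and norm $$\|F\|_{\mathcal W_{m,\boldsymbol\gamma}}^2=\sum_{\mathfrak u\subseteq\{1:m\}}\frac1{\gamma_{\mathfrak u}}\int_{[0,1]^{|\mathfrak u|}}\Big(\int_{[0,1]^{m-|\mathfrak u|}}\partial_{\mathfrak u}F(\boldsymbol y)\,d\boldsymbol y_{-\mathfrak u}\Big)^2d\boldsymbol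 y_{\mathfrak u}.$$ For generating vectors $\boldsymbol z^{(\ell)}\in\{0,\dots,2^\ell-1\}^m$, $\ell\ge0$, and a shift $\boldsymbol\Delta\sim\mathcal U([0,1]^m)$, the randomly shifted lattice rule at level $\ell$ is $Q_\ell F=2^{-\ell}\sum_{i=1}^{2^\ell}F(\{i\boldsymbol z^{(\ell)}/2^\ell+\boldsymbol\Delta\})$, where $\{\cdot\}$ is the componentwise fractional part. We say that $(\boldsymbol z^{(\ell)})_\ell$ has rate $r$ with respect to $\boldsymbol\gamma$ if for some $c>0$, $$\Big(\mathbb E_{\boldsymbol\Delta}\Big|\int_{[0,1]^m}F-Q_\ell F\Big|^2\Big)^{1/2}\le c\,2^{-r\ell}\|F\|_{\mathcal W_{m,\boldsymbol\gamma}}\qquad\text{for all }\ell\ge0,\ F\in\mathcal W_{m,\boldsymbol\gamma}.$$ Given generating vectors in dimensions $k$ and $s$ and independent shifts $\boldsymbol\Delta_1\sim\mathcal U([0,1]^k)$, $\boldsymbol\Delta_2\sim\mathcal U([0,1]^s)$ (each used on all levels), let $Q^{(1)}_\ell$ be the $k$-dimensional rule with $2^\ell$ points scaled to $[-K,K]^k$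 (points $2K\boldsymbol x-K\boldsymbol 1$, weights multiplied by $(2K)^k$), and let $Q^{(2)}_\ell$ be the $s$-dimensional rule with $2^{\ell+\ell_0}$ points translated to $\Theta_s$, where $\ell_0\in\mathbb N_0$ is a fixed offset. With $\Delta^{(1)}_0=Q^{(1)}_0$, $\Delta^{(1)}_\ell=Q^{(1)}_\ell-Q^{(1)}_{\ell-1}$, $\Delta^{(2)}_0(F)=g(Q^{(2)}_0F)$, $\Delta^{(2)}_\ell(F)=g(Q^{(2)}_\ell F)-g(Q^{(2)}_{\ell-1}F)$ for $\ell\ge1$, the sparse tensor product cubature with parameter $\sigma>0$ is $$\mathcal Q_{L,\sigma}(f)=\sum_{\sigma\ell_1+\ell_2/\sigma\le L}\Delta^{(1)}_{\ell_1}\Delta^{(2)}_{\ell_2}(f),\qquad L\in\mathbb N_0 .$$ **Theorem.** Let $s\in\mathbb N$, and let $\boldsymbol\gamma_1=(\gamma_{1,\mathfrak u})_{\mathfrak u\subseteq\{1:k\}}$ and $\boldsymbol\gamma_2=(\gamma_{2,\mathfrak u})_{\mathfrak u\subseteq\{1:s\}}$ be positive weights. 1. There exist generating vectors in dimensions $k$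 and $s$ that have rate $1-\delta$ with respect to $\boldsymbol\gamma_1$ and $\boldsymbol\gamma_2$, respectively, for every $\delta>0$. 2. Let $\delta>0$. For any generating vectors in dimensions $k$ and $s$ that have rate $1-\delta$ with respect to $\boldsymbol\gamma_1$ and $\boldsymbol\gamma_2$, respectively, there are an offset $\ell_0\in\mathbb N_0$ and a constant $C'>0$ such that, for all $\boldsymbol\xi\in\Xi$ and all $L\in\mathbb N_0$, the sparse tensor product cubature with $\sigma=1$ satisfies $$\Big(\mathbb E_{\boldsymbol\Delta_1,\boldsymbol\Delta_2}\big|\mathcal I_K-\mathcal Q_{L,1}(f_{\boldsymbol\xi})\big|^2\Big)^{1/2}\le C'\,(2^L)^{-1+\delta}(L+1),$$ the error being square-integrable with respect to the shifts. -/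

import Mathlib

open MeasureTheory
open scoped ContDiff

namespace QMC

/-- The closed unit cube `U_m = [0,1]^m`. -/
def unitCube (m : ℕ) : Set (Fin m → ℝ) := Set.Icc 0 1

/-- The open unit cube `(0,1)^m`. -/
def openUnitCube (m : ℕ) : Set (Fin m → ℝ) := Set.univ.pi fun _ => Set.Ioo (0 : ℝ) 1

/-- The uniform distribution `U([0,1]^m)`. -/
noncomputable def uniformCube (m : ℕ) : Measure (Fin m → ℝ) := volume.restrict (unitCube m)

/-! ### The weighted unanchored Sobolev space -/

/-- The first order mixed partial derivative `∂_u φ = ∂^{|u|} φ / ∏_{j ∈ u} ∂y_j` of a smooth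
function on all of `ℝ^m`. -/
noncomputable def mixedPartial {m : ℕ} (u : Finset (Fin m)) (φ : (Fin m → ℝ) → ℝ)
    (y : Fin m → ℝ) : ℝ :=
  iteratedFDeriv ℝ u.card φ y fun i => Pi.single (u.orderEmbOfFin rfl i) 1

/-- `D` is the weak mixed derivative `∂_u F` of `F` on the unit cube, and it is square
integrable there. -/
def IsWeakMixedPartial {m : ℕ} (u : Finset (Fin m)) (F D : (Fin m → ℝ) → ℝ) : Prop :=
  MemLp D 2 (volume.restrict (unitCube m)) ∧
  ∀ φ : (Fin m → ℝ) → ℝ, ContDiff ℝ ∞ φ → HasCompactSupport φ → tsupport φ ⊆ openUnitCube m →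
    ∫ y in unitCube m, F y * mixedPartial u φ y
      = (-1) ^ u.card * ∫ y in unitCube m, D y * φ y

/-- `F` belongs to the Sobolev space of dominating mixed smoothness of order one on `[0,1]^m`
(represented by its continuous version), and `D u = ∂_u F` for every `u ⊆ {1:m}`. The functions
`D u` are determined by `F` almost everywhere on the cube. -/
structure InSobolev {m : ℕ} (F : (Fin m → ℝ) → ℝ) (D : Finset (Fin m) → (Fin m → ℝ) → ℝ) :
    Prop where
  continuousOn : ContinuousOn F (unitCube m)
  isWeakMixedPartial : ∀ u, IsWeakMixedPartial u F (D u)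

/-- The point with coordinates `y_u` in `u` and `y_{-u}` outside `u`. -/
def glue {m : ℕ} (u : Finset (Fin m)) (yu : {j // j ∈ u} → ℝ) (yc : {j // j ∉ u} → ℝ) :
    Fin m → ℝ :=
  fun j => if h : j ∈ u then yu ⟨j, h⟩ else yc ⟨j, h⟩

/-- The norm of the weighted unanchored Sobolev space `W_{m,γ}`, in terms of the mixed
derivatives `D u = ∂_u F`:
`(∑_u γ_u⁻¹ ∫_{[0,1]^{|u|}} (∫_{[0,1]^{m-|u|}} ∂_u F(y) dy_{-u})² dy_u)^{1/2}`. -/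
noncomputable def sobolevNorm {m : ℕ} (γ : Finset (Fin m) → ℝ)
    (D : Finset (Fin m) → (Fin m → ℝ) → ℝ) : ℝ :=
  √(∑ u : Finset (Fin m), 1 / γ u *
      ∫ yu in Set.Icc (0 : {j // j ∈ u} → ℝ) 1,
        (∫ yc in Set.Icc (0 : {j // j ∉ u} → ℝ) 1, D u (glue u yu yc)) ^ 2)

/-! ### Randomly shifted lattice rules -/

/-- A family of generating vectors `z^{(ℓ)} ∈ {0, …, 2^ℓ - 1}^m`, one for each level `ℓ`. -/
abbrev GenVec (m : ℕ) : Type := (ℓ : ℕ) → Fin m → Fin (2 ^ ℓ)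

/-- The shifted lattice point `{t_i + Δ}` with `t_i = {i z / 2^ℓ}`; fractional parts are taken
componentwise. -/
noncomputable def latticePoint {m : ℕ} (z : GenVec m) (ℓ : ℕ) (Δ : Fin m → ℝ) (i : ℕ) :
    Fin m → ℝ :=
  fun j => Int.fract (Int.fract ((i : ℝ) * ((z ℓ j : ℕ) : ℝ) / (2 : ℝ) ^ ℓ) + Δ j)

/-- The lattice rule on `[0,1]^m` with `2^ℓ` points and shift `Δ`. -/
noncomputable def latticeRule {m : ℕ} (z : GenVec m) (ℓ : ℕ) (Δ : Fin m → ℝ)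
    (F : (Fin m → ℝ) → ℝ) : ℝ :=
  ((2 : ℝ) ^ ℓ)⁻¹ * ∑ i ∈ Finset.Icc 1 (2 ^ ℓ), F (latticePoint z ℓ Δ i)

/-- The root-mean-square `√(E[|X|²])`. -/
noncomputable def rms {S : Type*} [MeasurableSpace S] (μ : Measure S) (X : S → ℝ) : ℝ :=
  √(∫ x, |X x| ^ 2 ∂μ)

/-- The randomly shifted lattice rules with generating vectors `z` have R.M.S. error at most
`C 2^{-r ℓ} ‖F‖` for all `F ∈ W_{m,γ}` and all levels `ℓ`. -/
def HasRate {m : ℕ} (z : GenVec m) (γ : Finset (Fin m) → ℝ) (r : ℝ) : Prop :=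
  ∃ C : ℝ, 0 < C ∧ ∀ (ℓ : ℕ) (F : (Fin m → ℝ) → ℝ) (D : Finset (Fin m) → (Fin m → ℝ) → ℝ),
    InSobolev F D →
      rms (uniformCube m) (fun Δ => (∫ y in unitCube m, F y) - latticeRule z ℓ Δ F)
        ≤ C * (2 : ℝ) ^ (-(r * ℓ)) * sobolevNorm γ D

/-! ### The model problem -/

/-- The parameter domain `Θ_s = [-1/2, 1/2]^s`. -/
def paramCube (s : ℕ) : Set (Fin s → ℝ) := Set.Icc (fun _ => -(1 / 2)) fun _ => 1 / 2

/-- The partial derivative `∂^ν G` on the cube `Θ_s` (one-sided on the boundary): the direction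
`e_j` is used `ν j` times. -/
noncomputable def paramPartial {s k : ℕ} (ν : Fin s → ℕ)
    (G : (Fin s → ℝ) → EuclideanSpace ℝ (Fin k)) (θ : Fin s → ℝ) : EuclideanSpace ℝ (Fin k) :=
  iteratedFDerivWithin ℝ (∑ j, ν j) G (paramCube s) θ
    fun i => Pi.single (finSigmaFinEquiv.symm i).1 1

/-- Gevrey regularity of the forward model:
`‖∂^ν G(θ)‖ ≤ C (|ν|!)^β b^ν` for all `θ ∈ Θ_s` and all multi-indices `ν`. -/
def GevreyBound {s k : ℕ} (C β : ℝ) (b : ℕ → ℝ) (G : (Fin s → ℝ) → EuclideanSpace ℝ (Fin k)) :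
    Prop :=
  ContDiffOn ℝ ∞ G (paramCube s) ∧
  ∀ θ ∈ paramCube s, ∀ ν : Fin s → ℕ,
    ‖paramPartial ν G θ‖ ≤ C * ((∑ j, ν j).factorial : ℝ) ^ β * ∏ j : Fin s, b j ^ ν j

/-- `‖x‖_{Γ⁻¹} = √(xᵀ Γ⁻¹ x)`. -/
noncomputable def noiseNorm {k : ℕ} (Γ : Matrix (Fin k) (Fin k) ℝ) (x : Fin k → ℝ) : ℝ :=
  √(dotProduct x (Γ⁻¹.mulVec x))

/-- The likelihood `f(θ, y) = C_{k,Γ} exp(-½ ‖y - G(θ)‖²_{Γ⁻¹})`, where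
`C_{k,Γ} = 1 / (det (2πΓ))^{1/2}`. -/
noncomputable def likelihood {s k : ℕ} (Γ : Matrix (Fin k) (Fin k) ℝ)
    (G : (Fin s → ℝ) → EuclideanSpace ℝ (Fin k)) (θ : Fin s → ℝ) (y : Fin k → ℝ) : ℝ :=
  1 / √(((2 * Real.pi) • Γ).det) * Real.exp (-(1 / 2) * noiseNorm Γ (fun i => y i - G θ i) ^ 2)

/-- The truncated double integral `I_K`. -/
noncomputable def truncatedIntegral {s k : ℕ} (Γ : Matrix (Fin k) (Fin k) ℝ)
    (G : (Fin s → ℝ) → EuclideanSpace ℝ (Fin k)) (K : ℝ) : ℝ :=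
  ∫ y in Set.Icc (fun _ : Fin k => -K) (fun _ => K),
    Real.log (∫ θ in paramCube s, likelihood Γ G θ y) * ∫ θ in paramCube s, likelihood Γ G θ y

/-! ### Sparse tensor product cubature -/

/-- The nonlinearity `g(x) = x log x`. -/
noncomputable def entropyFun (x : ℝ) : ℝ := x * Real.log x

/-- The outer cubature operator at level `ℓ`: the shifted lattice rule scaled from `[0,1]^k` to
`[-K,K]^k`, a set of volume `(2K)^k`. -/
noncomputable def outerRule {k : ℕ} (z : GenVec k) (K : ℝ) (ℓ : ℕ) (Δ : Fin k → ℝ)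
    (F : (Fin k → ℝ) → ℝ) : ℝ :=
  (2 * K) ^ k * latticeRule z ℓ Δ fun x => F fun j => 2 * K * x j - K

/-- The inner cubature operator at level `ℓ` with offset `ℓ₀`: the shifted lattice rule with
`2^(ℓ + ℓ₀)` points, translated from `[0,1]^s` to `Θ_s`. -/
noncomputable def innerRule {s : ℕ} (z : GenVec s) (ℓ₀ ℓ : ℕ) (Δ : Fin s → ℝ)
    (H : (Fin s → ℝ) → ℝ) : ℝ :=
  latticeRule z (ℓ + ℓ₀) Δ fun x => H fun j => x j - 1 / 2

/-- The outer difference operator. -/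
noncomputable def outerDiff {k : ℕ} (z : GenVec k) (K : ℝ) (ℓ : ℕ) (Δ : Fin k → ℝ)
    (F : (Fin k → ℝ) → ℝ) : ℝ :=
  if ℓ = 0 then outerRule z K 0 Δ F else outerRule z K ℓ Δ F - outerRule z K (ℓ - 1) Δ F

/-- The generalized (nonlinear) inner difference operator. -/
noncomputable def innerDiff {s : ℕ} (z : GenVec s) (ℓ₀ ℓ : ℕ) (Δ : Fin s → ℝ)
    (H : (Fin s → ℝ) → ℝ) : ℝ :=
  if ℓ = 0 then entropyFun (innerRule z ℓ₀ 0 Δ H)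
  else entropyFun (innerRule z ℓ₀ ℓ Δ H) - entropyFun (innerRule z ℓ₀ (ℓ - 1) Δ H)

/-- The generalized sparse grid cubature operator
`Q_{L,σ}(f) = ∑_{σ ℓ₁ + ℓ₂ / σ ≤ L} Δ^{(1)}_{ℓ₁} Δ^{(2)}_{ℓ₂}(f)` for `σ > 0`; the box in which
the pairs `(ℓ₁, ℓ₂)` are filtered contains all of them. -/
noncomputable def sparseCubature {s k : ℕ} (z₁ : GenVec k) (z₂ : GenVec s) (K : ℝ) (ℓ₀ : ℕ)
    (σ : ℝ) (L : ℕ) (Δ₁ : Fin k → ℝ) (Δ₂ : Fin s → ℝ)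
    (f : (Fin s → ℝ) → (Fin k → ℝ) → ℝ) : ℝ :=
  ∑ p ∈ (Finset.range (⌊L / σ⌋₊ + 1) ×ˢ Finset.range (⌊σ * L⌋₊ + 1)).filter
      (fun p : ℕ × ℕ => σ * p.1 + p.2 / σ ≤ L),
    outerDiff z₁ K p.1 Δ₁ fun y => innerDiff z₂ ℓ₀ p.2 Δ₂ fun θ => f θ y

end QMC

namespace QMC

/-! ### Averaging over generating vectors -/

/-! Existence of good rules. As a function of the shift on the torus, the error of a lattice rule
has Fourier coefficients equal, up to sign, to those of `F` on the dual lattice and zero elsewhere,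
so by Parseval the mean square error is the sum of `|F̂(h)|²` over the dual lattice
(`integral_sq_lattice_error_le`). Testing the weak derivative over the active coordinates of `h`
against primitives of exponentials that vanish on the faces of the cube gives `|F̂(h)| ≤ c ‖F‖ / ∏
max(1, |h_j|)` (`norm_cubeCoeff_le`). What remains is the sum of `freqWeight ^ (-2)` over the dual
lattice. Averaging over all generating vectors shows that for each `q > 1` some vector makes the sum
with exponent `-q` of order `2^{-ℓ}`; raising it to the power `2/q` controls the exponent `-2`
(`exists_genVec_dualSum_le`).

Sparse error. For `σ = 1` the inner differences telescope and the cubature is `∑_{i ≤ L} Δ^{(1)}_i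
g(Q^{(2)}_{L-i} f)`. Its error is the outer error at level `L` for the exact integrand, plus the `L
+ 1` mixed terms `Δ^{(1)}_i [g(∫ f) - g(Q^{(2)}_{L-i} f)]`. If each mixed term has mean square of
order `2^{-2rL}`, Cauchy–Schwarz produces the factor `L + 1` (`exists_sparse_error_sq_le`).

Mixed terms. The likelihood depends on `y - G(θ)` only, so in unit cube coordinates both `∫ f` and
`Q^{(2)} f` are convolutions of one positive smooth function `Ψ` with a probability measure of
bounded support: the image of the uniform distribution, or an empirical measure. Both therefore stay
in a fixed interval `[c₀, c₁]` with `c₀ > 0`, where `g` is smooth, and their `x`-derivatives are the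
same averages of derivatives of `Ψ`. The derivatives of `g(X) - g(Y)` are bounded by those of `X -
Y` (`exists_comp_sub_bound`), which here are inner cubature errors for derivatives of `Ψ`, each of
rate `r`. The outer rate applied for a fixed inner shift, followed by Fubini, multiplies the two
rates (`exists_latticeDiff_sub_sq_le`).

Uniformity in `ξ`. The forward model enters only through derivative bounds on the cube, and these
are determined by the Gevrey constants (`exists_isAdmissible_unitModel`). -/

/-- The product weight `∏_j max(1, |h_j|)` of a frequency. -/
noncomputable def freqWeight {m : ℕ} (h : Fin m → ℤ) : ℝ := ∏ j, max 1 |(h j : ℝ)|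

/-- The frequencies `h ≠ 0` with `h · z ≡ 0 mod 2^ℓ`. -/
def dualLattice {m : ℕ} (ℓ : ℕ) (z : Fin m → Fin (2 ^ ℓ)) : Set (Fin m → ℤ) :=
  {h | h ≠ 0 ∧ ((2 ^ ℓ : ℕ) : ℤ) ∣ ∑ j, h j * ((z j : ℕ) : ℤ)}

/-- The nonzero frequencies all of whose entries are multiples of `2^t`. -/
def nonzeroMultiples (m t : ℕ) : Set (Fin m → ℤ) := {h | h ≠ 0 ∧ ∀ j, (2 ^ t : ℤ) ∣ h j}

/-- The sum of `freqWeight ^ (-q)` over the dual lattice. -/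
noncomputable def dualSum {m : ℕ} (ℓ : ℕ) (z : Fin m → Fin (2 ^ ℓ)) (q : ℝ) : ENNReal :=
  ∑' h, (dualLattice ℓ z).indicator (fun h => ENNReal.ofReal (freqWeight h ^ (-q))) h

lemma one_le_freqWeight {m : ℕ} (h : Fin m → ℤ) : 1 ≤ freqWeight h :=
  (Finset.prod_const_one (ι := Fin m) (M := ℝ) (s := Finset.univ)).ge.trans
    (Finset.prod_le_prod (fun _ _ => zero_le_one) fun _ _ => le_max_left _ _)

lemma freqWeight_pos {m : ℕ} (h : Fin m → ℤ) : 0 < freqWeight h :=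
  zero_lt_one.trans_le (one_le_freqWeight h)

lemma summable_prod_of_nonneg {a : ℤ → ℝ} (ha : ∀ n, 0 ≤ a n) (hs : Summable a) (m : ℕ) :
    Summable fun h : Fin m → ℤ => ∏ j, a (h j) := by
  induction m with
  | zero => exact (hasSum_fintype _).summable
  | succ m ih =>
    rw [← (Fin.consEquiv fun _ : Fin (m + 1) => ℤ).summable_iff]
    have := hs.mul_of_nonneg ih ha (fun h => Finset.prod_nonneg fun j _ => ha _)
    refine this.congr fun p => ?_
    simp [Fin.consEquiv, Fin.prod_univ_succ]

/-- The sum factors over the coordinates. Each factor is compared with `∑ |n|^{-q}`, which needs `q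
> 1`, plus an extra `1` for the frequency `0`. -/
lemma tsum_freqWeight_ne_top (m : ℕ) {q : ℝ} (hq : 1 < q) :
    ∑' h : Fin m → ℤ, ENNReal.ofReal (freqWeight h ^ (-q)) ≠ ⊤ := by
  have h1 : Summable fun n : ℤ => (max 1 |(n : ℝ)|) ^ (-q) := by
    have h2 : Summable fun n : ℤ => |(n : ℝ)| ^ (-q) + if n = 0 then (1 : ℝ) else 0 :=
      (Real.summable_abs_int_rpow hq).add
        (summable_of_hasFiniteSupport ((Set.finite_singleton (0 : ℤ)).subset fun n hn => by
          by_contra h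
          simp_all))
    refine h2.of_nonneg_of_le (fun n => by positivity) fun n => ?_
    rcases eq_or_ne n 0 with rfl | hn
    · have : (0 : ℝ) ≤ |((0 : ℤ) : ℝ)| ^ (-q) := by positivity
      simp only [Int.cast_zero, abs_zero, if_true] at *
      simpa using this
    · have : (1 : ℝ) ≤ |(n : ℝ)| := by exact_mod_cast Int.one_le_abs hn
      simp [max_eq_right this, hn]
  have h3 := summable_prod_of_nonneg (fun n => by positivity) h1 m
  have h4 : ∀ h : Fin m → ℤ, freqWeight h ^ (-q) = ∏ j, (max 1 |(h j : ℝ)|) ^ (-q) := fun h =>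
    (Real.finsetProd_rpow _ _ (fun _ _ => by positivity) _).symm
  simp_rw [h4]
  exact h3.tsum_ofReal_ne_top

/-- The vectors counted correspond to elements of the kernel of `x ↦ h · x` on `(ℤ/2^ℓ)^m`. Its
image has order `2^e`, so the kernel has `(2^ℓ)^m / 2^e` elements. Each `h j` lies in the image,
hence is killed by `2^e`, hence is divisible by `2^(ℓ - e)`; this is the `t`. Thus a frequency is
hit more often than the expected proportion `2^{-ℓ}` only as far as powers of two divide it. -/
lemma card_dual_mul_le {m : ℕ} (ℓ : ℕ) (h : Fin m → ℤ) :
    ∃ t ≤ ℓ, (∀ j, (2 ^ t : ℤ) ∣ h j) ∧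
      Nat.card {z : Fin m → Fin (2 ^ ℓ) // ((2 ^ ℓ : ℕ) : ℤ) ∣ ∑ j, h j * ((z j : ℕ) : ℤ)} * 2 ^ ℓ
        ≤ (2 ^ ℓ) ^ m * 2 ^ t := by
  classical
  let φ : (Fin m → ZMod (2 ^ ℓ)) →+ ZMod (2 ^ ℓ) :=
    { toFun := fun x => ∑ j, (h j : ZMod (2 ^ ℓ)) * x j
      map_zero' := by simp
      map_add' := fun x y => by simp [mul_add, Finset.sum_add_distrib] }
  have hcard : Nat.card φ.ker * Nat.card φ.range = (2 ^ ℓ) ^ m := by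
    rw [← AddSubgroup.index_ker, AddSubgroup.card_mul_index]
    simp
  have hdvd : Nat.card φ.range ∣ 2 ^ ℓ := by
    have := AddSubgroup.card_addSubgroup_dvd_card φ.range
    simpa using this
  obtain ⟨e, he, hde⟩ := (Nat.dvd_prime_pow Nat.prime_two).1 hdvd
  refine ⟨ℓ - e, Nat.sub_le _ _, fun j => ?_, ?_⟩
  · have hmem : (h j : ZMod (2 ^ ℓ)) ∈ φ.range := ⟨Pi.single j 1, by simp [φ, Pi.single_apply]⟩
    have h0 : (2 ^ e) • (h j : ZMod (2 ^ ℓ)) = 0 := by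
      have := card_nsmul_eq_zero' (x := (⟨_, hmem⟩ : φ.range))
      rw [hde] at this
      exact congrArg Subtype.val this
    have h1 : ((2 ^ e * h j : ℤ) : ZMod (2 ^ ℓ)) = 0 := by
      rw [← h0]; push_cast; simp
    rw [ZMod.intCast_zmod_eq_zero_iff_dvd] at h1
    have h2 : (2 ^ e * 2 ^ (ℓ - e) : ℤ) ∣ 2 ^ e * h j := by
      rw [← pow_add, Nat.add_sub_cancel' he]; exact_mod_cast h1
    exact (mul_dvd_mul_iff_left (by positivity)).1 h2
  · have hinj : Nat.card {z : Fin m → Fin (2 ^ ℓ) //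
        ((2 ^ ℓ : ℕ) : ℤ) ∣ ∑ j, h j * ((z j : ℕ) : ℤ)} ≤ Nat.card φ.ker := by
      refine Nat.card_le_card_of_injective
        (fun z => ⟨fun j => ((z.1 j : ℕ) : ZMod (2 ^ ℓ)), ?_⟩) ?_
      · have := (ZMod.intCast_zmod_eq_zero_iff_dvd _ _).2 z.2
        rw [AddMonoidHom.mem_ker]
        push_cast at this
        simpa [φ] using this
      · intro z w hzw
        ext j
        have := congrFun (congrArg Subtype.val hzw) j
        simp only at this
        rw [ZMod.natCast_eq_natCast_iff', Nat.mod_eq_of_lt (z.1 j).2,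
          Nat.mod_eq_of_lt (w.1 j).2] at this
        exact this
    calc _ ≤ Nat.card φ.ker * 2 ^ ℓ := Nat.mul_le_mul_right _ hinj
      _ = (Nat.card φ.ker * 2 ^ e) * 2 ^ (ℓ - e) := by
        rw [mul_assoc, ← pow_add, Nat.add_sub_cancel' he]
      _ = _ := by rw [← hde, hcard]

/-- Substitute `h = 2^t h'`. A single nonzero entry already multiplies the weight by at least `2^t`,
and this one gain is all that the geometric series over `t` requires. -/
lemma tsum_freqWeight_multiples_le (m t : ℕ) {q : ℝ} (hq : 0 ≤ q) :
    ∑' h : Fin m → ℤ, (nonzeroMultiples m t).indicator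
        (fun h => ENNReal.ofReal (freqWeight h ^ (-q))) h
      ≤ ENNReal.ofReal ((2 ^ t : ℝ) ^ (-q)) *
        ∑' h : Fin m → ℤ, ENNReal.ofReal (freqWeight h ^ (-q)) := by
  have hinj : Function.Injective fun (h : Fin m → ℤ) (j : Fin m) => (2 ^ t : ℤ) * h j := by
    intro a b hab
    ext j
    have := congrFun hab j
    exact mul_left_cancel₀ (by positivity) this
  rw [← hinj.tsum_eq, ← ENNReal.tsum_mul_left]
  · refine ENNReal.tsum_le_tsum fun h => ?_
    by_cases hh : (fun j => (2 ^ t : ℤ) * h j) ∈ nonzeroMultiples m t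
    swap
    · rw [Set.indicator_of_notMem hh]; exact zero_le
    rw [Set.indicator_of_mem hh]
    have hne : ∃ i, h i ≠ 0 := by
      by_contra! hc
      exact hh.1 (by ext j; simp [hc j])
    obtain ⟨i, hi⟩ := hne
    rw [← ENNReal.ofReal_mul (by positivity), ← Real.mul_rpow (by positivity)
      (freqWeight_pos h).le]
    refine ENNReal.ofReal_le_ofReal (Real.rpow_le_rpow_of_nonpos
      (mul_pos (by positivity) (freqWeight_pos h)) ?_ (by linarith))
    have h2 : (1 : ℝ) ≤ 2 ^ t := one_le_pow₀ (by norm_num)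
    rw [freqWeight, freqWeight, ← Finset.mul_prod_erase _ _ (Finset.mem_univ i),
      ← Finset.mul_prod_erase _ (fun j => max 1 |(((2 ^ t : ℤ) * h j : ℤ) : ℝ)|)
        (Finset.mem_univ i), ← mul_assoc]
    have h1i : (1 : ℝ) ≤ |(h i : ℝ)| := by exact_mod_cast Int.one_le_abs hi
    refine mul_le_mul ?_ (Finset.prod_le_prod (fun _ _ => by positivity) fun j hj =>
      max_le_max le_rfl ?_) (Finset.prod_nonneg fun _ _ => by positivity) (by positivity)
    · push_cast
      rw [abs_mul, max_eq_right h1i, abs_of_nonneg (by positivity : (0 : ℝ) ≤ 2 ^ t)]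
      exact le_max_right _ _
    · push_cast
      rw [abs_mul, abs_of_nonneg (by positivity : (0 : ℝ) ≤ 2 ^ t)]
      nlinarith [abs_nonneg (h j : ℝ)]
  · intro h hh
    have : h ∈ (nonzeroMultiples m t) := by
      by_contra hc
      exact hh (Set.indicator_of_notMem hc _)
    choose g hg using this.2
    exact ⟨g, by ext j; exact (hg j).symm⟩

/-- The mean over all generating vectors is at most `2^{-ℓ} ∑_t 2^{t(1-q)} S`, a convergent
geometric series for `q > 1`; some vector does no worse than the mean. -/
lemma exists_dualSum_le (m : ℕ) {q : ℝ} (hq : 1 < q) :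
    ∃ c : ENNReal, c ≠ ⊤ ∧ ∀ ℓ, ∃ z : Fin m → Fin (2 ^ ℓ), dualSum ℓ z q ≤ c / 2 ^ ℓ := by
  classical
  set S := ∑' h : Fin m → ℤ, ENNReal.ofReal (freqWeight h ^ (-q)) with hS
  -- The ratio combines `2^t`, from the excess of solutions `z`, with `2^{-qt}`, from the weights of
  -- multiples of `2^t`.
  set ρ : ENNReal := ENNReal.ofReal (2 ^ (1 - q)) with hρ
  have hρ1 : ρ < 1 := by
    rw [hρ, ENNReal.ofReal_lt_one]
    exact Real.rpow_lt_one_of_one_lt_of_neg (by norm_num) (by linarith)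
  refine ⟨(1 - ρ)⁻¹ * S, ENNReal.mul_ne_top (ENNReal.inv_ne_top.2
    (tsub_pos_of_lt hρ1).ne') (tsum_freqWeight_ne_top m hq), fun ℓ => ?_⟩
  have hN : (2 ^ ℓ : ENNReal) ≠ 0 := by positivity
  have hN' : (2 ^ ℓ : ENNReal) ≠ ⊤ := by finiteness
  have key : ∑ z : Fin m → Fin (2 ^ ℓ), dualSum ℓ z q
      ≤ ∑ _z : Fin m → Fin (2 ^ ℓ), ((1 - ρ)⁻¹ * S) / 2 ^ ℓ := by
    -- The `t` attached to `h` is replaced by the sum over all `t ≤ ℓ`, so that the sum over `h` can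
    -- be taken separately on each set of multiples.
    have hterm : ∀ h : Fin m → ℤ, (∑ z : Fin m → Fin (2 ^ ℓ),
        (dualLattice ℓ z).indicator (fun h => ENNReal.ofReal (freqWeight h ^ (-q))) h) ≤
        ((2 ^ ℓ) ^ m / 2 ^ ℓ) * ∑ t ∈ Finset.range (ℓ + 1), 2 ^ t *
          (nonzeroMultiples m t).indicator
            (fun h => ENNReal.ofReal (freqWeight h ^ (-q))) h := by
      intro h
      rcases eq_or_ne h 0 with rfl | hh
      · simp [dualLattice]
      obtain ⟨t, ht, hd, hc⟩ := card_dual_mul_le ℓ h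
      have h1 : (∑ z : Fin m → Fin (2 ^ ℓ), (dualLattice ℓ z).indicator
          (fun h => ENNReal.ofReal (freqWeight h ^ (-q))) h) =
          (Nat.card {z : Fin m → Fin (2 ^ ℓ) //
            ((2 ^ ℓ : ℕ) : ℤ) ∣ ∑ j, h j * ((z j : ℕ) : ℤ)} : ENNReal) *
            ENNReal.ofReal (freqWeight h ^ (-q)) := by
        simp only [Set.indicator_apply, dualLattice, Set.mem_ofPred_eq, hh, ne_eq, not_false_eq_true,
          true_and]
        rw [← Finset.sum_filter, Finset.sum_const, nsmul_eq_mul, Nat.card_eq_fintype_card,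
          Fintype.card_subtype]
      rw [h1]
      calc _ ≤ ((2 ^ ℓ) ^ m / 2 ^ ℓ * 2 ^ t) * ENNReal.ofReal (freqWeight h ^ (-q)) := by
            gcongr
            rw [div_eq_mul_inv, mul_right_comm, ← div_eq_mul_inv,
              ENNReal.le_div_iff_mul_le (Or.inl hN) (Or.inl hN')]
            exact_mod_cast hc
        _ = (2 ^ ℓ) ^ m / 2 ^ ℓ * (2 ^ t *
          (nonzeroMultiples m t).indicator
            (fun h => ENNReal.ofReal (freqWeight h ^ (-q))) h) := by
            rw [Set.indicator_of_mem (show h ∈ nonzeroMultiples m t from ⟨hh, hd⟩), mul_assoc]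
        _ ≤ _ := by
            gcongr
            exact Finset.single_le_sum (f := fun t => 2 ^ t *
              (nonzeroMultiples m t).indicator
              (fun h => ENNReal.ofReal (freqWeight h ^ (-q))) h) (fun _ _ => zero_le)
              (Finset.mem_range.2 (by omega))
    calc ∑ z : Fin m → Fin (2 ^ ℓ), dualSum ℓ z q
        = ∑' h, ∑ z : Fin m → Fin (2 ^ ℓ), (dualLattice ℓ z).indicator
            (fun h => ENNReal.ofReal (freqWeight h ^ (-q))) h :=
          (Summable.tsum_finsetSum fun _ _ => ENNReal.summable).symm
      _ ≤ ∑' h, _ := ENNReal.tsum_le_tsum hterm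
      _ = ((2 ^ ℓ) ^ m / 2 ^ ℓ) * ∑ t ∈ Finset.range (ℓ + 1), 2 ^ t *
          ∑' h, (nonzeroMultiples m t).indicator
            (fun h => ENNReal.ofReal (freqWeight h ^ (-q))) h := by
          rw [ENNReal.tsum_mul_left, Summable.tsum_finsetSum fun _ _ => ENNReal.summable]
          simp_rw [ENNReal.tsum_mul_left]
      _ ≤ ((2 ^ ℓ) ^ m / 2 ^ ℓ) * ∑ t ∈ Finset.range (ℓ + 1), ρ ^ t * S := by
          refine mul_le_mul_right (Finset.sum_le_sum fun t ht => ?_) _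
          calc _ ≤ 2 ^ t * (ENNReal.ofReal ((2 ^ t : ℝ) ^ (-q)) * S) := by
                gcongr
                exact tsum_freqWeight_multiples_le m t (by linarith)
            _ = ρ ^ t * S := by
                rw [← mul_assoc, hρ, ← ENNReal.ofReal_pow (by positivity)]
                congr 1
                rw [show (2 ^ t : ENNReal) = ENNReal.ofReal (2 ^ t) by
                  rw [ENNReal.ofReal_pow (by norm_num)]; norm_num,
                  ← ENNReal.ofReal_mul (by positivity)]
                congr 1
                rw [← Real.rpow_natCast, ← Real.rpow_natCast, ← Real.rpow_mul (by norm_num),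
                  ← Real.rpow_mul (by norm_num), ← Real.rpow_add (by norm_num)]
                ring_nf
      _ ≤ ((2 ^ ℓ) ^ m / 2 ^ ℓ) * ((1 - ρ)⁻¹ * S) := by
          gcongr
          rw [← Finset.sum_mul, ← ENNReal.tsum_geometric]
          gcongr
          exact ENNReal.sum_le_tsum _
      _ = _ := by
          rw [Finset.sum_const, nsmul_eq_mul]
          simp only [Finset.card_univ, Fintype.card_fun, Fintype.card_fin]
          push_cast
          rw [div_eq_mul_inv, div_eq_mul_inv]
          ring
  by_contra! hc
  exact key.not_gt (ENNReal.sum_lt_sum_of_nonempty Finset.univ_nonempty fun z _ => hc z)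

/-- For nonnegative terms and an exponent `p = 2/q ≥ 1`, `∑ a^p ≤ (∑ a)^p`: write `a^p = a ·
a^{p-1}` and bound the `a` in the second factor by the whole sum. -/
lemma dualSum_two_le {m : ℕ} (ℓ : ℕ) (z : Fin m → Fin (2 ^ ℓ)) {q : ℝ} (hq : 0 < q) (hq2 : q ≤ 2) :
    dualSum ℓ z 2 ≤ dualSum ℓ z q ^ (2 / q) := by
  have hp : 0 ≤ 2 / q - 1 := by rw [sub_nonneg, le_div_iff₀ hq]; linarith
  have hsplit : ∀ x : ENNReal, x ^ (2 / q) = x * x ^ (2 / q - 1) := fun x => by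
    have := ENNReal.rpow_add_of_nonneg (x := x) 1 (2 / q - 1) zero_le_one hp
    rwa [ENNReal.rpow_one, add_sub_cancel] at this
  rw [hsplit, dualSum, dualSum, ← ENNReal.tsum_mul_right]
  refine ENNReal.tsum_le_tsum fun h => ?_
  by_cases hh : h ∈ dualLattice ℓ z
  · have h1 : ENNReal.ofReal (freqWeight h ^ (-(2 : ℝ)))
        = ENNReal.ofReal (freqWeight h ^ (-q)) ^ (2 / q) := by
      rw [ENNReal.ofReal_rpow_of_pos (Real.rpow_pos_of_pos (freqWeight_pos h) _),
        ← Real.rpow_mul (freqWeight_pos h).le]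
      congr 2
      field_simp
    rw [Set.indicator_of_mem hh, Set.indicator_of_mem hh, h1, hsplit]
    gcongr
    refine le_trans ?_ (ENNReal.le_tsum h)
    rw [Set.indicator_of_mem hh]
  · simp [Set.indicator_of_notMem hh]

/-- The chosen vectors minimise the sum with exponent `-2`, a criterion free of `q`. One family
therefore serves every `q > 1`, and so every `δ`. -/
lemma exists_genVec_dualSum_le (m : ℕ) : ∃ z : GenVec m, ∀ q : ℝ, 1 < q → q ≤ 2 →
    ∃ c : ENNReal, c ≠ ⊤ ∧ ∀ ℓ, dualSum ℓ (z ℓ) 2 ≤ (c / 2 ^ ℓ) ^ (2 / q) := by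
  have hmin : ∀ ℓ : ℕ, ∃ z : Fin m → Fin (2 ^ ℓ), ∀ w, dualSum ℓ z 2 ≤ dualSum ℓ w 2 := fun ℓ =>
    Finite.exists_min _
  choose z hz using hmin
  refine ⟨z, fun q hq hq2 => ?_⟩
  obtain ⟨c, hc, h⟩ := exists_dualSum_le m hq
  refine ⟨c, hc, fun ℓ => ?_⟩
  obtain ⟨w, hw⟩ := h ℓ
  refine (hz ℓ w).trans ((dualSum_two_le ℓ w (by linarith) hq2).trans ?_)
  gcongr

/-! ### The cube -/

lemma volume_unitCube (m : ℕ) : volume (unitCube m) = 1 := by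
  simp [unitCube, Real.volume_Icc_pi]

instance (m : ℕ) : IsProbabilityMeasure (uniformCube m) :=
  ⟨by simp [uniformCube, volume_unitCube]⟩

instance (m : ℕ) : IsProbabilityMeasure (volume.restrict (unitCube m)) :=
  ⟨by simp [volume_unitCube]⟩

lemma isCompact_unitCube (m : ℕ) : IsCompact (unitCube m) := isCompact_Icc

lemma measurableSet_unitCube (m : ℕ) : MeasurableSet (unitCube m) := measurableSet_Icc

lemma openUnitCube_ae_eq (m : ℕ) : (openUnitCube m : Set (Fin m → ℝ)) =ᵐ[volume] unitCube m :=
  Measure.univ_pi_Ioo_ae_eq_Icc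

lemma isOpen_openUnitCube (m : ℕ) : IsOpen (openUnitCube m) :=
  isOpen_set_pi Set.finite_univ fun _ _ => isOpen_Ioo

lemma openUnitCube_subset (m : ℕ) : openUnitCube m ⊆ unitCube m := fun _ hy =>
  ⟨fun j => (hy j trivial).1.le, fun j => (hy j trivial).2.le⟩

lemma fract_mem_unitCube {m : ℕ} (x : Fin m → ℝ) : (fun j => Int.fract (x j)) ∈ unitCube m :=
  ⟨fun _ => Int.fract_nonneg _, fun _ => (Int.fract_lt_one _).le⟩

lemma latticePoint_mem {m : ℕ} (z : GenVec m) (ℓ : ℕ) (Δ : Fin m → ℝ) (i : ℕ) :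
    latticePoint z ℓ Δ i ∈ unitCube m := fract_mem_unitCube _

lemma measurable_latticePoint {m : ℕ} (z : GenVec m) (ℓ i : ℕ) :
    Measurable fun Δ => latticePoint z ℓ Δ i := by
  refine measurable_pi_lambda _ fun j => measurable_fract.comp ?_
  exact measurable_const.add (measurable_pi_apply j)

lemma ContinuousOn.measurable_indicator {m : ℕ} {E : Type*} [TopologicalSpace E] [Zero E]
    [MeasurableSpace E] [BorelSpace E] {F : (Fin m → ℝ) → E} {s : Set (Fin m → ℝ)}
    (hs : MeasurableSet s) (hF : ContinuousOn F s) : Measurable (s.indicator F) := by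
  classical
  rw [← Set.piecewise_eq_indicator]
  exact hF.measurable_piecewise continuousOn_const hs

/-! ### Fourier analysis of shifted lattice rules -/

/-- The Fourier coefficients of a function on the unit cube. -/
noncomputable def cubeCoeff {m : ℕ} (F : (Fin m → ℝ) → ℝ) (h : Fin m → ℤ) : ℂ :=
  ∫ y in unitCube m, (∏ j, Complex.exp (-(2 * Real.pi * Complex.I * h j * y j))) * F y

section Torus

attribute [local instance] instMeasureSpaceUnitAddCircle

local instance : Measure.IsAddHaarMeasure (volume : Measure UnitAddCircle) :=
  inferInstanceAs (Measure.IsAddHaarMeasure AddCircle.haarAddCircle)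

local instance : IsProbabilityMeasure (volume : Measure UnitAddCircle) :=
  inferInstanceAs (IsProbabilityMeasure AddCircle.haarAddCircle)

lemma integral_torus_eq {m : ℕ} {E : Type*} [NormedAddCommGroup E] [NormedSpace ℝ E]
    (f : UnitAddTorus (Fin m) → E) :
    ∫ x, f x = ∫ y in openUnitCube m, f fun j => (y j : UnitAddCircle) := by
  rw [UnitAddTorus.integral_preimage f 0]
  refine setIntegral_congr_set (Filter.EventuallyEq.trans ?_ (openUnitCube_ae_eq m).symm)
  have := Measure.univ_pi_Ioc_ae_eq_Icc (μ := fun _ : Fin m => (volume : Measure ℝ))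
    (f := fun _ => 0) (g := fun _ => 1)
  refine Filter.EventuallyEq.trans (Filter.EventuallyEq.of_eq ?_) this
  ext x
  change (∀ i, x i ∈ Set.Ioc ((0 : Fin m → ℝ) i) _) ↔ ∀ i ∈ Set.univ, _
  simp

/-- The representative in `[0,1)^m` of a point of the torus. -/
noncomputable def torusRep {m : ℕ} (x : UnitAddTorus (Fin m)) : Fin m → ℝ :=
  fun j => (AddCircle.equivIco 1 0 (x j) : ℝ)

lemma torusRep_coe {m : ℕ} (y : Fin m → ℝ) :
    torusRep (fun j => (y j : UnitAddCircle)) = fun j => Int.fract (y j) := by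
  ext j
  have := AddCircle.coe_equivIco_mk_apply (p := (1 : ℝ)) (y j)
  rw [div_one, mul_one] at this
  exact this

lemma torusRep_mem {m : ℕ} (x : UnitAddTorus (Fin m)) : torusRep x ∈ unitCube m :=
  ⟨fun j => (AddCircle.equivIco 1 0 (x j)).2.1,
    fun j => (AddCircle.equivIco (1 : ℝ) 0 (x j)).2.2.le.trans_eq (zero_add 1)⟩

lemma torusRep_coe_of_mem {m : ℕ} {y : Fin m → ℝ} (hy : y ∈ openUnitCube m) :
    torusRep (fun j => (y j : UnitAddCircle)) = y := by
  rw [torusRep_coe]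
  ext j
  exact Int.fract_eq_self.2 ⟨(hy j trivial).1.le, (hy j trivial).2⟩

lemma measurable_torusRep {m : ℕ} : Measurable (torusRep (m := m)) :=
  measurable_pi_lambda _ fun j => measurable_subtype_coe.comp
    ((AddCircle.measurableEquivIco 1 0).measurable.comp (measurable_pi_apply j))

lemma mFourier_add_apply {m : ℕ} (h : Fin m → ℤ) (x y : UnitAddTorus (Fin m)) :
    UnitAddTorus.mFourier h (x + y) = UnitAddTorus.mFourier h x * UnitAddTorus.mFourier h y := by
  simp only [UnitAddTorus.mFourier, ContinuousMap.coe_mk, ← Finset.prod_mul_distrib]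
  refine Finset.prod_congr rfl fun j _ => ?_
  simp only [fourier_apply, Pi.add_apply, smul_add, AddCircle.toCircle_add, Circle.coe_mul]

lemma norm_mFourier_apply {m : ℕ} (h : Fin m → ℤ) (x : UnitAddTorus (Fin m)) :
    ‖UnitAddTorus.mFourier h x‖ = 1 := by
  simp only [UnitAddTorus.mFourier, ContinuousMap.coe_mk, fourier_apply, norm_prod]
  exact Finset.prod_eq_one fun j _ => Circle.norm_coe _

/-- The lattice point `i z / 2^ℓ` on the torus. -/
noncomputable def torusPoint {m : ℕ} (z : GenVec m) (ℓ i : ℕ) : UnitAddTorus (Fin m) :=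
  fun j => (((i : ℝ) * ((z ℓ j : ℕ) : ℝ) / (2 : ℝ) ^ ℓ : ℝ) : UnitAddCircle)

/-- On the torus the fractional parts disappear and the shift acts as a translation, so the lattice
rule is an average of translates. -/
lemma latticePoint_eq_torusRep {m : ℕ} (z : GenVec m) (ℓ : ℕ) (Δ : Fin m → ℝ) (i : ℕ) :
    latticePoint z ℓ Δ i = torusRep ((fun j => (Δ j : UnitAddCircle)) + torusPoint z ℓ i) := by
  have : ((fun j => (Δ j : UnitAddCircle)) + torusPoint z ℓ i) =
      fun j => ((Δ j + (i : ℝ) * ((z ℓ j : ℕ) : ℝ) / (2 : ℝ) ^ ℓ : ℝ) : UnitAddCircle) := by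
    ext j; simp [torusPoint]
  rw [this, torusRep_coe]
  ext j
  rw [latticePoint, add_comm]
  refine Int.fract_eq_fract.2 ⟨-⌊(i : ℝ) * ((z ℓ j : ℕ) : ℝ) / (2 : ℝ) ^ ℓ⌋, ?_⟩
  rw [Int.fract]; push_cast; ring

lemma mFourier_torusPoint {m : ℕ} (z : GenVec m) (ℓ i : ℕ) (h : Fin m → ℤ) :
    UnitAddTorus.mFourier h (torusPoint z ℓ i) = Complex.exp
      (2 * Real.pi * Complex.I * (∑ j, h j * ((z ℓ j : ℕ) : ℤ) : ℤ) / (2 : ℂ) ^ ℓ) ^ i := by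
  simp only [UnitAddTorus.mFourier, torusPoint, ContinuousMap.coe_mk, fourier_coe_apply]
  rw [← Complex.exp_sum, ← Complex.exp_nat_mul]
  congr 1
  push_cast
  rw [Finset.mul_sum, Finset.sum_div, Finset.mul_sum]
  refine Finset.sum_congr rfl fun j _ => ?_
  ring

/-- A geometric sum over all powers of a `2^ℓ`-th root of unity different from `1`. -/
lemma sum_mFourier_torusPoint_eq_zero {m : ℕ} (z : GenVec m) (ℓ : ℕ) {h : Fin m → ℤ}
    (hh : ¬ ((2 ^ ℓ : ℕ) : ℤ) ∣ ∑ j, h j * ((z ℓ j : ℕ) : ℤ)) :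
    ∑ i ∈ Finset.Icc 1 (2 ^ ℓ), UnitAddTorus.mFourier h (torusPoint z ℓ i) = 0 := by
  simp_rw [mFourier_torusPoint]
  set a : ℤ := ∑ j, h j * ((z ℓ j : ℕ) : ℤ)
  set ζ := Complex.exp (2 * Real.pi * Complex.I * (a : ℤ) / (2 : ℂ) ^ ℓ) with hζ
  have h2 : (2 : ℂ) ^ ℓ ≠ 0 := pow_ne_zero _ two_ne_zero
  have h1 : ζ ≠ 1 := by
    rw [hζ, Ne, Complex.exp_eq_one_iff]
    rintro ⟨n, hn⟩
    refine hh ⟨n, ?_⟩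
    rw [div_eq_iff h2] at hn
    have h3 : (a : ℂ) = 2 ^ ℓ * n := by
      refine mul_left_cancel₀ Complex.two_pi_I_ne_zero ?_
      rw [hn]; ring
    exact_mod_cast h3
  have hN : ζ ^ (2 ^ ℓ) = 1 := by
    rw [hζ, ← Complex.exp_nat_mul]
    push_cast
    rw [mul_div_cancel₀ _ h2]
    exact Complex.exp_eq_one_iff.2 ⟨a, by ring⟩
  have hg := geom_sum_eq h1 (2 ^ ℓ)
  rw [hN, sub_self, zero_div] at hg
  rw [← Finset.Ico_succ_right_eq_Icc, Finset.sum_Ico_eq_sum_range]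
  simp [pow_add, ← Finset.mul_sum, hg]

/-- Translation multiplies the coefficient at `h` by a character value. Averaging over the lattice
points gives a factor of norm at most `1` on the dual lattice and `0` off it, while at `h = 0` the
exact integral cancels. Parseval in the shift finishes the argument. -/
lemma integral_sq_lattice_error_le {m : ℕ} (z : GenVec m) (ℓ : ℕ) {F : (Fin m → ℝ) → ℝ}
    (hF : ContinuousOn F (unitCube m)) {B : ℝ}
    (hc : ∀ h : Fin m → ℤ, h ≠ 0 → ‖cubeCoeff F h‖ ≤ B * (freqWeight h)⁻¹) :
    ENNReal.ofReal (∫ Δ, |(∫ y in unitCube m, F y) - latticeRule z ℓ Δ F| ^ 2 ∂uniformCube m)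
      ≤ ENNReal.ofReal (B ^ 2) * dualSum ℓ (z ℓ) 2 := by
  obtain ⟨M, hM⟩ := (isCompact_unitCube m).exists_bound_of_continuousOn hF
  -- The periodic extension of `F` may jump across the faces of the cube; it is bounded and
  -- measurable, which is enough for `L²`.
  set T : UnitAddTorus (Fin m) → ℂ := fun x => (F (torusRep x) : ℂ) with hT
  have hTm : Measurable T := by
    have h1 : T = fun x => (((unitCube m).indicator F (torusRep x) : ℝ) : ℂ) := by
      ext x; rw [Set.indicator_of_mem (torusRep_mem x)]
    rw [h1]
    exact Complex.measurable_ofReal.comp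
      ((ContinuousOn.measurable_indicator (measurableSet_unitCube m) hF).comp measurable_torusRep)
  have hTb : ∀ x, ‖T x‖ ≤ M := fun x => by
    simpa [hT] using hM _ (torusRep_mem x)
  have hTi : ∀ τ, Integrable fun x => T (x + τ) := fun τ =>
    Integrable.of_bound (hTm.comp (measurable_add_const τ)).aestronglyMeasurable M
      (Filter.Eventually.of_forall fun x => hTb _)
  set I : ℝ := ∫ y in unitCube m, F y with hI
  have hIT : ∫ x, T x = I := by
    rw [integral_torus_eq, hI, ← setIntegral_congr_set (openUnitCube_ae_eq m),
      ← integral_complex_ofReal]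
    refine setIntegral_congr_fun (isOpen_openUnitCube m).measurableSet fun y hy => ?_
    simp only [hT, torusRep_coe_of_mem hy]
  set S : UnitAddTorus (Fin m) → ℂ := fun x =>
    I - ((2 : ℂ) ^ ℓ)⁻¹ * ∑ i ∈ Finset.Icc 1 (2 ^ ℓ), T (x + torusPoint z ℓ i) with hS
  have hSm : Measurable S := measurable_const.sub (measurable_const.mul
    (Finset.measurable_sum _ fun i _ => hTm.comp (measurable_add_const _)))
  have hSb : ∀ x, ‖S x‖ ≤ ‖(I : ℂ)‖ + ‖((2 : ℂ) ^ ℓ)⁻¹‖ * ∑ i ∈ Finset.Icc 1 (2 ^ ℓ), M := fun x => by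
    refine (norm_sub_le _ _).trans (add_le_add le_rfl ?_)
    rw [norm_mul]
    exact mul_le_mul_of_nonneg_left (norm_sum_le_of_le _ fun i _ => hTb _) (norm_nonneg _)
  have hSL : MemLp S 2 volume :=
    MemLp.of_bound hSm.aestronglyMeasurable _ (Filter.Eventually.of_forall hSb)
  have hP := UnitAddTorus.hasSum_sq_mFourierCoeff (hSL.toLp S)
  have hcoe : ∀ h, UnitAddTorus.mFourierCoeff (hSL.toLp S) h = UnitAddTorus.mFourierCoeff S h :=
    fun h => integral_congr_ae (by
      filter_upwards [hSL.coeFn_toLp] with x hx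
      rw [hx])
  have hint : ∫ x, ‖hSL.toLp S x‖ ^ 2 =
      ∫ Δ, |I - latticeRule z ℓ Δ F| ^ 2 ∂uniformCube m := by
    rw [integral_congr_ae (g := fun x => ‖S x‖ ^ 2) (by
      filter_upwards [hSL.coeFn_toLp] with x hx
      rw [hx]), integral_torus_eq, uniformCube,
      ← setIntegral_congr_set (openUnitCube_ae_eq m)]
    refine setIntegral_congr_fun (isOpen_openUnitCube m).measurableSet fun y hy => ?_
    simp only [hS, hT, latticeRule, latticePoint_eq_torusRep]
    rw [← Real.norm_eq_abs, ← Complex.norm_real]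
    push_cast
    rfl
  rw [hint] at hP
  simp_rw [hcoe] at hP
  rw [← hP.tsum_eq, ENNReal.ofReal_tsum_of_nonneg (fun _ => by positivity) hP.summable, dualSum,
    ← ENNReal.tsum_mul_left]
  refine ENNReal.tsum_le_tsum fun h => ?_
  have hmi : ∀ τ, Integrable fun x => UnitAddTorus.mFourier (-h) x * T (x + τ) := fun τ =>
    (hTi τ).bdd_mul (c := 1) (UnitAddTorus.mFourier (-h)).continuous.aestronglyMeasurable
      (Filter.Eventually.of_forall fun x => (norm_mFourier_apply _ _).le)
  have hmc : ∫ x, UnitAddTorus.mFourier (-h) x = if h = 0 then 1 else 0 := by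
    have h1 := (UnitAddTorus.orthonormal_mFourier (d := Fin m))
    rw [orthonormal_iff_ite] at h1
    have h2 := h1 h 0
    rw [ContinuousMap.inner_toLp] at h2
    rw [← h2]
    refine integral_congr_ae (Filter.Eventually.of_forall fun x => ?_)
    simp [UnitAddTorus.mFourier_neg, UnitAddTorus.mFourier_zero]
  have hshift : ∀ τ, ∫ x, UnitAddTorus.mFourier (-h) x * T (x + τ) =
      UnitAddTorus.mFourier h τ * cubeCoeff F h := by
    intro τ
    have h1 : ∫ x, UnitAddTorus.mFourier (-h) x * T x = cubeCoeff F h := by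
      rw [integral_torus_eq, cubeCoeff, ← setIntegral_congr_set (openUnitCube_ae_eq m)]
      refine setIntegral_congr_fun (isOpen_openUnitCube m).measurableSet fun y hy => ?_
      simp only [hT, torusRep_coe_of_mem hy, UnitAddTorus.mFourier, ContinuousMap.coe_mk,
        fourier_coe_apply]
      congr 1
      refine Finset.prod_congr rfl fun j _ => ?_
      congr 1
      simp
    rw [← h1, ← integral_const_mul, ← integral_add_right_eq_self
      (fun x => UnitAddTorus.mFourier h τ * (UnitAddTorus.mFourier (-h) x * T x)) τ]
    refine integral_congr_ae (Filter.Eventually.of_forall fun x => ?_)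
    simp only
    rw [mFourier_add_apply]
    have h2 : UnitAddTorus.mFourier (-h) τ * UnitAddTorus.mFourier h τ = 1 := by
      rw [← UnitAddTorus.mFourier_add]; simp [UnitAddTorus.mFourier_zero]
    linear_combination (-(UnitAddTorus.mFourier (-h) x * T (x + τ))) * h2
  have hcoef : UnitAddTorus.mFourierCoeff S h = (I * if h = 0 then 1 else 0) -
      (((2 : ℂ) ^ ℓ)⁻¹ * ∑ i ∈ Finset.Icc 1 (2 ^ ℓ),
        UnitAddTorus.mFourier h (torusPoint z ℓ i)) * cubeCoeff F h := by
    have h1 : ∀ x, UnitAddTorus.mFourier (-h) x • S x = I * UnitAddTorus.mFourier (-h) x -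
        ((2 : ℂ) ^ ℓ)⁻¹ * ∑ i ∈ Finset.Icc 1 (2 ^ ℓ),
          UnitAddTorus.mFourier (-h) x * T (x + torusPoint z ℓ i) := fun x => by
      simp only [hS, smul_eq_mul, ← Finset.mul_sum]; ring
    rw [UnitAddTorus.mFourierCoeff]
    simp_rw [h1]
    rw [integral_sub, integral_const_mul, integral_const_mul, hmc, integral_finsetSum]
    · simp_rw [hshift]
      rw [← Finset.sum_mul, mul_assoc]
    · exact fun i _ => hmi _
    · refine Integrable.const_mul ?_ _
      exact Integrable.of_bound (UnitAddTorus.mFourier (-h)).continuous.aestronglyMeasurable 1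
        (Filter.Eventually.of_forall fun x => (norm_mFourier_apply _ _).le)
    · exact (integrable_finsetSum _ fun i _ => hmi _).const_mul _
  have hav : ‖((2 : ℂ) ^ ℓ)⁻¹ * ∑ i ∈ Finset.Icc 1 (2 ^ ℓ),
      UnitAddTorus.mFourier h (torusPoint z ℓ i)‖ ≤ 1 := by
    rw [norm_mul, norm_inv, norm_pow, Complex.norm_ofNat, inv_mul_le_iff₀ (by positivity)]
    refine (norm_sum_le_of_le _ fun i _ => (norm_mFourier_apply _ _).le).trans ?_
    simp
  rcases eq_or_ne h 0 with rfl | hh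
  · have h1 : cubeCoeff F 0 = I := by
      rw [← hIT]
      have := hshift 0
      simpa [UnitAddTorus.mFourier_zero] using this.symm
    have h2 : UnitAddTorus.mFourierCoeff S 0 = 0 := by
      rw [hcoef, h1]
      simp [UnitAddTorus.mFourier_zero]
    simp [h2]
  · rw [if_neg hh, mul_zero, zero_sub] at hcoef
    by_cases hd : ((2 ^ ℓ : ℕ) : ℤ) ∣ ∑ j, h j * ((z ℓ j : ℕ) : ℤ)
    · rw [Set.indicator_of_mem (show h ∈ dualLattice ℓ (z ℓ) from ⟨hh, hd⟩),
        ← ENNReal.ofReal_mul (by positivity)]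
      refine ENNReal.ofReal_le_ofReal ?_
      have h1 : freqWeight h ^ (-(2 : ℝ)) = ((freqWeight h)⁻¹) ^ 2 := by
        rw [Real.rpow_neg (freqWeight_pos h).le, inv_pow]
        norm_num
      rw [h1, ← mul_pow, hcoef, norm_neg, norm_mul]
      have := mul_le_mul hav (hc h hh) (norm_nonneg _) zero_le_one
      rw [one_mul] at this
      gcongr
    · rw [sum_mFourier_torusPoint_eq_zero z ℓ hd] at hcoef
      simp [hcoef]

end Torus

/-! ### Square integrals -/

/-- Nonnegativity of the variance. -/
lemma sq_integral_le {α : Type*} [MeasurableSpace α] (μ : Measure α) [IsProbabilityMeasure μ]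
    {f : α → ℝ} (hf : MemLp f 2 μ) : (∫ x, f x ∂μ) ^ 2 ≤ ∫ x, f x ^ 2 ∂μ := by
  have h1 : Integrable f μ := hf.integrable one_le_two
  have h2 : Integrable (fun x => f x ^ 2) μ := hf.integrable_sq
  set c := ∫ x, f x ∂μ
  have h3 : 0 ≤ ∫ x, (f x - c) ^ 2 ∂μ := integral_nonneg fun x => sq_nonneg _
  have h4 : ∫ x, (f x - c) ^ 2 ∂μ = ∫ x, f x ^ 2 ∂μ - 2 * c * c + c ^ 2 := by
    have : ∀ x, (f x - c) ^ 2 = f x ^ 2 - 2 * c * f x + c ^ 2 := fun x => by ring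
    simp_rw [this]
    have h5 : Integrable (fun x => 2 * c * f x) μ := h1.const_mul _
    have h6 : Integrable (fun x => f x ^ 2 - 2 * c * f x) μ := h2.sub h5
    rw [integral_add h6 (integrable_const _), integral_sub h2 h5, integral_const_mul]
    simp [c]
  nlinarith

lemma memLp_integral_prod {α β : Type*} [MeasurableSpace α] [MeasurableSpace β] (μ : Measure α)
    (ν : Measure β) [IsProbabilityMeasure μ] [IsProbabilityMeasure ν] {f : α × β → ℝ}
    (hf : MemLp f 2 (μ.prod ν)) :
    MemLp (fun x => ∫ y, f (x, y) ∂ν) 2 μ ∧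
      ∫ x, (∫ y, f (x, y) ∂ν) ^ 2 ∂μ ≤ ∫ p, f p ^ 2 ∂(μ.prod ν) := by
  have h1 : Integrable f (μ.prod ν) := hf.integrable one_le_two
  have h2 : Integrable (fun p => f p ^ 2) (μ.prod ν) := hf.integrable_sq
  have hm : AEStronglyMeasurable (fun x => ∫ y, f (x, y) ∂ν) μ :=
    h1.aestronglyMeasurable.integral_prod_right'
  have hle : ∀ᵐ x ∂μ, (∫ y, f (x, y) ∂ν) ^ 2 ≤ ∫ y, f (x, y) ^ 2 ∂ν := by
    filter_upwards [h1.prod_right_ae, h2.prod_right_ae] with x hx1 hx2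
    exact sq_integral_le ν ((memLp_two_iff_integrable_sq hx1.aestronglyMeasurable).2 hx2)
  have h3 := h2.integral_prod_left
  have h4 : Integrable (fun x => (∫ y, f (x, y) ∂ν) ^ 2) μ :=
    h3.mono' (hm.pow 2) (by
      filter_upwards [hle] with x hx
      rwa [Real.norm_eq_abs, abs_of_nonneg (sq_nonneg _)])
  refine ⟨(memLp_two_iff_integrable_sq hm).2 h4, ?_⟩
  rw [integral_prod _ h2]
  exact integral_mono_ae h4 h3 hle

instance {ι : Type*} [Fintype ι] :
    IsProbabilityMeasure (volume.restrict (Set.Icc (0 : ι → ℝ) 1)) :=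
  ⟨by simp [Real.volume_Icc_pi]⟩

/-- Makes the nested integrals in `sobolevNorm` accessible to Fubini on the cube. -/
lemma measurePreserving_glue {m : ℕ} (u : Finset (Fin m)) :
    MeasurePreserving (fun p : ({j // j ∈ u} → ℝ) × ({j // j ∉ u} → ℝ) => glue u p.1 p.2)
      ((volume.restrict (Set.Icc 0 1)).prod (volume.restrict (Set.Icc 0 1)))
      (volume.restrict (unitCube m)) := by
  have h := (volume_preserving_piEquivPiSubtypeProd (fun _ : Fin m => ℝ) (· ∈ u)).symm
  have h2 := h.restrict_preimage (measurableSet_unitCube m)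
  rw [Measure.prod_restrict]
  have hset : (MeasurableEquiv.piEquivPiSubtypeProd (fun _ : Fin m => ℝ) (· ∈ u)).symm ⁻¹'
      unitCube m = Set.Icc 0 1 ×ˢ Set.Icc 0 1 := by
    refine Set.ext fun p => ⟨fun h => ?_, fun h => ?_⟩
    · have h1 : ∀ j, 0 ≤ glue u p.1 p.2 j := h.1
      have h2 : ∀ j, glue u p.1 p.2 j ≤ 1 := h.2
      refine ⟨⟨fun j => ?_, fun j => ?_⟩, fun j => ?_, fun j => ?_⟩
      · exact (h1 j.1).trans_eq (dif_pos j.2)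
      · exact (dif_pos j.2).symm.trans_le (h2 j.1)
      · exact (h1 j.1).trans_eq (dif_neg j.2)
      · exact (dif_neg j.2).symm.trans_le (h2 j.1)
    · obtain ⟨⟨h1, h2⟩, h3, h4⟩ := h
      change 0 ≤ glue u p.1 p.2 ∧ glue u p.1 p.2 ≤ 1
      constructor <;> intro j <;> by_cases hj : j ∈ u
      · rw [glue, dif_pos hj]
        exact h1 ⟨j, hj⟩
      · rw [glue, dif_neg hj]
        exact h3 ⟨j, hj⟩
      · exact (dif_pos hj).trans_le (h2 ⟨j, hj⟩)
      · exact (dif_neg hj).trans_le (h4 ⟨j, hj⟩)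
  rw [hset] at h2
  have hfun : (fun p : ({j // j ∈ u} → ℝ) × ({j // j ∉ u} → ℝ) => glue u p.1 p.2) =
    (MeasurableEquiv.piEquivPiSubtypeProd (fun _ : Fin m => ℝ) (· ∈ u)).symm := rfl
  rw [hfun, ← Measure.volume_eq_prod]
  convert h2
  rfl

/-! ### Mixed derivatives of products -/

lemma fderiv_prod_single {m : ℕ} (a : Fin m → ℝ → ℂ) (ha : ∀ j, Differentiable ℝ (a j))
    (y : Fin m → ℝ) (i : Fin m) :
    fderiv ℝ (fun y : Fin m → ℝ => ∏ j, a j (y j)) y (Pi.single i 1)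
      = ∏ j, (if j = i then deriv (a j) else a j) (y j) := by
  classical
  have h : HasFDerivAt (fun y : Fin m → ℝ => ∏ j, a j (y j))
      (∑ i, (∏ j ∈ Finset.univ.erase i, a j (y j)) •
        ((ContinuousLinearMap.toSpanSingleton ℝ (deriv (a i) (y i))).comp
          (ContinuousLinearMap.proj i : (Fin m → ℝ) →L[ℝ] ℝ))) y := by
    refine HasFDerivAt.finsetProd fun j _ => ?_
    exact ((ha j (y j)).hasDerivAt.hasFDerivAt).comp y (hasFDerivAt_apply j y)
  rw [h.fderiv, sum_apply, Finset.sum_eq_single i]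
  · rw [← Finset.mul_prod_erase _ _ (Finset.mem_univ i)]
    simp only [smul_apply, ContinuousLinearMap.comp_apply,
      ContinuousLinearMap.proj_apply, Pi.single_eq_same,
      ContinuousLinearMap.toSpanSingleton_apply, one_smul, if_true, smul_eq_mul]
    rw [mul_comm]
    congr 1
    refine Finset.prod_congr rfl fun j hj => ?_
    rw [if_neg (Finset.ne_of_mem_erase hj)]
  · intro j _ hj
    simp [Pi.single_eq_of_ne hj]
  · simp

/-- Since `v` is injective, each variable is differentiated at most once and only first derivatives
of the factors occur. -/
lemma iteratedFDeriv_prod {m n : ℕ} (a : Fin m → ℝ → ℂ) (ha : ∀ j, ContDiff ℝ ∞ (a j))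
    (v : Fin n → Fin m) (hv : Function.Injective v) (y : Fin m → ℝ) :
    iteratedFDeriv ℝ n (fun y : Fin m → ℝ => ∏ j, a j (y j)) y (fun i => Pi.single (v i) 1)
      = ∏ j, (if j ∈ Finset.univ.image v then deriv (a j) else a j) (y j) := by
  induction n generalizing y with
  | zero => simp
  | succ n ih =>
    have hs : ContDiff ℝ ∞ (fun y : Fin m → ℝ => ∏ j, a j (y j)) :=
      contDiff_prod fun j _ => (ha j).comp (contDiff_apply ℝ ℝ j)
    have hd : Differentiable ℝ (iteratedFDeriv ℝ n (fun y : Fin m → ℝ => ∏ j, a j (y j))) :=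
      hs.differentiable_iteratedFDeriv (by exact_mod_cast WithTop.coe_lt_top n)
    rw [(hd y).iteratedFDeriv_succ_apply_left']
    have htail : Fin.tail (fun i => (Pi.single (v i) 1 : Fin m → ℝ))
        = fun i => Pi.single (Fin.tail v i) 1 := rfl
    rw [htail]
    simp_rw [ih (Fin.tail v) (hv.comp (Fin.succ_injective n))]
    rw [fderiv_prod_single]
    · refine Finset.prod_congr rfl fun j _ => ?_
      have h0 : v 0 ∉ Finset.univ.image (Fin.tail v) := by
        simp only [Finset.mem_image, Finset.mem_univ, true_and, not_exists]
        exact fun i hi => Fin.succ_ne_zero i (hv hi)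
      have h1 : Finset.univ.image v = insert (v 0) (Finset.univ.image (Fin.tail v)) := by
        ext x
        simp [Fin.exists_fin_succ, Fin.tail, eq_comm]
      have h2 : j ∈ Finset.univ.image v ↔ j = v 0 ∨ j ∈ Finset.univ.image (Fin.tail v) := by
        rw [h1, Finset.mem_insert]
      by_cases hj : j = v 0
      · rw [if_pos hj, if_pos (h2.2 (Or.inl hj)), if_neg (hj ▸ h0)]
      · simp only [hj, h2, false_or, if_false]
    · intro j
      split_ifs
      · exact ((contDiff_infty_iff_deriv.1 (ha j)).2).differentiable (by simp)
      · exact (ha j).differentiable (by simp)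

/-! ### Test functions -/

open Filter Topology

/-- The primitive of `t ↦ exp (-2πi h t)` that vanishes at the integers. -/
noncomputable def fourierKernel (h : ℤ) (t : ℝ) : ℂ :=
  (1 - Complex.exp (-(2 * Real.pi * Complex.I * h * t))) / (2 * Real.pi * Complex.I * h)

lemma two_pi_I_mul_ne_zero {h : ℤ} (hh : h ≠ 0) : (2 * Real.pi * Complex.I * h : ℂ) ≠ 0 :=
  mul_ne_zero Complex.two_pi_I_ne_zero (by exact_mod_cast hh)

lemma contDiff_fourierKernel (h : ℤ) : ContDiff ℝ ∞ (fourierKernel h) := by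
  have h1 : ContDiff ℝ ∞ fun t : ℝ => (t : ℂ) := Complex.ofRealCLM.contDiff
  unfold fourierKernel
  exact (contDiff_const.sub (contDiff_const.mul h1).neg.cexp).div_const _

lemma hasDerivAt_fourierKernel {h : ℤ} (hh : h ≠ 0) (t : ℝ) :
    HasDerivAt (fourierKernel h) (Complex.exp (-(2 * Real.pi * Complex.I * h * t))) t := by
  have h0 := two_pi_I_mul_ne_zero hh
  have h1 : HasDerivAt (fun t : ℝ => -(2 * Real.pi * Complex.I * h * (t : ℂ)))
      (-(2 * Real.pi * Complex.I * h * 1)) t :=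
    ((Complex.ofRealCLM.hasDerivAt (x := t)).const_mul _).neg
  have h2 := ((h1.cexp).const_sub 1).div_const (2 * Real.pi * Complex.I * h)
  refine h2.congr_deriv ?_
  rw [div_eq_iff h0]
  ring

lemma norm_exp_eq_one (h : ℤ) (t : ℝ) :
    ‖Complex.exp (-(2 * Real.pi * Complex.I * h * t))‖ = 1 := by
  rw [show (-(2 * Real.pi * Complex.I * h * t) : ℂ) = ((-(2 * Real.pi * h * t) : ℝ) : ℂ) *
    Complex.I by push_cast; ring, Complex.norm_exp_ofReal_mul_I]

lemma norm_two_pi_I_mul (h : ℤ) : ‖(2 * Real.pi * Complex.I * h : ℂ)‖ = 2 * Real.pi * |(h : ℝ)| := by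
  simp [abs_of_pos Real.pi_pos]

lemma norm_fourierKernel_le_inv {h : ℤ} (hh : h ≠ 0) (t : ℝ) :
    ‖fourierKernel h t‖ ≤ (max 1 |(h : ℝ)|)⁻¹ := by
  have h1 : (1 : ℝ) ≤ |(h : ℝ)| := by exact_mod_cast Int.one_le_abs hh
  rw [fourierKernel, norm_div, norm_two_pi_I_mul, max_eq_right h1, div_le_iff₀ (by positivity)]
  have h2 : ‖1 - Complex.exp (-(2 * Real.pi * Complex.I * h * t))‖ ≤ 2 := by
    refine (norm_sub_le _ _).trans ?_
    rw [norm_exp_eq_one]; norm_num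
  have h3 : (|(h : ℝ)|)⁻¹ * (2 * Real.pi * |(h : ℝ)|) = 2 * Real.pi := by field_simp
  rw [h3]
  linarith [Real.pi_gt_three]

/-- Linear vanishing at `0`, and by periodicity at `1`, is what pays for the steep derivative of the
cutoff near the faces. -/
lemma norm_fourierKernel_le_abs {h : ℤ} (hh : h ≠ 0) (t : ℝ) : ‖fourierKernel h t‖ ≤ |t| := by
  have h1 : (1 : ℝ) ≤ |(h : ℝ)| := by exact_mod_cast Int.one_le_abs hh
  rw [fourierKernel, norm_div, norm_two_pi_I_mul, div_le_iff₀ (by positivity), norm_sub_rev]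
  have h2 := Real.norm_exp_I_mul_ofReal_sub_one_le (x := -(2 * Real.pi * h * t))
  rw [show (-(2 * Real.pi * Complex.I * h * t) : ℂ) = Complex.I * ((-(2 * Real.pi * h * t) : ℝ) : ℂ)
    by push_cast; ring]
  refine h2.trans_eq ?_
  rw [Real.norm_eq_abs, abs_neg, abs_mul, abs_mul, abs_of_pos (by positivity : 0 < 2 * Real.pi)]
  ring

lemma norm_fourierKernel_le_abs_one_sub {h : ℤ} (hh : h ≠ 0) (t : ℝ) :
    ‖fourierKernel h t‖ ≤ |1 - t| := by
  have h1 : fourierKernel h t = fourierKernel h (t - 1) := by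
    rw [fourierKernel, fourierKernel, show (-(2 * Real.pi * Complex.I * h * ((t - 1 : ℝ) : ℂ)) : ℂ)
      = -(2 * Real.pi * Complex.I * h * t) + h * (2 * Real.pi * Complex.I) by push_cast; ring,
      Complex.exp_add, Complex.exp_int_mul_two_pi_mul_I, mul_one]
  rw [h1, abs_sub_comm]
  exact norm_fourierKernel_le_abs hh _

lemma exists_deriv_smoothTransition_le : ∃ C, ∀ x, |deriv Real.smoothTransition x| ≤ C := by
  have hc : Continuous (deriv Real.smoothTransition) :=
    Real.smoothTransition.contDiff.continuous_deriv (n := 1) le_rfl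
  obtain ⟨C, hC⟩ := (isCompact_Icc (a := (0 : ℝ)) (b := 1)).exists_bound_of_continuousOn
    hc.continuousOn
  have hC0 : 0 ≤ C := (norm_nonneg _).trans (hC 0 (by simp))
  refine ⟨C, fun x => ?_⟩
  rcases lt_or_ge x 0 with hx | hx
  · have : Real.smoothTransition =ᶠ[𝓝 x] fun _ => (0 : ℝ) := by
      filter_upwards [gt_mem_nhds hx] with y hy
      exact Real.smoothTransition.zero_of_nonpos hy.le
    rw [this.deriv_eq]
    simpa using hC0
  rcases lt_or_ge 1 x with hx1 | hx1
  · have : Real.smoothTransition =ᶠ[𝓝 x] fun _ => (1 : ℝ) := by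
      filter_upwards [lt_mem_nhds hx1] with y hy
      exact Real.smoothTransition.one_of_one_le hy.le
    rw [this.deriv_eq]
    simpa using hC0
  · exact hC x ⟨hx, hx1⟩

/-- A smooth cutoff supported in `[1/(n+1), 1-1/(n+1)]`. -/
noncomputable def cutoff (n : ℕ) (t : ℝ) : ℝ :=
  Real.smoothTransition ((n + 1) * t - 1) * Real.smoothTransition ((n + 1) * (1 - t) - 1)

lemma contDiff_cutoff (n : ℕ) : ContDiff ℝ ∞ (cutoff n) := by
  unfold cutoff
  refine (Real.smoothTransition.contDiff.comp ?_).mul (Real.smoothTransition.contDiff.comp ?_)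
  · fun_prop
  · fun_prop

lemma abs_cutoff_le (n : ℕ) (t : ℝ) : |cutoff n t| ≤ 1 := by
  rw [cutoff, abs_of_nonneg (mul_nonneg (Real.smoothTransition.nonneg _)
    (Real.smoothTransition.nonneg _))]
  exact mul_le_one₀ (Real.smoothTransition.le_one _) (Real.smoothTransition.nonneg _)
    (Real.smoothTransition.le_one _)

lemma mem_Icc_of_cutoff_ne_zero {n : ℕ} {t : ℝ} (h : cutoff n t ≠ 0) :
    t ∈ Set.Icc (1 / (n + 1) : ℝ) (1 - 1 / (n + 1)) := by
  have hn : (0 : ℝ) < n + 1 := by positivity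
  constructor
  · by_contra! hc
    rw [lt_div_iff₀ hn] at hc
    exact h (by rw [cutoff, Real.smoothTransition.zero_of_nonpos (by linarith), zero_mul])
  · by_contra! hc
    have : (1 - t) < 1 / (n + 1) := by linarith
    rw [lt_div_iff₀ hn] at this
    exact h (by rw [cutoff, Real.smoothTransition.zero_of_nonpos (x := (n + 1) * (1 - t) - 1)
      (by linarith), mul_zero])

lemma cutoff_eventuallyEq_one {n : ℕ} {t : ℝ} (h1 : 2 < (n + 1) * t) (h2 : 2 < (n + 1) * (1 - t)) :
    cutoff n =ᶠ[𝓝 t] fun _ => 1 := by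
  have c1 : ContinuousAt (fun t : ℝ => ((n : ℝ) + 1) * t) t := by fun_prop
  have c2 : ContinuousAt (fun t : ℝ => ((n : ℝ) + 1) * (1 - t)) t := by fun_prop
  filter_upwards [c1.eventually (lt_mem_nhds h1), c2.eventually (lt_mem_nhds h2)] with x hx1 hx2
  rw [cutoff, Real.smoothTransition.one_of_one_le (by linarith),
    Real.smoothTransition.one_of_one_le (by linarith), mul_one]

lemma eventually_cutoff_eq_one {t : ℝ} (ht : t ∈ Set.Ioo (0 : ℝ) 1) :
    ∀ᶠ n : ℕ in atTop, cutoff n =ᶠ[𝓝 t] fun _ => 1 := by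
  have h1 : ∀ᶠ n : ℕ in atTop, 2 < ((n : ℝ) + 1) * t :=
    ((tendsto_atTop_add_const_right _ 1 tendsto_natCast_atTop_atTop).atTop_mul_const
      ht.1).eventually_gt_atTop 2
  have h2 : ∀ᶠ n : ℕ in atTop, 2 < ((n : ℝ) + 1) * (1 - t) :=
    ((tendsto_atTop_add_const_right _ 1 tendsto_natCast_atTop_atTop).atTop_mul_const
      (sub_pos.2 ht.2)).eventually_gt_atTop 2
  filter_upwards [h1, h2] with n hn1 hn2
  exact cutoff_eventuallyEq_one hn1 hn2

lemma exists_deriv_cutoff_le : ∃ C, 0 ≤ C ∧ ∀ (n : ℕ) (t : ℝ), |deriv (cutoff n) t| ≤ C * (n + 1) := by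
  obtain ⟨C, hC⟩ := exists_deriv_smoothTransition_le
  have hC0 : 0 ≤ C := (abs_nonneg _).trans (hC 0)
  refine ⟨2 * C, by positivity, fun n t => ?_⟩
  have hd : ∀ x, HasDerivAt Real.smoothTransition (deriv Real.smoothTransition x) x := fun x =>
    ((Real.smoothTransition.contDiff (n := 1)).differentiable (by simp) x).hasDerivAt
  have d1 : HasDerivAt (fun t : ℝ => ((n : ℝ) + 1) * t - 1) (n + 1) t := by
    simpa using ((hasDerivAt_id t).const_mul ((n : ℝ) + 1)).sub_const 1
  have d2 : HasDerivAt (fun t : ℝ => ((n : ℝ) + 1) * (1 - t) - 1) (-(n + 1)) t := by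
    simpa using (((hasDerivAt_id t).const_sub 1).const_mul ((n : ℝ) + 1)).sub_const 1
  have h := ((hd _).comp t d1).mul ((hd _).comp t d2)
  have h' : HasDerivAt (cutoff n) _ t := h
  rw [h'.deriv]
  have hn : (0 : ℝ) ≤ n + 1 := by positivity
  have b : ∀ x, |Real.smoothTransition x| ≤ 1 := fun x => by
    rw [abs_of_nonneg (Real.smoothTransition.nonneg _)]; exact Real.smoothTransition.le_one _
  refine (abs_add_le _ _).trans ?_
  simp only [abs_mul, abs_neg, abs_of_nonneg hn, Function.comp]
  have e1 := mul_le_mul (mul_le_mul_of_nonneg_right (hC (((n : ℝ) + 1) * t - 1)) hn)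
    (b (((n : ℝ) + 1) * (1 - t) - 1)) (abs_nonneg _) (by positivity)
  have e2 := mul_le_mul (b (((n : ℝ) + 1) * t - 1))
    (mul_le_mul_of_nonneg_right (hC (((n : ℝ) + 1) * (1 - t) - 1)) hn) (by positivity) zero_le_one
  linarith

/-- The factors of the product test functions. -/
noncomputable def testFactor (n : ℕ) (h : ℤ) (t : ℝ) : ℂ :=
  (if h = 0 then 1 else fourierKernel h t) * (cutoff n t : ℂ)

lemma contDiff_testFactor (n : ℕ) (h : ℤ) : ContDiff ℝ ∞ (testFactor n h) := by
  unfold testFactor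
  refine ContDiff.mul ?_ (Complex.ofRealCLM.contDiff.comp (contDiff_cutoff n))
  split_ifs
  · exact contDiff_const
  · exact contDiff_fourierKernel h

lemma norm_testFactor_le (n : ℕ) (h : ℤ) (t : ℝ) : ‖testFactor n h t‖ ≤ 1 := by
  rw [testFactor, norm_mul, Complex.norm_real, Real.norm_eq_abs]
  refine mul_le_one₀ ?_ (abs_nonneg _) (abs_cutoff_le n t)
  split_ifs with hh
  · simp
  · exact (norm_fourierKernel_le_inv hh t).trans (inv_le_one_of_one_le₀ (le_max_left _ _))

lemma tendsto_testFactor (h : ℤ) {t : ℝ} (ht : t ∈ Set.Ioo (0 : ℝ) 1) :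
    Tendsto (fun n => testFactor n h t) atTop (𝓝 (if h = 0 then 1 else fourierKernel h t)) := by
  refine tendsto_const_nhds.congr' ?_
  filter_upwards [eventually_cutoff_eq_one ht] with n hn
  rw [testFactor, hn.eq_of_nhds]
  simp

lemma tendsto_deriv_testFactor {h : ℤ} (hh : h ≠ 0) {t : ℝ} (ht : t ∈ Set.Ioo (0 : ℝ) 1) :
    Tendsto (fun n => deriv (testFactor n h) t) atTop
      (𝓝 (Complex.exp (-(2 * Real.pi * Complex.I * h * t)))) := by
  refine tendsto_const_nhds.congr' ?_
  filter_upwards [eventually_cutoff_eq_one ht] with n hn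
  have : testFactor n h =ᶠ[𝓝 t] fourierKernel h := by
    filter_upwards [hn] with x hx
    rw [testFactor, hx, if_neg hh]
    simp
  rw [this.deriv_eq, (hasDerivAt_fourierKernel hh t).deriv]

/-- In the product rule the term with the derivative of the kernel is at most `1`. The other one
contains the derivative of the cutoff, of size `n + 1`, but that derivative vanishes except within
`2/(n+1)` of an endpoint, where the kernel is at most `2/(n+1)`. The bound is uniform in `n`, as
dominated convergence requires. -/
lemma exists_deriv_testFactor_le : ∃ C, 0 ≤ C ∧ ∀ (n : ℕ) (h : ℤ) (t : ℝ), h ≠ 0 →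
    t ∈ Set.Icc (0 : ℝ) 1 → ‖deriv (testFactor n h) t‖ ≤ C := by
  obtain ⟨C, hC0, hC⟩ := exists_deriv_cutoff_le
  refine ⟨1 + 2 * C, by positivity, fun n h t hh ht => ?_⟩
  have hn : (0 : ℝ) < n + 1 := by positivity
  have hd : HasDerivAt (fun t => (cutoff n t : ℂ)) ((deriv (cutoff n) t : ℝ) : ℂ) t :=
    (((contDiff_cutoff n).differentiable (by simp) t).hasDerivAt).ofReal_comp
  have h1 := (hasDerivAt_fourierKernel hh t).mul hd
  have h2 : testFactor n h = fourierKernel h * fun t => (cutoff n t : ℂ) := by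
    ext x
    simp [testFactor, hh]
  rw [h2, h1.deriv]
  refine (norm_add_le _ _).trans (add_le_add ?_ ?_)
  · rw [norm_mul, norm_exp_eq_one, one_mul, Complex.norm_real]
    exact abs_cutoff_le n t
  · rw [norm_mul, Complex.norm_real, Real.norm_eq_abs]
    have hk1 := norm_fourierKernel_le_abs hh t
    have hk2 := norm_fourierKernel_le_abs_one_sub hh t
    rw [abs_of_nonneg ht.1] at hk1
    rw [abs_of_nonneg (sub_nonneg.2 ht.2)] at hk2
    have key : ‖fourierKernel h t‖ * (n + 1) ≤ 2 ∨ deriv (cutoff n) t = 0 := by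
      rcases le_or_gt (((n : ℝ) + 1) * t) 2 with a | a
      · left; nlinarith
      rcases le_or_gt (((n : ℝ) + 1) * (1 - t)) 2 with b | b
      · left; nlinarith
      · right
        rw [(cutoff_eventuallyEq_one a b).deriv_eq]
        simp
    rcases key with h2 | h2
    · calc _ ≤ ‖fourierKernel h t‖ * (C * (n + 1)) := by gcongr; exact hC n t
        _ = C * (‖fourierKernel h t‖ * (n + 1)) := by ring
        _ ≤ C * 2 := by gcongr
        _ = _ := by ring
    · rw [h2]; simp; positivity

/-! ### Fourier coefficients of functions with square integrable mixed derivatives -/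

/-- The definition admits real test functions only; the complex identity is assembled from the real
and imaginary parts. -/
lemma IsWeakMixedPartial.integral_complex {m : ℕ} {u : Finset (Fin m)} {F D : (Fin m → ℝ) → ℝ}
    (h : IsWeakMixedPartial u F D) (hF : ContinuousOn F (unitCube m)) {ψ : (Fin m → ℝ) → ℂ}
    (hψ : ContDiff ℝ ∞ ψ) (hc : HasCompactSupport ψ) (hs : tsupport ψ ⊆ openUnitCube m) :
    ∫ y in unitCube m, (F y : ℂ) *
        iteratedFDeriv ℝ u.card ψ y (fun i => Pi.single (u.orderEmbOfFin rfl i) 1)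
      = (-1) ^ u.card * ∫ y in unitCube m, (D y : ℂ) * ψ y := by
  set e : Fin u.card → Fin m → ℝ := fun i => Pi.single (u.orderEmbOfFin rfl i) 1 with he
  have hcont : Continuous fun y => iteratedFDeriv ℝ u.card ψ y e :=
    (ContinuousMultilinearMap.apply ℝ _ ℂ e).continuous.comp
      (hψ.continuous_iteratedFDeriv (by exact_mod_cast le_top))
  have i1 : Integrable (fun y => (F y : ℂ) * iteratedFDeriv ℝ u.card ψ y e)
      (volume.restrict (unitCube m)) :=
    ((Complex.continuous_ofReal.comp_continuousOn hF).mul hcont.continuousOn).integrableOn_compact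
      (isCompact_unitCube m)
  obtain ⟨B, hB⟩ := hψ.continuous.bounded_above_of_compact_support hc
  have i2 : Integrable (fun y => (D y : ℂ) * ψ y) (volume.restrict (unitCube m)) :=
    ((h.1.integrable one_le_two).ofReal).mul_bdd (c := B) hψ.continuous.aestronglyMeasurable
      (Eventually.of_forall hB)
  have key : ∀ (L : ℂ →L[ℝ] ℝ), (∀ (r : ℝ) (w : ℂ), L (r * w) = r * L w) →
      L (∫ y in unitCube m, (F y : ℂ) * iteratedFDeriv ℝ u.card ψ y e)
        = (-1) ^ u.card * L (∫ y in unitCube m, (D y : ℂ) * ψ y) := by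
    intro L hL
    have h1 := h.2 (L ∘ ψ) (L.contDiff.comp hψ) (hc.comp_left (map_zero L))
      ((tsupport_comp_subset (map_zero L) ψ).trans hs)
    rw [← L.integral_comp_comm i1, ← L.integral_comp_comm i2]
    simp_rw [hL]
    have h2 : ∀ y, mixedPartial u (L ∘ ψ) y = L (iteratedFDeriv ℝ u.card ψ y e) := fun y => by
      rw [mixedPartial, L.iteratedFDeriv_comp_left hψ.contDiffAt (by exact_mod_cast le_top)]
      rfl
    simp_rw [h2] at h1
    exact h1
  have hpow : ((-1 : ℂ)) ^ u.card = (((-1 : ℝ) ^ u.card : ℝ) : ℂ) := by push_cast; rfl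
  rw [hpow]
  apply Complex.ext
  · rw [Complex.re_ofReal_mul]
    exact key Complex.reCLM fun r w => by simp
  · rw [Complex.im_ofReal_mul]
    exact key Complex.imCLM fun r w => by simp

/-- The set of active coordinates of a frequency. -/
def freqSupport {m : ℕ} (h : Fin m → ℤ) : Finset (Fin m) := Finset.univ.filter fun j => h j ≠ 0

lemma mem_freqSupport {m : ℕ} {h : Fin m → ℤ} {j : Fin m} : j ∈ freqSupport h ↔ h j ≠ 0 := by
  simp [freqSupport]

/-- Integration by parts in the active coordinates of `h`. The primitive of the exponential vanishes
at `0` and `1`, so no boundary terms survive; inactive coordinates carry only the cutoff, which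
tends to `1`. Both sides converge by dominated convergence as the cutoff is removed. -/
lemma cubeCoeff_eq {m : ℕ} (h : Fin m → ℤ) {F D : (Fin m → ℝ) → ℝ}
    (hD : IsWeakMixedPartial (freqSupport h) F D) (hF : ContinuousOn F (unitCube m)) :
    cubeCoeff F h = (-1) ^ (freqSupport h).card * ∫ y in unitCube m, (D y : ℂ) *
      ∏ j, (if h j = 0 then 1 else fourierKernel (h j) (y j)) := by
  set u := freqSupport h with hu
  set ψ : ℕ → (Fin m → ℝ) → ℂ := fun n y => ∏ j, testFactor n (h j) (y j) with hψ
  have hψs : ∀ n, ContDiff ℝ ∞ (ψ n) := fun n =>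
    contDiff_prod fun j _ => (contDiff_testFactor n (h j)).comp (contDiff_apply ℝ ℝ j)
  have hsupp : ∀ n, Function.support (ψ n) ⊆
      Set.univ.pi fun _ : Fin m => Set.Icc (1 / (n + 1) : ℝ) (1 - 1 / (n + 1)) := fun n y hy j _ => by
    have h1 := Finset.prod_ne_zero_iff.1 hy j (Finset.mem_univ j)
    refine mem_Icc_of_cutoff_ne_zero fun h0 => h1 ?_
    rw [testFactor, h0]; simp
  have hK : ∀ n : ℕ, IsCompact
      (Set.univ.pi fun _ : Fin m => Set.Icc (1 / (n + 1) : ℝ) (1 - 1 / (n + 1))) := fun n =>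
    isCompact_univ_pi fun _ => isCompact_Icc
  have hKo : ∀ n : ℕ, (Set.univ.pi fun _ : Fin m => Set.Icc (1 / (n + 1) : ℝ) (1 - 1 / (n + 1)))
      ⊆ openUnitCube m := fun n => Set.pi_mono fun j _ x hx => by
    have : (0 : ℝ) < 1 / (n + 1) := by positivity
    exact ⟨this.trans_le hx.1, hx.2.trans_lt (by linarith)⟩
  have hid := fun n => hD.integral_complex hF (hψs n)
    (HasCompactSupport.of_support_subset_isCompact (hK n) (hsupp n))
    ((closure_minimal (hsupp n) (hK n).isClosed).trans (hKo n))
  have hder : ∀ n y, iteratedFDeriv ℝ u.card (ψ n) y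
      (fun i => Pi.single (u.orderEmbOfFin rfl i) 1) =
      ∏ j, (if j ∈ u then deriv (testFactor n (h j)) else testFactor n (h j)) (y j) := fun n y => by
    rw [hψ, iteratedFDeriv_prod _ (fun j => contDiff_testFactor n (h j)) _
      (u.orderEmbOfFin rfl).injective]
    simp only [Finset.image_orderEmbOfFin_univ]
  simp_rw [hder] at hid
  obtain ⟨C, hC0, hC⟩ := exists_deriv_testFactor_le
  obtain ⟨M, hM⟩ := (isCompact_unitCube m).exists_bound_of_continuousOn hF
  have hM0 : 0 ≤ M := (norm_nonneg _).trans (hM 0 (Set.left_mem_Icc.2 zero_le_one))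
  have hae : ∀ᵐ y ∂(volume.restrict (unitCube m)), y ∈ openUnitCube m := by
    rw [← Measure.restrict_congr_set (openUnitCube_ae_eq m)]
    exact ae_restrict_mem (isOpen_openUnitCube m).measurableSet
  have lim1 : Tendsto (fun n => ∫ y in unitCube m, (F y : ℂ) *
      ∏ j, (if j ∈ u then deriv (testFactor n (h j)) else testFactor n (h j)) (y j)) atTop
      (𝓝 (cubeCoeff F h)) := by
    refine tendsto_integral_of_dominated_convergence (fun _ => M * ∏ _j : Fin m, (1 + C)) ?_
      (integrable_const _) ?_ ?_
    · intro n
      refine ContinuousOn.aestronglyMeasurable ?_ (measurableSet_unitCube m)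
      refine (Complex.continuous_ofReal.comp_continuousOn hF).mul (Continuous.continuousOn ?_)
      refine continuous_finsetProd _ fun j _ => ?_
      split_ifs
      · exact ((contDiff_infty_iff_deriv.1 (contDiff_testFactor n (h j))).2).continuous.comp
          (continuous_apply j)
      · exact (contDiff_testFactor n (h j)).continuous.comp (continuous_apply j)
    · intro n
      filter_upwards [ae_restrict_mem (measurableSet_unitCube m)] with y hy
      rw [norm_mul, Complex.norm_real, norm_prod]
      refine mul_le_mul (hM y hy) (Finset.prod_le_prod (fun _ _ => norm_nonneg _) fun j _ => ?_)
        (Finset.prod_nonneg fun _ _ => norm_nonneg _) hM0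
      split_ifs with hj
      · exact (hC n (h j) (y j) (mem_freqSupport.1 hj) ⟨hy.1 j, hy.2 j⟩).trans (by linarith)
      · exact (norm_testFactor_le n _ _).trans (by linarith)
    · filter_upwards [hae] with y hy
      rw [mul_comm]
      refine (tendsto_const_nhds.mul (tendsto_finsetProd _ fun j _ => ?_)).congr
        fun n => rfl |>.trans (mul_comm _ _) |>.symm.trans (mul_comm _ _)
      split_ifs with hj
      · exact tendsto_deriv_testFactor (mem_freqSupport.1 hj) (hy j trivial)
      · have hj0 : h j = 0 := by simpa [hu, mem_freqSupport] using hj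
        have := tendsto_testFactor (h j) (hy j trivial)
        simpa [hj0] using this
  have lim2 : Tendsto (fun n => ∫ y in unitCube m, (D y : ℂ) * ψ n y) atTop
      (𝓝 (∫ y in unitCube m, (D y : ℂ) *
        ∏ j, (if h j = 0 then 1 else fourierKernel (h j) (y j)))) := by
    have hDi : Integrable D (volume.restrict (unitCube m)) := hD.1.integrable one_le_two
    refine tendsto_integral_of_dominated_convergence (fun y => ‖D y‖) ?_ hDi.norm ?_ ?_
    · exact fun n => (Complex.continuous_ofReal.comp_aestronglyMeasurable
        hDi.aestronglyMeasurable).mul (hψs n).continuous.aestronglyMeasurable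
    · refine fun n => Eventually.of_forall fun y => ?_
      rw [norm_mul, Complex.norm_real, norm_prod]
      exact mul_le_of_le_one_right (norm_nonneg _)
        (Finset.prod_le_one (fun _ _ => norm_nonneg _) fun j _ => norm_testFactor_le n _ _)
    · filter_upwards [hae] with y hy
      exact tendsto_const_nhds.mul
        (tendsto_finsetProd _ fun j _ => tendsto_testFactor (h j) (hy j trivial))
  refine tendsto_nhds_unique lim1 ((lim2.const_mul _).congr fun n => (hid n).symm)

/-- The kernel involves the active variables only. Integrating the derivative over the inactive ones
first produces the function `E` whose `L²` norm is a term of the Sobolev norm, and each active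
kernel factor contributes `1/|h_j|`. Bounding `γ u` by `∑ γ` makes the constant independent of `h`.
-/
lemma norm_cubeCoeff_le {m : ℕ} {γ : Finset (Fin m) → ℝ} (hγ : ∀ u, 0 < γ u) {F : (Fin m → ℝ) → ℝ}
    {D : Finset (Fin m) → (Fin m → ℝ) → ℝ} (hFD : InSobolev F D) (h : Fin m → ℤ) :
    ‖cubeCoeff F h‖ ≤ √(∑ u, γ u) * sobolevNorm γ D * (freqWeight h)⁻¹ := by
  set u := freqSupport h with hu
  have hD := hFD.isWeakMixedPartial u
  rw [cubeCoeff_eq h hD hFD.continuousOn, norm_mul, norm_pow, norm_neg, norm_one, one_pow, one_mul]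
  have hmp := measurePreserving_glue u
  have hDL := hD.1.comp_measurePreserving hmp
  obtain ⟨hE, -⟩ := memLp_integral_prod _ _ hDL
  set E : ({j // j ∈ u} → ℝ) → ℝ :=
    fun yu => ∫ yc in Set.Icc (0 : {j // j ∉ u} → ℝ) 1, D u (glue u yu yc) with hEdef
  set k : ({j // j ∈ u} → ℝ) → ℂ := fun yu => ∏ j : {j // j ∈ u}, fourierKernel (h j) (yu j)
  have hprod : ∀ yu yc, ∏ j, (if h j = 0 then 1 else fourierKernel (h j) (glue u yu yc j)) = k yu := by
    intro yu yc
    rw [← Finset.prod_subset (Finset.subset_univ u), ← Finset.prod_coe_sort u]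
    · refine Finset.prod_congr rfl fun j _ => ?_
      rw [if_neg (mem_freqSupport.1 j.2), glue, dif_pos j.2]
    · intro j _ hj
      have hj0 : h j = 0 := by simpa [hu, mem_freqSupport] using hj
      rw [if_pos hj0]
  have hkb : ∀ yu, ‖k yu‖ ≤ (freqWeight h)⁻¹ := fun yu => by
    rw [norm_prod, freqWeight, ← Finset.prod_inv_distrib,
      ← Finset.prod_subset (Finset.subset_univ u), ← Finset.prod_coe_sort u]
    · exact Finset.prod_le_prod (fun _ _ => norm_nonneg _) fun j _ =>
        norm_fourierKernel_le_inv (mem_freqSupport.1 j.2) _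
    · intro j _ hj
      have hj0 : h j = 0 := by simpa [hu, mem_freqSupport] using hj
      simp [hj0]
  have hkc : Continuous k := continuous_finsetProd _ fun j _ =>
    (contDiff_fourierKernel (h j)).continuous.comp (continuous_apply j)
  have hmeasprod : Continuous fun y : Fin m → ℝ =>
      ∏ j, (if h j = 0 then 1 else fourierKernel (h j) (y j)) := by
    refine continuous_finsetProd _ fun j _ => ?_
    split_ifs
    · exact continuous_const
    · exact (contDiff_fourierKernel (h j)).continuous.comp (continuous_apply j)
  have h1 : ∫ y in unitCube m, (D u y : ℂ) *
      ∏ j, (if h j = 0 then 1 else fourierKernel (h j) (y j)) =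
      ∫ yu in Set.Icc (0 : {j // j ∈ u} → ℝ) 1, (E yu : ℂ) * k yu := by
    rw [← hmp.map_eq, integral_map hmp.aemeasurable]
    · simp_rw [hprod]
      rw [integral_prod]
      · refine integral_congr_ae (Eventually.of_forall fun yu => ?_)
        simp only [hEdef]
        rw [integral_mul_const, integral_complex_ofReal]
      · exact ((hDL.integrable one_le_two).ofReal).mul_bdd (c := (freqWeight h)⁻¹)
          (hkc.comp continuous_fst).aestronglyMeasurable (Eventually.of_forall fun p => hkb p.1)
    · rw [hmp.map_eq]
      exact (Complex.continuous_ofReal.comp_aestronglyMeasurable hD.1.1).mul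
        hmeasprod.aestronglyMeasurable
  rw [h1]
  have h2 : ‖∫ yu in Set.Icc (0 : {j // j ∈ u} → ℝ) 1, (E yu : ℂ) * k yu‖ ≤
      (∫ yu in Set.Icc (0 : {j // j ∈ u} → ℝ) 1, |E yu|) * (freqWeight h)⁻¹ := by
    rw [← integral_mul_const]
    refine norm_integral_le_of_norm_le ((hE.integrable one_le_two).abs.mul_const _)
      (Eventually.of_forall fun yu => ?_)
    rw [norm_mul, Complex.norm_real, Real.norm_eq_abs]
    exact mul_le_mul_of_nonneg_left (hkb yu) (abs_nonneg _)
  refine h2.trans (mul_le_mul_of_nonneg_right ?_ (inv_nonneg.2 (freqWeight_pos h).le))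
  have h3 : (∫ yu in Set.Icc (0 : {j // j ∈ u} → ℝ) 1, |E yu|) ^ 2 ≤
      ∫ yu in Set.Icc (0 : {j // j ∈ u} → ℝ) 1, |E yu| ^ 2 := sq_integral_le _ hE.abs
  simp_rw [sq_abs] at h3
  rw [sobolevNorm, ← Real.sqrt_mul (Finset.sum_nonneg fun u _ => (hγ u).le)]
  refine Real.le_sqrt_of_sq_le (h3.trans ?_)
  have h4 : 1 / γ u * ∫ yu in Set.Icc (0 : {j // j ∈ u} → ℝ) 1, E yu ^ 2 ≤
      ∑ u, 1 / γ u * ∫ yu in Set.Icc (0 : {j // j ∈ u} → ℝ) 1,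
        (∫ yc in Set.Icc (0 : {j // j ∉ u} → ℝ) 1, D u (glue u yu yc)) ^ 2 :=
    Finset.single_le_sum (f := fun u => 1 / γ u * ∫ yu in Set.Icc (0 : {j // j ∈ u} → ℝ) 1,
        (∫ yc in Set.Icc (0 : {j // j ∉ u} → ℝ) 1, D u (glue u yu yc)) ^ 2)
      (fun u _ => mul_nonneg (one_div_pos.2 (hγ u)).le (integral_nonneg fun _ => sq_nonneg _))
      (Finset.mem_univ u)
  have h5 : γ u ≤ ∑ u, γ u :=
    Finset.single_le_sum (f := γ) (fun u _ => (hγ u).le) (Finset.mem_univ u)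
  have h6 : 0 ≤ ∫ yu in Set.Icc (0 : {j // j ∈ u} → ℝ) 1, E yu ^ 2 :=
    integral_nonneg fun _ => sq_nonneg _
  calc _ = γ u * (1 / γ u * ∫ yu in Set.Icc (0 : {j // j ∈ u} → ℝ) 1, E yu ^ 2) := by
        rw [← mul_assoc, mul_one_div_cancel (hγ u).ne', one_mul]
    _ ≤ _ := mul_le_mul h5 h4 (mul_nonneg (one_div_pos.2 (hγ u)).le h6)
        (Finset.sum_nonneg fun u _ => (hγ u).le)

lemma HasRate.mono {m : ℕ} {z : GenVec m} {γ : Finset (Fin m) → ℝ} {r r' : ℝ} (h : HasRate z γ r)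
    (hr : r' ≤ r) : HasRate z γ r' := by
  obtain ⟨C, hC, hb⟩ := h
  refine ⟨C, hC, fun ℓ F D hFD => (hb ℓ F D hFD).trans ?_⟩
  have : 0 ≤ sobolevNorm γ D := Real.sqrt_nonneg _
  gcongr
  norm_num

/-- Lattice rules of order arbitrarily close to one exist for arbitrary positive weights. -/
theorem exists_hasRate (m : ℕ) : ∃ z : GenVec m, ∀ γ : Finset (Fin m) → ℝ, (∀ u, 0 < γ u) →
    ∀ δ : ℝ, 0 < δ → HasRate z γ (1 - δ) := by
  obtain ⟨z, hz⟩ := exists_genVec_dualSum_le m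
  refine ⟨z, fun γ hγ => ?_⟩
  -- The restriction `δ ≤ 1/2` corresponds to `q ≤ 2`; a larger `δ` asks for a weaker rate.
  have main : ∀ δ : ℝ, 0 < δ → δ ≤ 1 / 2 → HasRate z γ (1 - δ) := by
    intro δ hδ hδ2
    have hδ1 : 0 < 1 - δ := by linarith
    -- With `q = 1/(1-δ)` the exponent `2/q` is `2(1-δ)`, the squared rate.
    obtain ⟨c, hc, hcb⟩ := hz (1 / (1 - δ)) (by rw [lt_div_iff₀ hδ1]; linarith)
      (by rw [div_le_iff₀ hδ1]; linarith)
    -- The added `1` keeps the constant positive when `c = 0`.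
    refine ⟨√(∑ u, γ u) * (c.toReal ^ (1 - δ) + 1), ?_, fun ℓ F D hFD => ?_⟩
    · have : 0 < ∑ u, γ u := Finset.sum_pos (fun u _ => hγ u) Finset.univ_nonempty
      positivity
    set N := sobolevNorm γ D with hN
    have hN0 : 0 ≤ N := Real.sqrt_nonneg _
    have h1 := integral_sq_lattice_error_le z ℓ hFD.continuousOn (B := √(∑ u, γ u) * N)
      (fun h _ => norm_cubeCoeff_le hγ hFD h)
    have h2 : (c / 2 ^ ℓ) ^ (2 / (1 / (1 - δ))) =
        ENNReal.ofReal ((c.toReal ^ (1 - δ) * (2 : ℝ) ^ (-((1 - δ) * ℓ))) ^ 2) := by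
      have e1 : c / 2 ^ ℓ = ENNReal.ofReal (c.toReal / 2 ^ ℓ) := by
        rw [ENNReal.ofReal_div_of_pos (by positivity), ENNReal.ofReal_toReal hc,
          ENNReal.ofReal_pow (by norm_num)]
        norm_num
      rw [e1, ENNReal.ofReal_rpow_of_nonneg (by positivity) (by positivity)]
      congr 1
      rw [show 2 / (1 / (1 - δ)) = (1 - δ) * (2 : ℕ) by push_cast; field_simp,
        Real.rpow_mul (by positivity), Real.rpow_natCast, Real.div_rpow (by positivity)
        (by positivity), ← Real.rpow_natCast 2 ℓ, ← Real.rpow_mul (by norm_num),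
        Real.rpow_neg (by norm_num), div_eq_mul_inv, mul_comm (1 - δ)]
    have h3 := h1.trans (mul_le_mul_right ((hcb ℓ).trans_eq h2) _)
    rw [← ENNReal.ofReal_mul (by positivity), ENNReal.ofReal_le_ofReal_iff (by positivity),
      ← mul_pow] at h3
    rw [rms]
    refine (Real.sqrt_le_sqrt h3).trans ?_
    rw [Real.sqrt_sq (by positivity)]
    have h4 : 0 ≤ √(∑ u, γ u) * (2 : ℝ) ^ (-((1 - δ) * ℓ)) * N := by positivity
    calc _ = √(∑ u, γ u) * (2 : ℝ) ^ (-((1 - δ) * ℓ)) * N * c.toReal ^ (1 - δ) := by ring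
      _ ≤ √(∑ u, γ u) * (2 : ℝ) ^ (-((1 - δ) * ℓ)) * N * (c.toReal ^ (1 - δ) + 1) := by
          gcongr; linarith
      _ = _ := by ring
  intro δ hδ
  refine (main (min δ (1 / 2)) (by positivity) (min_le_right _ _)).mono ?_
  linarith [min_le_left δ (1 / 2)]

/-! ### Smooth functions belong to the Sobolev space -/

lemma integrable_mul_of_tsupport_subset {E : Type*} [NormedAddCommGroup E] [MeasurableSpace E]
    [BorelSpace E] {μ : Measure E} [IsFiniteMeasureOnCompacts μ] {U : Set E} {f g : E → ℝ}
    (hf : ContinuousOn f U) (hg : Continuous g) (hc : HasCompactSupport g) (hs : tsupport g ⊆ U) :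
    Integrable (fun x => f x * g x) μ := by
  have h1 : IntegrableOn (fun x => f x * g x) (tsupport g) μ :=
    ((hf.mono hs).mul hg.continuousOn).integrableOn_compact hc
  refine (integrableOn_iff_integrable_of_support_subset fun x hx => ?_).1 h1
  exact subset_tsupport g (right_ne_zero_of_mul hx)

/-- Each integration by parts takes the outermost direction off `φ` and makes it the innermost one
of the remaining derivatives of `F`. The directions come out reversed, hence `Fin.rev`, and no
symmetry of derivatives is needed. -/
lemma integral_mul_iteratedFDeriv {E : Type*} [NormedAddCommGroup E] [NormedSpace ℝ E]
    [FiniteDimensional ℝ E] [MeasurableSpace E] [BorelSpace E] {μ : Measure E} [μ.IsAddHaarMeasure]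
    {U : Set E} (hU : IsOpen U) {n : ℕ} {F φ : E → ℝ} (hF : ContDiffOn ℝ ∞ F U)
    (hφ : ContDiff ℝ ∞ φ) (hc : HasCompactSupport φ) (hs : tsupport φ ⊆ U) (v : Fin n → E) :
    ∫ y, F y * iteratedFDeriv ℝ n φ y v ∂μ
      = (-1) ^ n * ∫ y, iteratedFDeriv ℝ n F y (v ∘ Fin.rev) * φ y ∂μ := by
  induction n generalizing F with
  | zero => simp
  | succ n ih =>
    have hle : ((n : ℕ∞) : WithTop ℕ∞) < ∞ := by exact_mod_cast WithTop.coe_lt_top n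
    have hd : Differentiable ℝ (iteratedFDeriv ℝ n φ) := hφ.differentiable_iteratedFDeriv hle
    set ψ : E → ℝ := fun y => iteratedFDeriv ℝ n φ y (Fin.tail v) with hψ
    have hψs : ContDiff ℝ ∞ ψ :=
      (ContinuousMultilinearMap.apply ℝ (fun _ : Fin n => E) ℝ (Fin.tail v)).contDiff.comp
        (hφ.iteratedFDeriv_right (m := ∞) (by norm_cast))
    have hsub : tsupport ψ ⊆ tsupport φ :=
      (tsupport_comp_subset (g := fun w : E [×n]→L[ℝ] ℝ => w (Fin.tail v)) rfl _).trans
        (tsupport_iteratedFDeriv_subset n)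
    have hψc : HasCompactSupport ψ := hc.of_isClosed_subset isClosed_closure hsub
    have h1 : ∀ y, iteratedFDeriv ℝ (n + 1) φ y v = fderiv ℝ ψ y (v 0) := fun y =>
      (hd y).iteratedFDeriv_succ_apply_left'
    have hF' : ContDiffOn ℝ ∞ (fun y => fderiv ℝ F y) U := hF.fderiv_of_isOpen hU (by norm_cast)
    have hF'' : ContDiffOn ℝ ∞ (fun y => fderiv ℝ F y (v 0)) U := hF'.clm_apply contDiffOn_const
    have hdψ : Continuous fun y => fderiv ℝ ψ y (v 0) :=
      (hψs.continuous_fderiv (by simp)).clm_apply continuous_const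
    simp_rw [h1]
    rw [integral_mul_fderiv_eq_neg_fderiv_mul_of_integrable]
    · rw [ih hF'', pow_succ, mul_neg_one, neg_mul]
      congr 2
      refine integral_congr_ae (Eventually.of_forall fun y => ?_)
      by_cases hy : y ∈ U
      · simp only
        congr 1
        rw [iteratedFDeriv_succ_apply_right]
        have h2 := (ContinuousLinearMap.apply ℝ ℝ (v 0)).iteratedFDeriv_comp_left
          (i := n) ((hF' y hy).contDiffAt (hU.mem_nhds hy)) (by exact_mod_cast le_top)
        have h3 : (ContinuousLinearMap.apply ℝ ℝ (v 0)) ∘ (fun y => fderiv ℝ F y) =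
          fun y => fderiv ℝ F y (v 0) := rfl
        rw [h3] at h2
        rw [h2]
        have h4 : Fin.init (v ∘ Fin.rev) = Fin.tail v ∘ Fin.rev := by
          ext i
          simp [Fin.init, Fin.tail, Fin.rev_castSucc]
        rw [h4]
        simp
      · have : φ y = 0 := image_eq_zero_of_notMem_tsupport fun h => hy (hs h)
        simp [this]
    · exact integrable_mul_of_tsupport_subset hF''.continuousOn hψs.continuous hψc (hsub.trans hs)
    · exact integrable_mul_of_tsupport_subset hF.continuousOn hdψ (hψc.fderiv_apply ℝ (v 0))
        ((tsupport_fderiv_apply_subset ℝ (v 0)).trans (hsub.trans hs))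
    · exact integrable_mul_of_tsupport_subset hF.continuousOn hψs.continuous hψc (hsub.trans hs)
    · exact fun x hx => ((hF x (hs (hsub hx))).contDiffAt
        (hU.mem_nhds (hs (hsub hx)))).differentiableAt (by simp)
    · exact fun x _ => hψs.differentiable (by simp) x

lemma uniqueDiffOn_unitCube (m : ℕ) : UniqueDiffOn ℝ (unitCube m) := by
  rw [unitCube, ← Set.pi_univ_Icc]
  exact UniqueDiffOn.univ_pi fun _ => uniqueDiffOn_Icc zero_lt_one

/-- The classical mixed derivative of a smooth function on the cube. -/
noncomputable def smoothMixed {m : ℕ} (F : (Fin m → ℝ) → ℝ) (u : Finset (Fin m))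
    (y : Fin m → ℝ) : ℝ :=
  iteratedFDerivWithin ℝ u.card F (unitCube m) y
    ((fun i => Pi.single (u.orderEmbOfFin rfl i) 1) ∘ Fin.rev)

lemma norm_apply_single_le {m n : ℕ} {E : Type*} [NormedAddCommGroup E] [NormedSpace ℝ E]
    (A : (Fin m → ℝ) [×n]→L[ℝ] E) (v : Fin n → Fin m) :
    ‖A fun i => Pi.single (v i) 1‖ ≤ ‖A‖ := by
  refine (A.le_opNorm _).trans (mul_le_of_le_one_right (norm_nonneg _) ?_)
  refine Finset.prod_le_one (fun _ _ => norm_nonneg _) fun i _ => ?_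
  rw [Pi.norm_single, norm_one]

lemma abs_smoothMixed_le {m : ℕ} (F : (Fin m → ℝ) → ℝ) (u : Finset (Fin m)) (y : Fin m → ℝ) :
    |smoothMixed F u y| ≤ ‖iteratedFDerivWithin ℝ u.card F (unitCube m) y‖ := by
  rw [smoothMixed, ← Real.norm_eq_abs]
  exact norm_apply_single_le _ fun i => u.orderEmbOfFin rfl (Fin.rev i)

lemma continuousOn_smoothMixed {m : ℕ} {F : (Fin m → ℝ) → ℝ} (hF : ContDiffOn ℝ ∞ F (unitCube m))
    (u : Finset (Fin m)) : ContinuousOn (smoothMixed F u) (unitCube m) :=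
  (ContinuousMultilinearMap.apply ℝ _ ℝ _).continuous.comp_continuousOn
    (hF.continuousOn_iteratedFDerivWithin (by exact_mod_cast le_top) (uniqueDiffOn_unitCube m))

lemma memLp_of_continuousOn {m : ℕ} {F : (Fin m → ℝ) → ℝ} (hF : ContinuousOn F (unitCube m)) :
    MemLp F 2 (volume.restrict (unitCube m)) := by
  obtain ⟨M, hM⟩ := (isCompact_unitCube m).exists_bound_of_continuousOn hF
  refine MemLp.of_bound (hF.aestronglyMeasurable (measurableSet_unitCube m)) M ?_
  filter_upwards [ae_restrict_mem (measurableSet_unitCube m)] with y hy using hM y hy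

lemma inSobolev_of_contDiffOn {m : ℕ} {F : (Fin m → ℝ) → ℝ}
    (hF : ContDiffOn ℝ ∞ F (unitCube m)) : InSobolev F (smoothMixed F) := by
  refine ⟨hF.continuousOn, fun u => ⟨memLp_of_continuousOn (continuousOn_smoothMixed hF u), ?_⟩⟩
  intro φ hφ hc hs
  have hz : ∀ y, y ∉ unitCube m → y ∉ tsupport φ := fun y hy h => hy (openUnitCube_subset m (hs h))
  rw [setIntegral_eq_integral_of_forall_compl_eq_zero fun y hy => ?_,
    setIntegral_eq_integral_of_forall_compl_eq_zero fun y hy => ?_]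
  · have h := integral_mul_iteratedFDeriv (μ := volume) (isOpen_openUnitCube m)
      (hF.mono (openUnitCube_subset m)) hφ hc hs
      (fun i => (Pi.single (u.orderEmbOfFin rfl i) 1 : Fin m → ℝ))
    refine h.trans ?_
    congr 1
    refine integral_congr_ae (Eventually.of_forall fun y => ?_)
    by_cases hy : y ∈ openUnitCube m
    · have hn : unitCube m ∈ 𝓝 y :=
        mem_of_superset ((isOpen_openUnitCube m).mem_nhds hy) (openUnitCube_subset m)
      simp only [smoothMixed]
      rw [iteratedFDerivWithin_eq_iteratedFDeriv (uniqueDiffOn_unitCube m)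
        ((hF.contDiffAt hn).of_le (by exact_mod_cast le_top)) (openUnitCube_subset m hy)]
    · have : φ y = 0 := image_eq_zero_of_notMem_tsupport fun h => hy (hs h)
      simp [this]
  · rw [image_eq_zero_of_notMem_tsupport (hz y hy), mul_zero]
  · have h0 : iteratedFDeriv ℝ u.card φ y = 0 :=
      image_eq_zero_of_notMem_tsupport fun h => hz y hy (tsupport_iteratedFDeriv_subset _ h)
    rw [mixedPartial, h0]
    simp

/-- Jensen removes the inner integrals over the inactive variables. The bound `R` is a function, not
a constant, so that it can later be an inner cubature error depending on the outer variable. -/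
lemma sobolevNorm_sq_le {m : ℕ} {γ : Finset (Fin m) → ℝ} (hγ : ∀ u, 0 < γ u)
    {D : Finset (Fin m) → (Fin m → ℝ) → ℝ} {R : (Fin m → ℝ) → ℝ}
    (hD : ∀ u, MemLp (D u) 2 (volume.restrict (unitCube m)))
    (hR : MemLp R 2 (volume.restrict (unitCube m)))
    (hDR : ∀ u, ∀ y ∈ unitCube m, |D u y| ≤ R y) :
    sobolevNorm γ D ^ 2 ≤ (∑ u, 1 / γ u) * ∫ y in unitCube m, R y ^ 2 := by
  have hγ' : ∀ u, 0 ≤ 1 / γ u := fun u => (one_div_pos.2 (hγ u)).le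
  rw [sobolevNorm, Real.sq_sqrt (Finset.sum_nonneg fun u _ =>
    mul_nonneg (hγ' u) (integral_nonneg fun _ => sq_nonneg _)), Finset.sum_mul]
  refine Finset.sum_le_sum fun u _ => mul_le_mul_of_nonneg_left ?_ (hγ' u)
  have hmp := measurePreserving_glue u
  refine (memLp_integral_prod _ _ ((hD u).comp_measurePreserving hmp)).2.trans ?_
  have h1 : ∫ y in unitCube m, D u y ^ 2 = ∫ p, (D u ∘ fun p : ({j // j ∈ u} → ℝ) ×
      ({j // j ∉ u} → ℝ) => glue u p.1 p.2) p ^ 2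
        ∂((volume.restrict (Set.Icc 0 1)).prod (volume.restrict (Set.Icc 0 1))) := by
    conv_lhs => rw [← hmp.map_eq]
    rw [integral_map hmp.aemeasurable]
    · rfl
    · rw [hmp.map_eq]; exact (hD u).1.pow 2
  rw [← h1]
  refine integral_mono_ae (hD u).integrable_sq hR.integrable_sq ?_
  filter_upwards [ae_restrict_mem (measurableSet_unitCube m)] with y hy
  exact sq_le_sq' (neg_le_of_abs_le (hDR u y hy)) (le_of_abs_le (hDR u y hy))

/-! ### Bounds for derivatives of compositions -/

/-- A Faà di Bruno estimate whose point is the order of quantifiers: `M` is fixed before `X`, and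
this carries uniformity in `ξ`, the shifts and the levels. -/
lemma exists_iteratedFDerivWithin_comp_bound {E F G : Type*} [NormedAddCommGroup E]
    [NormedSpace ℝ E] [NormedAddCommGroup F] [NormedSpace ℝ F] [NormedAddCommGroup G]
    [NormedSpace ℝ G] {g : F → G} {T K : Set F} (hg : ContDiffOn ℝ ∞ g T) (hT : UniqueDiffOn ℝ T)
    (hK : IsCompact K) (hKT : K ⊆ T) (N : ℕ) (B : ℝ) :
    ∃ M, 0 ≤ M ∧ ∀ (s : Set E) (X : E → F), UniqueDiffOn ℝ s → ContDiffOn ℝ ∞ X s →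
      Set.MapsTo X s T → ∀ x ∈ s, X x ∈ K →
      (∀ i, 1 ≤ i → i ≤ N → ‖iteratedFDerivWithin ℝ i X s x‖ ≤ B) →
      ∀ i ≤ N, ‖iteratedFDerivWithin ℝ i (g ∘ X) s x‖ ≤ M := by
  have hb : ∀ i : ℕ, ∃ C, ∀ y ∈ K, ‖iteratedFDerivWithin ℝ i g T y‖ ≤ C := fun i =>
    hK.exists_bound_of_continuousOn
      ((hg.continuousOn_iteratedFDerivWithin (by exact_mod_cast le_top) hT).mono hKT)
  choose C hC using hb
  set C' := ∑ i ∈ Finset.range (N + 1), |C i| with hC'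
  have hC'0 : 0 ≤ C' := Finset.sum_nonneg fun _ _ => abs_nonneg _
  -- With `D ≥ 1`, a bound by `B` on the `j`-th derivative implies one by `D ^ j` for every `j ≥ 1`.
  set D := max 1 B with hD
  have hD1 : 1 ≤ D := le_max_left _ _
  refine ⟨N.factorial * C' * D ^ N, by positivity, fun s X hs hX hm x hx hxK hXb i hi => ?_⟩
  have h := norm_iteratedFDerivWithin_comp_le (n := i) hg hX (by exact_mod_cast le_top) hT hs hm hx
    (C := C') (D := D) (fun j hj => ?_) (fun j hj1 hj => ?_)
  · refine h.trans ?_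
    gcongr
  · refine (hC j _ hxK).trans ((le_abs_self _).trans ?_)
    exact Finset.single_le_sum (f := fun i => |C i|) (fun _ _ => abs_nonneg _)
      (Finset.mem_range.2 (by omega))
  · exact (hXb j hj1 (hj.trans hi)).trans ((le_max_right 1 B).trans
      (le_self_pow₀ hD1 (by omega)))

lemma sum_choose_mul_le {n : ℕ} {a b : ℕ → ℝ} {A B : ℝ} (hA : 0 ≤ A) (hB : ∀ i ≤ n, 0 ≤ b i)
    (ha : ∀ i ≤ n, a i ≤ A) (hb : ∀ i ≤ n, b (n - i) ≤ B) :
    ∑ i ∈ Finset.range (n + 1), (n.choose i : ℝ) * a i * b (n - i) ≤ 2 ^ n * (A * B) := by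
  have h : (2 : ℝ) ^ n = ∑ i ∈ Finset.range (n + 1), (n.choose i : ℝ) := by
    exact_mod_cast (Nat.sum_range_choose n).symm
  rw [h, Finset.sum_mul]
  refine Finset.sum_le_sum fun i hi => ?_
  have hi' : i ≤ n := by simpa [Nat.lt_succ_iff] using hi
  rw [mul_assoc]
  refine mul_le_mul_of_nonneg_left ?_ (by positivity)
  exact mul_le_mul (ha i hi') (hb i hi') (hB _ (Nat.sub_le _ _)) hA

/-- Order zero is the mean value inequality on `[c₀, c₁]`. For the induction, `D(g(X) - g(Y)) =
g'(X) D(X - Y) + (g'(X) - g'(Y)) DY`: by Leibniz the first term is controlled by derivatives of `X -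
Y`, and the second by the induction hypothesis for `g'` in place of `g`. Hence the statement
quantifies over `g`. -/
lemma exists_comp_sub_bound {V : Type*} [NormedAddCommGroup V] [NormedSpace ℝ V] {c₀ : ℝ}
    (hc₀ : 0 < c₀) (c₁ B : ℝ) (hB : 0 ≤ B) (n : ℕ) (g : ℝ → ℝ)
    (hg : ContDiffOn ℝ ∞ g (Set.Ioi 0)) :
    ∃ M, 0 ≤ M ∧ ∀ X Y : V → ℝ, ContDiff ℝ ∞ X → ContDiff ℝ ∞ Y → (∀ x, 0 < X x) →
      (∀ x, 0 < Y x) → ∀ x, X x ∈ Set.Icc c₀ c₁ → Y x ∈ Set.Icc c₀ c₁ →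
      (∀ i ≤ n, ‖iteratedFDeriv ℝ i X x‖ ≤ B) → (∀ i ≤ n, ‖iteratedFDeriv ℝ i Y x‖ ≤ B) →
      ‖iteratedFDeriv ℝ n (fun y => g (X y) - g (Y y)) x‖ ≤
        M * ∑ i ∈ Finset.range (n + 1), ‖iteratedFDeriv ℝ i (fun y => X y - Y y) x‖ := by
  induction n using Nat.strong_induction_on generalizing g with
  | _ n ih =>
  have hKT : Set.Icc c₀ c₁ ⊆ Set.Ioi 0 := fun y hy => hc₀.trans_le hy.1
  have hg' : ContDiffOn ℝ ∞ (deriv g) (Set.Ioi 0) := hg.deriv_of_isOpen isOpen_Ioi (by norm_cast)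
  have hgd : ∀ y, 0 < y → HasDerivAt g (deriv g y) y := fun y hy =>
    ((hg.contDiffAt (isOpen_Ioi.mem_nhds hy)).differentiableAt (by simp)).hasDerivAt
  rcases n with _ | n
  · obtain ⟨M, hM⟩ := (isCompact_Icc (a := c₀) (b := c₁)).exists_bound_of_continuousOn
      (hg'.continuousOn.mono hKT)
    refine ⟨|M|, abs_nonneg _, fun X Y _ _ _ _ x hx hy _ _ => ?_⟩
    simp only [norm_iteratedFDeriv_zero, zero_add, Finset.sum_range_one]
    exact (convex_Icc c₀ c₁).norm_image_sub_le_of_norm_deriv_le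
      (fun y hy => (hgd y (hKT hy)).differentiableAt)
      (fun y hy => (hM y hy).trans (le_abs_self _)) hy hx
  · obtain ⟨M₁, hM₁, hcomp⟩ := exists_iteratedFDerivWithin_comp_bound (E := V) hg'
      isOpen_Ioi.uniqueDiffOn isCompact_Icc hKT n B
    have ih' : ∀ i : ℕ, ∃ M, 0 ≤ M ∧ (i ≤ n → ∀ X Y : V → ℝ, ContDiff ℝ ∞ X → ContDiff ℝ ∞ Y →
      (∀ x, 0 < X x) → (∀ x, 0 < Y x) → ∀ x, X x ∈ Set.Icc c₀ c₁ → Y x ∈ Set.Icc c₀ c₁ →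
      (∀ i' ≤ i, ‖iteratedFDeriv ℝ i' X x‖ ≤ B) → (∀ i' ≤ i, ‖iteratedFDeriv ℝ i' Y x‖ ≤ B) →
      ‖iteratedFDeriv ℝ i (fun y => deriv g (X y) - deriv g (Y y)) x‖ ≤
        M * ∑ i ∈ Finset.range (i + 1), ‖iteratedFDeriv ℝ i (fun y => X y - Y y) x‖) := fun i => by
      by_cases hi : i ≤ n
      · obtain ⟨M, hM0, hM⟩ := ih i (by omega) (deriv g) hg'
        exact ⟨M, hM0, fun _ => hM⟩
      · exact ⟨0, le_rfl, fun h => absurd h hi⟩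
    choose M₂ hM₂0 hM₂ using ih'
    set M₃ := ∑ i ∈ Finset.range (n + 1), M₂ i with hM₃
    have hM₃0 : 0 ≤ M₃ := Finset.sum_nonneg fun i _ => hM₂0 i
    refine ⟨2 ^ n * M₁ + 2 ^ n * (M₃ * B), by positivity,
      fun X Y hX hY hX0 hY0 x hx hy hXB hYB => ?_⟩
    set S := ∑ i ∈ Finset.range (n + 1 + 1), ‖iteratedFDeriv ℝ i (fun y => X y - Y y) x‖ with hS
    have hS0 : 0 ≤ S := Finset.sum_nonneg fun _ _ => norm_nonneg _
    have hSi : ∀ i ≤ n + 1, ‖iteratedFDeriv ℝ i (fun y => X y - Y y) x‖ ≤ S := fun i hi =>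
      Finset.single_le_sum (f := fun i => ‖iteratedFDeriv ℝ i (fun y => X y - Y y) x‖)
        (fun _ _ => norm_nonneg _) (Finset.mem_range.2 (by omega))
    have hXd : ∀ y, HasFDerivAt X (fderiv ℝ X y) y := fun y =>
      (hX.differentiable (by simp) y).hasFDerivAt
    have hYd : ∀ y, HasFDerivAt Y (fderiv ℝ Y y) y := fun y =>
      (hY.differentiable (by simp) y).hasFDerivAt
    have hXY : ContDiff ℝ ∞ fun y => X y - Y y := hX.sub hY
    have hgX : ContDiff ℝ ∞ fun y => deriv g (X y) := hg'.comp_contDiff hX hX0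
    have hgY : ContDiff ℝ ∞ fun y => deriv g (Y y) := hg'.comp_contDiff hY hY0
    have hdXY : ContDiff ℝ ∞ (fderiv ℝ fun y => X y - Y y) := hXY.fderiv_right (by norm_cast)
    have hdY : ContDiff ℝ ∞ (fderiv ℝ Y) := hY.fderiv_right (by norm_cast)
    have hfd : fderiv ℝ (fun y => g (X y) - g (Y y)) =
        (fun y => deriv g (X y) • fderiv ℝ (fun y => X y - Y y) y) +
        fun y => (deriv g (X y) - deriv g (Y y)) • fderiv ℝ Y y := by
      ext1 y
      have h1 := (hgd (X y) (hX0 y)).comp_hasFDerivAt y (hXd y)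
      have h2 := (hgd (Y y) (hY0 y)).comp_hasFDerivAt y (hYd y)
      have h3 : HasFDerivAt (fun y => g (X y) - g (Y y)) _ y := h1.sub h2
      rw [h3.fderiv, Pi.add_apply, ((hXd y).fun_sub (hYd y)).fderiv, smul_sub, sub_smul]
      abel
    have hs₁ : ContDiff ℝ ∞ fun y => deriv g (X y) • fderiv ℝ (fun y => X y - Y y) y :=
      hgX.smul hdXY
    have hs₂ : ContDiff ℝ ∞ fun y => (deriv g (X y) - deriv g (Y y)) • fderiv ℝ Y y :=
      (hgX.sub hgY).smul hdY
    rw [← norm_iteratedFDeriv_fderiv, hfd, iteratedFDeriv_add_apply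
      (hs₁.contDiffAt.of_le (by exact_mod_cast le_top))
      (hs₂.contDiffAt.of_le (by exact_mod_cast le_top))]
    refine (norm_add_le _ _).trans ?_
    rw [add_mul]
    refine add_le_add ?_ ?_
    · refine (norm_iteratedFDeriv_smul_le hgX hdXY x (by exact_mod_cast le_top)).trans ?_
      rw [mul_assoc]
      refine sum_choose_mul_le hM₁ (a := fun i => ‖iteratedFDeriv ℝ i (fun y => deriv g (X y)) x‖)
        (b := fun i => ‖iteratedFDeriv ℝ i (fderiv ℝ fun y => X y - Y y) x‖)
        (fun i _ => norm_nonneg _) (fun i hi => ?_) (fun i hi => ?_)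
      · have := hcomp Set.univ X uniqueDiffOn_univ hX.contDiffOn (fun y _ => hX0 y) x trivial hx
          (fun i _ hi => by rw [iteratedFDerivWithin_univ]; exact hXB i (by omega)) i hi
        rwa [iteratedFDerivWithin_univ] at this
      · rw [norm_iteratedFDeriv_fderiv]
        exact hSi _ (by omega)
    · refine (norm_iteratedFDeriv_smul_le (hgX.sub hgY) hdY x (by exact_mod_cast le_top)).trans ?_
      rw [mul_assoc, mul_right_comm M₃]
      refine sum_choose_mul_le (by positivity)
        (a := fun i => ‖iteratedFDeriv ℝ i (fun y => deriv g (X y) - deriv g (Y y)) x‖)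
        (b := fun i => ‖iteratedFDeriv ℝ i (fderiv ℝ Y) x‖)
        (fun i _ => norm_nonneg _) (fun i hi => ?_) (fun i hi => ?_)
      · refine (hM₂ i hi X Y hX hY hX0 hY0 x hx hy (fun j hj => hXB j (by omega))
          (fun j hj => hYB j (by omega))).trans ?_
        refine mul_le_mul (Finset.single_le_sum (f := M₂) (fun i _ => hM₂0 i)
          (Finset.mem_range.2 (by omega))) ?_ (Finset.sum_nonneg fun _ _ => norm_nonneg _) hM₃0
        exact Finset.sum_le_sum_of_subset_of_nonneg (Finset.range_mono (by omega))
          fun _ _ _ => norm_nonneg _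
      · rw [norm_iteratedFDeriv_fderiv]
        exact hYB _ (by omega)

/-! ### Convolutions with measures of bounded support -/

/-- For `y` near `x` and `w` in the bounded support, `y - w` stays in one compact ball, so a
constant dominates the derivatives. -/
lemma hasFDerivAt_integral_sub {V E : Type*} [NormedAddCommGroup V] [NormedSpace ℝ V]
    [FiniteDimensional ℝ V] [MeasurableSpace V] [BorelSpace V] [NormedAddCommGroup E]
    [NormedSpace ℝ E] {ν : Measure V} [IsFiniteMeasure ν] {R : ℝ} (hν : ∀ᵐ w ∂ν, ‖w‖ ≤ R)
    {Ψ : V → E} (hΨ : ContDiff ℝ 1 Ψ) (x : V) :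
    HasFDerivAt (fun x => ∫ w, Ψ (x - w) ∂ν) (∫ w, fderiv ℝ Ψ (x - w) ∂ν) x := by
  have : ProperSpace V := FiniteDimensional.proper ℝ V
  have hK : IsCompact (Metric.closedBall (0 : V) (‖x‖ + 1 + R)) := isCompact_closedBall _ _
  have hmem : ∀ y ∈ Metric.ball x 1, ∀ w : V, ‖w‖ ≤ R →
      y - w ∈ Metric.closedBall (0 : V) (‖x‖ + 1 + R) := fun y hy w hw => by
    rw [mem_closedBall_zero_iff]
    have h1 : ‖y - x‖ < 1 := by simpa [dist_eq_norm] using hy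
    have h2 : y - w = x + (y - x) - w := by abel
    rw [h2]
    have := norm_sub_le (x + (y - x)) w
    have := norm_add_le x (y - x)
    linarith
  have hcΨ := hΨ.continuous
  have hcd : Continuous (fderiv ℝ Ψ) := hΨ.continuous_fderiv (by simp)
  obtain ⟨A, hA⟩ := hK.exists_bound_of_continuousOn hcΨ.continuousOn
  obtain ⟨A', hA'⟩ := hK.exists_bound_of_continuousOn hcd.continuousOn
  have : SecondCountableTopology V := secondCountable_of_proper
  refine hasFDerivAt_integral_of_dominated_of_fderiv_le (bound := fun _ => A')
    (F' := fun x w => fderiv ℝ Ψ (x - w)) (Metric.ball_mem_nhds x one_pos) ?_ ?_ ?_ ?_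
    (integrable_const _) ?_
  · exact Eventually.of_forall fun y =>
      (hcΨ.comp (continuous_const.sub continuous_id)).aestronglyMeasurable
  · refine Integrable.of_bound (hcΨ.comp (continuous_const.sub continuous_id)).aestronglyMeasurable
      A ?_
    filter_upwards [hν] with w hw using hA _ (hmem x (Metric.mem_ball_self one_pos) w hw)
  · exact (hcd.comp (continuous_const.sub continuous_id)).aestronglyMeasurable
  · filter_upwards [hν] with w hw y hy using hA' _ (hmem y hy w hw)
  · refine Eventually.of_forall fun w y _ => ?_
    have h1 := (hΨ.differentiable (by simp) (y - w)).hasFDerivAt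
    have h2 : HasFDerivAt (fun y => y - w) (ContinuousLinearMap.id ℝ V) y :=
      (hasFDerivAt_id y).sub_const w
    have h3 := h1.comp y h2
    rw [ContinuousLinearMap.comp_id] at h3
    exact h3

/-- Allowing an arbitrary finite measure treats the exact inner integral and the lattice rule as
instances of one formula. -/
lemma iteratedFDeriv_integral_sub {V E : Type*} [NormedAddCommGroup V] [NormedSpace ℝ V]
    [FiniteDimensional ℝ V] [MeasurableSpace V] [BorelSpace V] [NormedAddCommGroup E]
    [NormedSpace ℝ E] [CompleteSpace E] {ν : Measure V} [IsFiniteMeasure ν] {R : ℝ}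
    (hν : ∀ᵐ w ∂ν, ‖w‖ ≤ R)
    {Ψ : V → E} (hΨ : ContDiff ℝ ∞ Ψ) (n : ℕ) :
    iteratedFDeriv ℝ n (fun x => ∫ w, Ψ (x - w) ∂ν) =
      fun x => ∫ w, iteratedFDeriv ℝ n Ψ (x - w) ∂ν := by
  induction n with
  | zero =>
    ext1 x
    rw [iteratedFDeriv_zero_eq_comp, Function.comp_apply,
      iteratedFDeriv_zero_eq_comp]
    exact ((continuousMultilinearCurryFin0 ℝ V E).symm.toContinuousLinearEquiv.integral_comp_comm
      _).symm
  | succ n ih =>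
    ext1 x
    have hs : ContDiff ℝ 1 (iteratedFDeriv ℝ n Ψ) := hΨ.iteratedFDeriv_right (m := 1) (by
      exact_mod_cast le_top)
    rw [iteratedFDeriv_succ_eq_comp_left, iteratedFDeriv_succ_eq_comp_left, Function.comp_apply, ih,
      (hasFDerivAt_integral_sub hν hs x).fderiv]
    exact (ContinuousLinearEquiv.integral_comp_comm (𝕜 := ℝ) (E := V →L[ℝ] V [×n]→L[ℝ] E)
      (F := V [×(n + 1)]→L[ℝ] E) (μ := ν) (continuousMultilinearCurryLeftEquiv ℝ
      (fun _ : Fin (n + 1) => V) E).symm.toContinuousLinearEquiv _).symm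

lemma contDiff_integral_sub {V E : Type*} [NormedAddCommGroup V] [NormedSpace ℝ V]
    [FiniteDimensional ℝ V] [MeasurableSpace V] [BorelSpace V] [NormedAddCommGroup E]
    [NormedSpace ℝ E] [CompleteSpace E] {ν : Measure V} [IsFiniteMeasure ν] {R : ℝ}
    (hν : ∀ᵐ w ∂ν, ‖w‖ ≤ R) {Ψ : V → E} (hΨ : ContDiff ℝ ∞ Ψ) :
    ContDiff ℝ ∞ fun x => ∫ w, Ψ (x - w) ∂ν := by
  refine contDiff_of_differentiable_iteratedFDeriv fun n _ => ?_
  rw [iteratedFDeriv_integral_sub hν hΨ]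
  exact fun x => (hasFDerivAt_integral_sub hν (hΨ.iteratedFDeriv_right (m := 1) (by
      exact_mod_cast le_top)) x).differentiableAt

lemma norm_le_sum_apply_single {m n : ℕ} {E : Type*} [NormedAddCommGroup E] [NormedSpace ℝ E]
    (A : (Fin m → ℝ) [×n]→L[ℝ] E) :
    ‖A‖ ≤ ∑ v : Fin n → Fin m, ‖A fun i => Pi.single (v i) 1‖ := by
  refine A.opNorm_le_bound (Finset.sum_nonneg fun _ _ => norm_nonneg _) fun x => ?_
  have h1 : A x = ∑ v : Fin n → Fin m, (∏ i, x i (v i)) • A fun i => Pi.single (v i) 1 := by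
    have h2 : x = fun i => ∑ j, x i j • (Pi.single j 1 : Fin m → ℝ) := by
      ext1 i
      exact pi_eq_sum_univ' (x i)
    conv_lhs => rw [h2]
    have h3 := A.toMultilinearMap.map_sum (fun i j => x i j • (Pi.single j 1 : Fin m → ℝ))
    refine h3.trans (Finset.sum_congr rfl fun v _ => ?_)
    exact A.toMultilinearMap.map_smul_univ (fun i => x i (v i)) _
  rw [h1, Finset.sum_mul]
  refine norm_sum_le_of_le _ fun v _ => ?_
  rw [norm_smul, mul_comm, norm_prod]
  refine mul_le_mul_of_nonneg_left ?_ (norm_nonneg _)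
  exact Finset.prod_le_prod (fun _ _ => norm_nonneg _) fun i _ => norm_le_pi_norm (x i) (v i)

/-! ### Symmetry of iterated derivatives of smooth functions -/

section Symmetry

variable {E F : Type*} [NormedAddCommGroup E] [NormedSpace ℝ E] [NormedAddCommGroup F]
  [NormedSpace ℝ F] {f : E → F} {s : Set E}

/-- The derivative of order `n + 1` is the derivative, in the direction of slot `0`, of the one of
order `n`; the symmetry of the latter in its `n` slots is inherited. -/
lemma iteratedFDerivWithin_comp_perm_of_fix_zero (hf : ContDiffOn ℝ ∞ f s)
    (hs : UniqueDiffOn ℝ s) {n : ℕ}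
    (ih : ∀ (σ : Equiv.Perm (Fin n)) (x : E), x ∈ s → ∀ v : Fin n → E,
      iteratedFDerivWithin ℝ n f s x (v ∘ σ) = iteratedFDerivWithin ℝ n f s x v)
    (e : Equiv.Perm (Fin n)) {σ : Equiv.Perm (Fin (n + 1))} (h0 : σ 0 = 0)
    (hσ : ∀ i, σ (Fin.succ i) = Fin.succ (e i)) {x : E} (hx : x ∈ s) (v : Fin (n + 1) → E) :
    iteratedFDerivWithin ℝ (n + 1) f s x (v ∘ σ) = iteratedFDerivWithin ℝ (n + 1) f s x v := by
  have hd : DifferentiableWithinAt ℝ (iteratedFDerivWithin ℝ n f s) s x :=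
    hf.differentiableOn_iteratedFDerivWithin (by exact_mod_cast WithTop.coe_lt_top n) hs x hx
  rw [iteratedFDerivWithin_succ_apply_left, iteratedFDerivWithin_succ_apply_left]
  have h1 : Fin.tail (v ∘ σ) = Fin.tail v ∘ e := by
    ext1 i
    simp [Fin.tail, hσ]
  rw [h1, Function.comp_apply, h0, ← fderivWithin_continuousMultilinear_apply_const_apply (hs x hx) hd,
    ← fderivWithin_continuousMultilinear_apply_const_apply (hs x hx) hd,
    fderivWithin_congr (fun y hy => ih e y hy (Fin.tail v)) (ih e x hx (Fin.tail v))]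

/-- The slots `0` and `1` belong to the second derivative of the derivative of order `n`, which is
symmetric at points in the closure of the interior. -/
lemma iteratedFDerivWithin_comp_swap_zero_one (hf : ContDiffOn ℝ ∞ f s)
    (hs : UniqueDiffOn ℝ s) (hcl : s ⊆ closure (interior s)) {n : ℕ} {x : E} (hx : x ∈ s)
    (v : Fin (n + 2) → E) :
    iteratedFDerivWithin ℝ (n + 2) f s x (v ∘ Equiv.swap 0 1)
      = iteratedFDerivWithin ℝ (n + 2) f s x v := by
  have hD : ContDiffOn ℝ ∞ (iteratedFDerivWithin ℝ n f s) s :=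
    fun y hy => (hf y hy).iteratedFDerivWithin_right hs (by norm_cast) hy
  have hd1 : DifferentiableWithinAt ℝ (iteratedFDerivWithin ℝ (n + 1) f s) s x :=
    hf.differentiableOn_iteratedFDerivWithin (by exact_mod_cast WithTop.coe_lt_top (n + 1)) hs x hx
  have hd2 : DifferentiableWithinAt ℝ (fderivWithin ℝ (iteratedFDerivWithin ℝ n f s) s) s x :=
    (hD.fderivWithin (m := ∞) hs (by norm_cast)).differentiableOn (by simp) x hx
  have hsymm : IsSymmSndFDerivWithinAt ℝ (iteratedFDerivWithin ℝ n f s) s x :=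
    (hD x hx).isSymmSndFDerivWithinAt
      (by rw [minSmoothness_of_isRCLikeNormedField]
          exact WithTop.coe_le_coe.2 (le_top : (2 : ℕ∞) ≤ ⊤)) hs (hcl hx) hx
  have key : ∀ w : Fin (n + 2) → E, iteratedFDerivWithin ℝ (n + 2) f s x w =
      fderivWithin ℝ (fderivWithin ℝ (iteratedFDerivWithin ℝ n f s) s) s x (w 0) (w 1)
        (Fin.tail (Fin.tail w)) := by
    intro w
    rw [iteratedFDerivWithin_succ_apply_left,
      ← fderivWithin_continuousMultilinear_apply_const_apply (hs x hx) hd1]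
    have h1 : ∀ y, iteratedFDerivWithin ℝ (n + 1) f s y (Fin.tail w) =
        fderivWithin ℝ (iteratedFDerivWithin ℝ n f s) s y (w 1) (Fin.tail (Fin.tail w)) := fun y =>
      iteratedFDerivWithin_succ_apply_left _
    simp_rw [h1]
    have h2 : HasFDerivWithinAt
        (fun y => fderivWithin ℝ (iteratedFDerivWithin ℝ n f s) s y (w 1))
        ((fderivWithin ℝ (fderivWithin ℝ (iteratedFDerivWithin ℝ n f s) s) s x).flip (w 1)) s x := by
      simpa using hd2.hasFDerivWithinAt.clm_apply (hasFDerivWithinAt_const (w 1) x s)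
    rw [fderivWithin_continuousMultilinear_apply_const_apply (hs x hx) h2.differentiableWithinAt,
      h2.fderivWithin (hs x hx)]
    rfl
  rw [key, key]
  have h3 : Fin.tail (Fin.tail (v ∘ Equiv.swap 0 1)) = Fin.tail (Fin.tail v) := by
    ext1 i
    simp only [Fin.tail, Function.comp_apply]
    rw [Equiv.swap_apply_of_ne_of_ne]
    · exact Fin.succ_ne_zero _
    · rw [← Fin.succ_zero_eq_one]
      exact fun h => Fin.succ_ne_zero i (Fin.succ_injective _ h)
  rw [h3]
  simp only [Function.comp_apply, Equiv.swap_apply_left, Equiv.swap_apply_right]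
  rw [hsymm]

/-- Iterated derivatives of a smooth function are symmetric. -/
theorem iteratedFDerivWithin_comp_perm_of_contDiffOn (hf : ContDiffOn ℝ ∞ f s)
    (hs : UniqueDiffOn ℝ s) (hcl : s ⊆ closure (interior s)) {n : ℕ} (σ : Equiv.Perm (Fin n))
    {x : E} (hx : x ∈ s) (v : Fin n → E) :
    iteratedFDerivWithin ℝ n f s x (v ∘ σ) = iteratedFDerivWithin ℝ n f s x v := by
  induction n generalizing x with
  | zero => rw [Subsingleton.elim (v ∘ σ) v]
  | succ n ih =>
    have hfix : ∀ (τ : Equiv.Perm (Fin (n + 1))), τ 0 = 0 → ∀ v : Fin (n + 1) → E,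
        iteratedFDerivWithin ℝ (n + 1) f s x (v ∘ τ) = iteratedFDerivWithin ℝ (n + 1) f s x v := by
      intro τ h0 v
      obtain ⟨⟨p, e⟩, rfl⟩ := Equiv.Perm.decomposeFin.symm.surjective τ
      have hp : p = 0 := by simpa using h0
      subst hp
      exact iteratedFDerivWithin_comp_perm_of_fix_zero hf hs
        (fun σ y hy w => ih (x := y) σ hy w) e h0 (fun i => by simp) hx v
    by_cases h0 : σ 0 = 0
    · exact hfix σ h0 v
    rcases n with _ | n
    · exact absurd (Fin.eq_zero _) h0
    set p := σ 0 with hp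
    -- Any `σ` with `σ 0 = p ≠ 0` factors as `(1 p)(0 1)τ`, where both `(1 p)` and `τ` fix `0`; each
    -- factor is covered by one of the two symmetries.
    set ρ : Equiv.Perm (Fin (n + 2)) := Equiv.swap 1 p with hρ
    have hρ0 : ρ 0 = 0 := Equiv.swap_apply_of_ne_of_ne (by simp) (Ne.symm h0)
    have hρ1 : ρ 1 = p := Equiv.swap_apply_left _ _
    set τ := Equiv.swap 0 1 * (ρ * σ) with hτ
    have hρρ : ρ * ρ = 1 := Equiv.swap_mul_self _ _
    have hτ0 : τ 0 = 0 := by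
      simp only [hτ, Equiv.Perm.mul_apply]
      rw [← hp, hρ, Equiv.swap_apply_right, Equiv.swap_apply_right]
    have hσ : σ = ρ * (Equiv.swap 0 1 * τ) := by
      rw [hτ, ← mul_assoc (Equiv.swap 0 1), Equiv.swap_mul_self, one_mul, ← mul_assoc, hρρ, one_mul]
    have h1 : v ∘ σ = ((v ∘ ρ) ∘ Equiv.swap 0 1) ∘ τ := by
      rw [hσ]; rfl
    rw [h1, hfix τ hτ0, iteratedFDerivWithin_comp_swap_zero_one hf hs hcl hx, hfix ρ hρ0]

end Symmetry

/-! ### Operator norm bounds from Gevrey regularity -/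

lemma uniqueDiffOn_paramCube (s : ℕ) : UniqueDiffOn ℝ (paramCube s) := by
  rw [paramCube, ← Set.pi_univ_Icc]
  exact UniqueDiffOn.univ_pi fun _ => uniqueDiffOn_Icc (by norm_num)

lemma paramCube_subset_closure_interior (s : ℕ) :
    paramCube s ⊆ closure (interior (paramCube s)) := by
  have h1 : (interior (paramCube s)).Nonempty := by
    refine ⟨0, mem_interior.2 ⟨Set.univ.pi fun _ => Set.Ioo (-(1 / 2) : ℝ) (1 / 2), ?_,
      isOpen_set_pi Set.finite_univ fun _ _ => isOpen_Ioo, ?_⟩⟩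
    · exact fun y hy => ⟨fun j => (hy j trivial).1.le, fun j => (hy j trivial).2.le⟩
    · intro j _
      norm_num
  have h2 : Convex ℝ (paramCube s) := convex_Icc _ _
  rw [h2.closure_interior_eq_closure_of_nonempty_interior h1]
  exact subset_closure

/-- `paramPartial` lists the directions in sorted order, whereas `v` is arbitrary. They differ by
the sorting permutation `e`, which symmetry on the closed cube removes. -/
lemma iteratedFDerivWithin_eq_paramPartial {s k n : ℕ}
    {G : (Fin s → ℝ) → EuclideanSpace ℝ (Fin k)} (hG : ContDiffOn ℝ ∞ G (paramCube s))
    {θ : Fin s → ℝ} (hθ : θ ∈ paramCube s) (v : Fin n → Fin s) :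
    iteratedFDerivWithin ℝ n G (paramCube s) θ (fun i => Pi.single (v i) 1) =
      paramPartial (fun j => Fintype.card {i // v i = j}) G θ := by
  set ν : Fin s → ℕ := fun j => Fintype.card {i // v i = j} with hν
  let e : Fin n ≃ Fin (∑ j, ν j) := (Equiv.sigmaFiberEquiv v).symm.trans
    ((Equiv.sigmaCongrRight fun j => Fintype.equivFin {i // v i = j}).trans finSigmaFinEquiv)
  have he : ∀ i, (finSigmaFinEquiv.symm (e i)).1 = v i := fun i => by
    simp [e, Equiv.sigmaFiberEquiv]
  -- The length `N` is made a variable so that the equation `n = ∑ ν j` can be eliminated and `e`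
  -- becomes a permutation.
  have gen : ∀ (N : ℕ) (_ : n = N) (e : Fin n ≃ Fin N) (w : Fin N → Fin s), (∀ i, w (e i) = v i) →
      iteratedFDerivWithin ℝ n G (paramCube s) θ (fun i => Pi.single (v i) 1) =
        iteratedFDerivWithin ℝ N G (paramCube s) θ (fun i => Pi.single (w i) 1) := by
    rintro N rfl e w hw
    have := iteratedFDerivWithin_comp_perm_of_contDiffOn hG (uniqueDiffOn_paramCube s)
      (paramCube_subset_closure_interior s) e hθ (fun i => (Pi.single (w i) 1 : Fin s → ℝ))
    rw [← this]
    congr 1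
    ext1 i
    simp [hw]
  exact gen _ (by simpa using Fintype.card_congr e) e (fun i => (finSigmaFinEquiv.symm i).1) he

/-- Expanding in the standard basis reduces operator norms to partial derivatives. The bounds `A n`
are fixed before `G`, which is the source of uniformity in `ξ`. -/
lemma GevreyBound.exists_norm_bound (s k : ℕ) (C β : ℝ) (b : ℕ → ℝ) :
    ∃ A : ℕ → ℝ, ∀ G : (Fin s → ℝ) → EuclideanSpace ℝ (Fin k), GevreyBound C β b G →
      ∀ n, ∀ θ ∈ paramCube s, ‖iteratedFDerivWithin ℝ n G (paramCube s) θ‖ ≤ A n := by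
  refine ⟨fun n => ∑ v : Fin n → Fin s,
    C * ((∑ j, Fintype.card {i // v i = j}).factorial : ℝ) ^ β *
      ∏ j : Fin s, b j ^ Fintype.card {i // v i = j}, fun G hG n θ hθ => ?_⟩
  refine (norm_le_sum_apply_single _).trans (Finset.sum_le_sum fun v _ => ?_)
  rw [iteratedFDerivWithin_eq_paramPartial hG.1 hθ]
  exact hG.2 θ hθ _

/-! ### Smoothing a positive function with probability measures -/

section Potential

variable {k : ℕ} {Ψ : (Fin k → ℝ) → ℝ}

lemma integrable_comp_sub {E : Type*} [NormedAddCommGroup E] {φ : (Fin k → ℝ) → E}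
    (hφ : Continuous φ) {ν : Measure (Fin k → ℝ)} [IsFiniteMeasure ν] {R : ℝ}
    (hν : ∀ᵐ w ∂ν, ‖w‖ ≤ R) (x : Fin k → ℝ) : Integrable (fun w => φ (x - w)) ν := by
  obtain ⟨A, hA⟩ := (isCompact_closedBall (0 : Fin k → ℝ) (‖x‖ + R)).exists_bound_of_continuousOn
    hφ.continuousOn
  refine Integrable.of_bound (hφ.comp (continuous_const.sub continuous_id)).aestronglyMeasurable
    A ?_
  filter_upwards [hν] with w hw
  exact hA _ (by rw [mem_closedBall_zero_iff]; exact (norm_sub_le _ _).trans (by linarith))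

/-- `Ψ` has a positive minimum on the compact ball that matters, and an average by a probability
measure cannot fall below it. Lattice rules have equal positive weights of total one, so they
respect the same bound at every level and shift. -/
lemma exists_integral_sub_mem_Icc (hΨ : Continuous Ψ) (hΨ0 : ∀ x, 0 < Ψ x) (r R : ℝ) :
    ∃ c₀ c₁, 0 < c₀ ∧ ∀ (ν : Measure (Fin k → ℝ)) [IsProbabilityMeasure ν], (∀ᵐ w ∂ν, ‖w‖ ≤ R) →
      ∀ x, ‖x‖ ≤ r → ∫ w, Ψ (x - w) ∂ν ∈ Set.Icc c₀ c₁ := by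
  have hK := isCompact_closedBall (0 : Fin k → ℝ) (r + R)
  obtain ⟨A, hA⟩ := hK.exists_bound_of_continuousOn hΨ.continuousOn
  obtain ⟨c₀, hc₀, hc⟩ : ∃ c₀, 0 < c₀ ∧ ∀ y ∈ Metric.closedBall (0 : Fin k → ℝ) (r + R),
      c₀ ≤ Ψ y := by
    rcases (Metric.closedBall (0 : Fin k → ℝ) (r + R)).eq_empty_or_nonempty with he | hne
    · exact ⟨1, one_pos, fun y hy => by simp [he] at hy⟩
    · obtain ⟨y, -, hy⟩ := hK.exists_isMinOn hne hΨ.continuousOn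
      exact ⟨Ψ y, hΨ0 y, fun z hz => hy hz⟩
  refine ⟨c₀, A, hc₀, fun ν _ hν x hx => ?_⟩
  have hmem : ∀ᵐ w ∂ν, x - w ∈ Metric.closedBall (0 : Fin k → ℝ) (r + R) := by
    filter_upwards [hν] with w hw
    rw [mem_closedBall_zero_iff]; exact (norm_sub_le _ _).trans (by linarith)
  have hi := integrable_comp_sub hΨ hν x
  constructor
  · have := integral_mono_ae (integrable_const c₀) hi (by
      filter_upwards [hmem] with w hw using hc _ hw)
    simpa using this
  · have := integral_mono_ae hi (integrable_const A) (by
      filter_upwards [hmem] with w hw using (le_abs_self _).trans (hA _ hw))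
    simpa using this

lemma integral_sub_pos (hΨ : Continuous Ψ) (hΨ0 : ∀ x, 0 < Ψ x) {R : ℝ}
    (ν : Measure (Fin k → ℝ)) [IsProbabilityMeasure ν] (hν : ∀ᵐ w ∂ν, ‖w‖ ≤ R) (x : Fin k → ℝ) :
    0 < ∫ w, Ψ (x - w) ∂ν := by
  obtain ⟨c₀, c₁, hc₀, h⟩ := exists_integral_sub_mem_Icc hΨ hΨ0 ‖x‖ R
  exact hc₀.trans_le (h ν hν x le_rfl).1

lemma exists_iteratedFDeriv_integral_sub_le (hΨ : ContDiff ℝ ∞ Ψ) (r R : ℝ) (N : ℕ) :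
    ∃ B, 0 ≤ B ∧ ∀ (ν : Measure (Fin k → ℝ)) [IsProbabilityMeasure ν], (∀ᵐ w ∂ν, ‖w‖ ≤ R) →
      ∀ x, ‖x‖ ≤ r → ∀ i ≤ N, ‖iteratedFDeriv ℝ i (fun x => ∫ w, Ψ (x - w) ∂ν) x‖ ≤ B := by
  have hb : ∀ i : ℕ, ∃ A, ∀ y ∈ Metric.closedBall (0 : Fin k → ℝ) (r + R),
      ‖iteratedFDeriv ℝ i Ψ y‖ ≤ A := fun i =>
    (isCompact_closedBall _ _).exists_bound_of_continuousOn
      (hΨ.continuous_iteratedFDeriv (by exact_mod_cast le_top)).continuousOn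
  choose A hA using hb
  refine ⟨∑ i ∈ Finset.range (N + 1), |A i|, Finset.sum_nonneg fun _ _ => abs_nonneg _,
    fun ν _ hν x hx i hi => ?_⟩
  have h1 : |A i| ≤ ∑ i ∈ Finset.range (N + 1), |A i| :=
    Finset.single_le_sum (f := fun i => |A i|) (fun _ _ => abs_nonneg _)
      (Finset.mem_range.2 (by omega))
  refine le_trans ?_ h1
  rw [iteratedFDeriv_integral_sub hν hΨ]
  have := norm_integral_le_of_norm_le_const (μ := ν) (C := |A i|)
    (f := fun w => iteratedFDeriv ℝ i Ψ (x - w)) (by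
      filter_upwards [hν] with w hw
      refine (hA i _ ?_).trans (le_abs_self _)
      rw [mem_closedBall_zero_iff]; exact (norm_sub_le _ _).trans (by linarith))
  simpa using this

/-- The partial derivatives of order at most `k`, indexed by tuples of directions. -/
abbrev DirIndex (k : ℕ) : Type := Σ i : Fin (k + 1), (Fin i → Fin k)

/-- The partial derivative of `Ψ` in the directions `j`. -/
noncomputable def dirDeriv (Ψ : (Fin k → ℝ) → ℝ) (j : DirIndex k) (x : Fin k → ℝ) : ℝ :=
  iteratedFDeriv ℝ j.1 Ψ x fun i => Pi.single (j.2 i) 1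

lemma contDiff_dirDeriv (hΨ : ContDiff ℝ ∞ Ψ) (j : DirIndex k) :
    ContDiff ℝ ∞ (dirDeriv Ψ j) :=
  (ContinuousMultilinearMap.apply ℝ (fun _ : Fin j.1 => Fin k → ℝ) ℝ
    fun i => Pi.single (j.2 i) 1).contDiff.comp
    (hΨ.iteratedFDeriv_right (m := ∞) (by norm_cast))

lemma dirDeriv_integral_sub (hΨ : ContDiff ℝ ∞ Ψ) {R : ℝ} {ν : Measure (Fin k → ℝ)}
    [IsFiniteMeasure ν] (hν : ∀ᵐ w ∂ν, ‖w‖ ≤ R) (j : DirIndex k) (x : Fin k → ℝ) :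
    dirDeriv (fun x => ∫ w, Ψ (x - w) ∂ν) j x = ∫ w, dirDeriv Ψ j (x - w) ∂ν := by
  rw [dirDeriv, iteratedFDeriv_integral_sub hν hΨ]
  exact ((ContinuousMultilinearMap.apply ℝ (fun _ : Fin j.1 => Fin k → ℝ) ℝ
    fun i => Pi.single (j.2 i) 1).integral_comp_comm (integrable_comp_sub
      (hΨ.continuous_iteratedFDeriv (by exact_mod_cast le_top)) hν x)).symm

lemma exists_comp_integral_sub_bound (hΨ : ContDiff ℝ ∞ Ψ) (hΨ0 : ∀ x, 0 < Ψ x) (r R : ℝ)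
    {g : ℝ → ℝ} (hg : ContDiffOn ℝ ∞ g (Set.Ioi 0)) :
    ∃ M, 0 ≤ M ∧ ∀ (ν : Measure (Fin k → ℝ)) [IsProbabilityMeasure ν], (∀ᵐ w ∂ν, ‖w‖ ≤ R) →
      ∀ x, ‖x‖ ≤ r → ∀ n ≤ k, ‖iteratedFDeriv ℝ n (fun y => g (∫ w, Ψ (y - w) ∂ν)) x‖ ≤ M := by
  obtain ⟨c₀, c₁, hc₀, hc⟩ := exists_integral_sub_mem_Icc hΨ.continuous hΨ0 r R
  obtain ⟨B, hB, hBb⟩ := exists_iteratedFDeriv_integral_sub_le hΨ r R k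
  obtain ⟨M, hM, h⟩ := exists_iteratedFDerivWithin_comp_bound (E := Fin k → ℝ) hg
    isOpen_Ioi.uniqueDiffOn (isCompact_Icc (a := c₀) (b := c₁)) (fun y hy => hc₀.trans_le hy.1) k B
  refine ⟨M, hM, fun ν _ hν x hx n hn => ?_⟩
  have := h Set.univ (fun y => ∫ w, Ψ (y - w) ∂ν) uniqueDiffOn_univ
    (contDiff_integral_sub hν hΨ).contDiffOn
    (fun y _ => integral_sub_pos hΨ.continuous hΨ0 ν hν y) x trivial (hc ν hν x hx)
    (fun i _ hi => by rw [iteratedFDerivWithin_univ]; exact hBb ν hν x hx i hi) n hn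
  rwa [iteratedFDerivWithin_univ] at this

/-- Differentiation in `x` commutes with both averages, so a derivative of their difference is the
difference of the averages of a derivative of `Ψ`. -/
lemma exists_comp_integral_sub_sub_bound (hΨ : ContDiff ℝ ∞ Ψ) (hΨ0 : ∀ x, 0 < Ψ x) (r R : ℝ)
    {g : ℝ → ℝ} (hg : ContDiffOn ℝ ∞ g (Set.Ioi 0)) :
    ∃ M, 0 ≤ M ∧ ∀ (ν ν' : Measure (Fin k → ℝ)) [IsProbabilityMeasure ν] [IsProbabilityMeasure ν'],
      (∀ᵐ w ∂ν, ‖w‖ ≤ R) → (∀ᵐ w ∂ν', ‖w‖ ≤ R) → ∀ x, ‖x‖ ≤ r → ∀ n ≤ k,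
      ‖iteratedFDeriv ℝ n (fun y => g (∫ w, Ψ (y - w) ∂ν) - g (∫ w, Ψ (y - w) ∂ν')) x‖ ≤
        M * ∑ j : DirIndex k, |∫ w, dirDeriv Ψ j (x - w) ∂ν - ∫ w, dirDeriv Ψ j (x - w) ∂ν'| := by
  obtain ⟨c₀, c₁, hc₀, hc⟩ := exists_integral_sub_mem_Icc hΨ.continuous hΨ0 r R
  obtain ⟨B, hB, hBb⟩ := exists_iteratedFDeriv_integral_sub_le hΨ r R k
  have hex := fun n => exists_comp_sub_bound (V := Fin k → ℝ) hc₀ c₁ B hB n g hg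
  choose M hM0 hM using hex
  refine ⟨∑ n ∈ Finset.range (k + 1), M n, Finset.sum_nonneg fun n _ => hM0 n,
    fun ν ν' _ _ hν hν' x hx n hn => ?_⟩
  have hX := contDiff_integral_sub hν hΨ
  have hY := contDiff_integral_sub hν' hΨ
  refine (hM n _ _ hX hY (integral_sub_pos hΨ.continuous hΨ0 ν hν)
    (integral_sub_pos hΨ.continuous hΨ0 ν' hν') x (hc ν hν x hx) (hc ν' hν' x hx)
    (fun i hi => hBb ν hν x hx i (hi.trans hn)) (fun i hi => hBb ν' hν' x hx i (hi.trans hn))).trans ?_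
  refine mul_le_mul (Finset.single_le_sum (f := M) (fun n _ => hM0 n)
    (Finset.mem_range.2 (by omega))) ?_ (Finset.sum_nonneg fun _ _ => norm_nonneg _)
    (Finset.sum_nonneg fun n _ => hM0 n)
  refine (Finset.sum_le_sum_of_subset_of_nonneg (Finset.range_mono (Nat.succ_le_succ hn))
    fun _ _ _ => norm_nonneg _).trans ?_
  rw [← Fin.sum_univ_eq_sum_range
    (fun i => ‖iteratedFDeriv ℝ i (fun y => ∫ w, Ψ (y - w) ∂ν - ∫ w, Ψ (y - w) ∂ν') x‖) (k + 1),
    Fintype.sum_sigma]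
  refine Finset.sum_le_sum fun i _ => (norm_le_sum_apply_single _).trans_eq
    (Finset.sum_congr rfl fun v _ => ?_)
  rw [← dirDeriv_integral_sub hΨ hν ⟨i, v⟩ x, ← dirDeriv_integral_sub hΨ hν' ⟨i, v⟩ x, dirDeriv,
    dirDeriv, Real.norm_eq_abs]
  congr 1
  have := iteratedFDeriv_sub_apply (i := i) (x := x) (𝕜 := ℝ)
    (hX.contDiffAt.of_le (by exact_mod_cast le_top)) (hY.contDiffAt.of_le (by exact_mod_cast le_top))
  have h2 : ((fun y => ∫ w, Ψ (y - w) ∂ν) - fun y => ∫ w, Ψ (y - w) ∂ν') =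
    fun y => ∫ w, Ψ (y - w) ∂ν - ∫ w, Ψ (y - w) ∂ν' := rfl
  rw [h2] at this
  rw [this]
  rfl

end Potential

/-! ### Admissible parametrizations -/

/-- A continuous map that is smooth on the unit cube, with prescribed bounds on its derivatives. -/
structure IsAdmissible {k s : ℕ} (A : ℕ → ℝ) (H : (Fin s → ℝ) → Fin k → ℝ) : Prop where
  continuous : Continuous H
  contDiffOn : ContDiffOn ℝ ∞ H (unitCube s)
  bound : ∀ n, ∀ t ∈ unitCube s, ‖iteratedFDerivWithin ℝ n H (unitCube s) t‖ ≤ A n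

lemma IsAdmissible.norm_le {k s : ℕ} {A : ℕ → ℝ} {H : (Fin s → ℝ) → Fin k → ℝ}
    (hH : IsAdmissible A H) {t : Fin s → ℝ} (ht : t ∈ unitCube s) : ‖H t‖ ≤ A 0 := by
  simpa using hH.bound 0 t ht

lemma norm_le_one_of_mem_unitCube {m : ℕ} {x : Fin m → ℝ} (hx : x ∈ unitCube m) : ‖x‖ ≤ 1 :=
  (pi_norm_le_iff_of_nonneg zero_le_one).2 fun i => by
    rw [Real.norm_eq_abs, abs_le]
    exact ⟨by linarith [show (0 : ℝ) ≤ x i from hx.1 i], hx.2 i⟩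

/-- The uniform distribution on the image of `H`. -/
noncomputable def uniformImage {k s : ℕ} (H : (Fin s → ℝ) → Fin k → ℝ) : Measure (Fin k → ℝ) :=
  (uniformCube s).map H

/-- The empirical distribution of `H` at the shifted lattice points. -/
noncomputable def latticeImage {k s : ℕ} (z : GenVec s) (ℓ : ℕ) (Δ : Fin s → ℝ)
    (H : (Fin s → ℝ) → Fin k → ℝ) : Measure (Fin k → ℝ) :=
  ((2 : ENNReal) ^ ℓ)⁻¹ • ∑ i ∈ Finset.Icc 1 (2 ^ ℓ), Measure.dirac (H (latticePoint z ℓ Δ i))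

section Admissible

variable {k s : ℕ} {A : ℕ → ℝ} {H : (Fin s → ℝ) → Fin k → ℝ}

lemma IsAdmissible.isProbabilityMeasure_uniformImage (hH : IsAdmissible A H) :
    IsProbabilityMeasure (uniformImage H) :=
  Measure.isProbabilityMeasure_map hH.continuous.measurable.aemeasurable

lemma IsAdmissible.ae_uniformImage (hH : IsAdmissible A H) :
    ∀ᵐ w ∂uniformImage H, ‖w‖ ≤ A 0 := by
  rw [uniformImage, ae_map_iff hH.continuous.measurable.aemeasurable
    (measurableSet_le measurable_norm measurable_const)]
  filter_upwards [ae_restrict_mem (measurableSet_unitCube s)] with t ht using hH.norm_le ht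

lemma IsAdmissible.integral_uniformImage (hH : IsAdmissible A H) {φ : (Fin k → ℝ) → ℝ}
    (hφ : Continuous φ) (x : Fin k → ℝ) :
    ∫ w, φ (x - w) ∂uniformImage H = ∫ t in unitCube s, φ (x - H t) := by
  rw [uniformImage, integral_map hH.continuous.measurable.aemeasurable, uniformCube]
  exact (hφ.comp (continuous_const.sub continuous_id)).aestronglyMeasurable

lemma isProbabilityMeasure_latticeImage (z : GenVec s) (ℓ : ℕ) (Δ : Fin s → ℝ)
    (H : (Fin s → ℝ) → Fin k → ℝ) : IsProbabilityMeasure (latticeImage z ℓ Δ H) := by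
  refine ⟨?_⟩
  rw [latticeImage, Measure.smul_apply, Measure.finsetSum_apply]
  simp only [measure_univ, Finset.sum_const, Nat.card_Icc, smul_eq_mul]
  rw [Nat.add_sub_cancel, nsmul_eq_mul, mul_one]
  push_cast
  exact ENNReal.inv_mul_cancel (by positivity) (by finiteness)

lemma IsAdmissible.ae_latticeImage (hH : IsAdmissible A H) (z : GenVec s) (ℓ : ℕ)
    (Δ : Fin s → ℝ) : ∀ᵐ w ∂latticeImage z ℓ Δ H, ‖w‖ ≤ A 0 := by
  rw [latticeImage]
  refine Measure.ae_smul_measure ?_ _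
  rw [ae_iff, Measure.finsetSum_apply, Finset.sum_eq_zero]
  intro i _
  rw [← ae_iff, ae_dirac_iff (measurableSet_le measurable_norm measurable_const)]
  exact hH.norm_le (latticePoint_mem z ℓ Δ i)

lemma integral_latticeImage (z : GenVec s) (ℓ : ℕ) (Δ : Fin s → ℝ)
    (H : (Fin s → ℝ) → Fin k → ℝ) (φ : (Fin k → ℝ) → ℝ) (x : Fin k → ℝ) :
    ∫ w, φ (x - w) ∂latticeImage z ℓ Δ H = latticeRule z ℓ Δ fun t => φ (x - H t) := by
  rw [latticeImage, integral_smul_measure, integral_finsetSum_measure]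
  · simp [latticeRule]
  · exact fun i _ => integrable_dirac (by simp)

/-- The error of the shifted lattice rule for `t ↦ φ (x - H t)`. -/
noncomputable def innerError (z : GenVec s) (ℓ : ℕ) (φ : (Fin k → ℝ) → ℝ)
    (H : (Fin s → ℝ) → Fin k → ℝ) (x : Fin k → ℝ) (Δ : Fin s → ℝ) : ℝ :=
  (∫ t in unitCube s, φ (x - H t)) - latticeRule z ℓ Δ fun t => φ (x - H t)

/-- The functions `t ↦ φ (x - H t)` have derivatives, hence Sobolev norms, bounded uniformly in `x`
and `H`. -/
lemma exists_innerError_sq_le {γ : Finset (Fin s) → ℝ} (hγ : ∀ u, 0 < γ u) {z : GenVec s} {r : ℝ}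
    (hz : HasRate z γ r) (A : ℕ → ℝ) {φ : (Fin k → ℝ) → ℝ} (hφ : ContDiff ℝ ∞ φ) :
    ∃ c, 0 ≤ c ∧ ∀ H, IsAdmissible A H → ∀ x ∈ unitCube k, ∀ ℓ : ℕ,
      ∫ Δ, innerError z ℓ φ H x Δ ^ 2 ∂uniformCube s ≤ c * ((2 : ℝ) ^ (-(r * ℓ))) ^ 2 := by
  obtain ⟨C, hC, hrate⟩ := hz
  obtain ⟨M, hM0, hM⟩ := exists_iteratedFDerivWithin_comp_bound (E := Fin s → ℝ)
    hφ.contDiffOn uniqueDiffOn_univ (isCompact_closedBall (0 : Fin k → ℝ) (1 + A 0))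
    (Set.subset_univ _) s (∑ i ∈ Finset.range (s + 1), |A i|)
  have hΓ : 0 ≤ ∑ u, 1 / γ u := Finset.sum_nonneg fun u _ => (one_div_pos.2 (hγ u)).le
  refine ⟨C ^ 2 * ((∑ u, 1 / γ u) * M ^ 2), by positivity, fun H hH x hx ℓ => ?_⟩
  set E : (Fin s → ℝ) → ℝ := fun t => φ (x - H t) with hE
  have hXs : ContDiffOn ℝ ∞ (fun t => x - H t) (unitCube s) := contDiffOn_const.sub hH.contDiffOn
  have hEs : ContDiffOn ℝ ∞ E (unitCube s) := hφ.comp_contDiffOn hXs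
  have hEb : ∀ t ∈ unitCube s, ∀ i ≤ s, ‖iteratedFDerivWithin ℝ i E (unitCube s) t‖ ≤ M := by
    intro t ht
    refine hM (unitCube s) (fun t => x - H t) (uniqueDiffOn_unitCube s) hXs
      (Set.mapsTo_univ _ _) t ht ?_ fun i hi1 hi => ?_
    · rw [mem_closedBall_zero_iff]
      exact (norm_sub_le _ _).trans
        (add_le_add (norm_le_one_of_mem_unitCube hx) (hH.norm_le ht))
    · have h1 := iteratedFDerivWithin_sub_apply (𝕜 := ℝ) (i := i) (x := t) (s := unitCube s)
        (f := fun _ => x) (g := H) contDiffWithinAt_const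
        ((hH.contDiffOn t ht).of_le (by exact_mod_cast le_top)) (uniqueDiffOn_unitCube s) ht
      have h2 : ((fun _ => x) - H : (Fin s → ℝ) → Fin k → ℝ) = fun t => x - H t := rfl
      rw [h2, iteratedFDerivWithin_const_of_ne (by omega), Pi.zero_apply, zero_sub] at h1
      rw [h1, norm_neg]
      refine (hH.bound i t ht).trans ((le_abs_self _).trans ?_)
      exact Finset.single_le_sum (f := fun i => |A i|) (fun _ _ => abs_nonneg _)
        (Finset.mem_range.2 (by omega))
  have hS := inSobolev_of_contDiffOn hEs
  have hN : sobolevNorm γ (smoothMixed E) ^ 2 ≤ (∑ u, 1 / γ u) * M ^ 2 := by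
    have := sobolevNorm_sq_le hγ (R := fun _ => M) (fun u => (hS.isWeakMixedPartial u).1)
      (memLp_const M) (fun u t ht => (abs_smoothMixed_le E u t).trans
        (hEb t ht _ (by simpa using Finset.card_le_univ u)))
    simpa [volume_unitCube, Measure.real] using this
  have h1 := hrate ℓ E _ hS
  rw [rms] at h1
  have h2 := (Real.sqrt_le_left (by
    have : 0 ≤ sobolevNorm γ (smoothMixed E) := Real.sqrt_nonneg _
    positivity)).1 h1
  simp_rw [sq_abs] at h2
  refine h2.trans ?_
  rw [mul_pow, mul_pow]
  calc _ ≤ C ^ 2 * ((2 : ℝ) ^ (-(r * ℓ))) ^ 2 * ((∑ u, 1 / γ u) * M ^ 2) := by gcongr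
    _ = _ := by ring

end Admissible

/-! ### Differences of lattice rules -/

/-- The difference of the lattice rules at two consecutive levels. -/
noncomputable def latticeDiff {m : ℕ} (z : GenVec m) (ℓ : ℕ) (Δ : Fin m → ℝ)
    (F : (Fin m → ℝ) → ℝ) : ℝ :=
  if ℓ = 0 then latticeRule z 0 Δ F else latticeRule z ℓ Δ F - latticeRule z (ℓ - 1) Δ F

section LatticeDiff

variable {m : ℕ} (z : GenVec m) (ℓ : ℕ) (Δ : Fin m → ℝ)

lemma latticeRule_congr {F F' : (Fin m → ℝ) → ℝ} (h : Set.EqOn F F' (unitCube m)) :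
    latticeRule z ℓ Δ F = latticeRule z ℓ Δ F' := by
  rw [latticeRule, latticeRule]
  congr 1
  exact Finset.sum_congr rfl fun i _ => h (latticePoint_mem z ℓ Δ i)

lemma latticeRule_sub (F F' : (Fin m → ℝ) → ℝ) :
    latticeRule z ℓ Δ (fun x => F x - F' x) = latticeRule z ℓ Δ F - latticeRule z ℓ Δ F' := by
  simp only [latticeRule, Finset.sum_sub_distrib, mul_sub]

lemma latticeDiff_sub (F F' : (Fin m → ℝ) → ℝ) :
    latticeDiff z ℓ Δ (fun x => F x - F' x) = latticeDiff z ℓ Δ F - latticeDiff z ℓ Δ F' := by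
  unfold latticeDiff
  split_ifs
  · exact latticeRule_sub _ _ _ _ _
  · rw [latticeRule_sub, latticeRule_sub]; ring

lemma sum_latticeDiff (F : (Fin m → ℝ) → ℝ) :
    ∑ i ∈ Finset.range (ℓ + 1), latticeDiff z i Δ F = latticeRule z ℓ Δ F := by
  induction ℓ with
  | zero => simp [latticeDiff]
  | succ n ih => rw [Finset.sum_range_succ, ih]; simp [latticeDiff]

lemma abs_latticeRule_le {F : (Fin m → ℝ) → ℝ} {B : ℝ} (hF : ∀ x ∈ unitCube m, |F x| ≤ B) :
    |latticeRule z ℓ Δ F| ≤ B := by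
  rw [latticeRule, abs_mul, abs_of_pos (by positivity), inv_mul_le_iff₀ (by positivity)]
  refine (Finset.abs_sum_le_sum_abs _ _).trans
    ((Finset.sum_le_sum fun i _ => hF _ (latticePoint_mem z ℓ Δ i)).trans_eq ?_)
  simp

lemma abs_latticeDiff_le {F : (Fin m → ℝ) → ℝ} {B : ℝ} (hF : ∀ x ∈ unitCube m, |F x| ≤ B) :
    |latticeDiff z ℓ Δ F| ≤ 2 * B := by
  have h := fun ℓ => abs_latticeRule_le z ℓ Δ hF
  unfold latticeDiff
  split_ifs
  · linarith [h 0, abs_nonneg (latticeRule z 0 Δ F)]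
  · exact (abs_sub _ _).trans (by linarith [h ℓ, h (ℓ - 1)])

lemma measurable_latticeRule {X : Type*} [MeasurableSpace X] {D : X → Fin m → ℝ}
    {F : X → (Fin m → ℝ) → ℝ} (hD : Measurable D) (hF : Measurable (Function.uncurry F)) :
    Measurable fun p => latticeRule z ℓ (D p) (F p) := by
  unfold latticeRule
  refine (Finset.measurable_sum _ fun i _ => ?_).const_mul _
  exact hF.comp (measurable_id.prodMk ((measurable_latticePoint z ℓ i).comp hD))

lemma measurable_latticeDiff {X : Type*} [MeasurableSpace X] {D : X → Fin m → ℝ}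
    {F : X → (Fin m → ℝ) → ℝ} (hD : Measurable D) (hF : Measurable (Function.uncurry F)) :
    Measurable fun p => latticeDiff z ℓ (D p) (F p) := by
  unfold latticeDiff
  split_ifs
  · exact measurable_latticeRule z 0 hD hF
  · exact (measurable_latticeRule z ℓ hD hF).sub (measurable_latticeRule z (ℓ - 1) hD hF)

end LatticeDiff

/-- A smooth function on `ℝ^m` whose derivatives up to order `m` are bounded by `R` on the unit
cube. -/
structure SmoothBoundedBy {m : ℕ} (W R : (Fin m → ℝ) → ℝ) : Prop where
  contDiff : ContDiff ℝ ∞ W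
  memLp : MemLp R 2 (volume.restrict (unitCube m))
  bound : ∀ x ∈ unitCube m, ∀ n ≤ m, ‖iteratedFDeriv ℝ n W x‖ ≤ R x

lemma SmoothBoundedBy.memLp_self {m : ℕ} {W R : (Fin m → ℝ) → ℝ} (h : SmoothBoundedBy W R) :
    MemLp W 2 (volume.restrict (unitCube m)) :=
  memLp_of_continuousOn h.contDiff.continuous.continuousOn

lemma SmoothBoundedBy.sq_integral_le {m : ℕ} {W R : (Fin m → ℝ) → ℝ} (h : SmoothBoundedBy W R) :
    (∫ x in unitCube m, W x) ^ 2 ≤ ∫ x in unitCube m, R x ^ 2 := by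
  refine (QMC.sq_integral_le _ h.memLp_self).trans
    (setIntegral_mono_on h.memLp_self.integrable_sq h.memLp.integrable_sq
      (measurableSet_unitCube m) fun x hx => ?_)
  have := h.bound x hx 0 (Nat.zero_le _)
  rw [norm_iteratedFDeriv_zero, Real.norm_eq_abs] at this
  exact sq_le_sq' (by linarith [neg_abs_le (W x)]) ((le_abs_self _).trans this)

lemma SmoothBoundedBy.memLp_latticeRule {m : ℕ} {W R : (Fin m → ℝ) → ℝ}
    (h : SmoothBoundedBy W R) (z : GenVec m) (ℓ : ℕ) :
    MemLp (fun Δ => latticeRule z ℓ Δ W) 2 (uniformCube m) := by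
  obtain ⟨B, hB⟩ := (isCompact_unitCube m).exists_bound_of_continuousOn
    h.contDiff.continuous.continuousOn
  refine MemLp.of_bound (measurable_latticeRule z ℓ (D := fun Δ => Δ) (F := fun _ => W)
    measurable_id (h.contDiff.continuous.measurable.comp measurable_snd)).aestronglyMeasurable B
    (Eventually.of_forall fun Δ => abs_latticeRule_le z ℓ Δ hB)

lemma HasRate.exists_error_sq_le {m : ℕ} {γ : Finset (Fin m) → ℝ} (hγ : ∀ u, 0 < γ u)
    {z : GenVec m} {r : ℝ} (hz : HasRate z γ r) :
    ∃ c, 0 ≤ c ∧ ∀ W R : (Fin m → ℝ) → ℝ, SmoothBoundedBy W R → ∀ ℓ : ℕ,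
      ∫ Δ, ((∫ x in unitCube m, W x) - latticeRule z ℓ Δ W) ^ 2 ∂uniformCube m ≤
        c * ((2 : ℝ) ^ (-(r * ℓ))) ^ 2 * ∫ x in unitCube m, R x ^ 2 := by
  obtain ⟨C, hC, hrate⟩ := hz
  have hΓ : 0 ≤ ∑ u, 1 / γ u := Finset.sum_nonneg fun u _ => (one_div_pos.2 (hγ u)).le
  refine ⟨C ^ 2 * ∑ u, 1 / γ u, by positivity, fun W R hW ℓ => ?_⟩
  have hS := inSobolev_of_contDiffOn hW.contDiff.contDiffOn
  have hN : sobolevNorm γ (smoothMixed W) ^ 2 ≤ (∑ u, 1 / γ u) * ∫ x in unitCube m, R x ^ 2 :=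
    sobolevNorm_sq_le hγ (fun u => (hS.isWeakMixedPartial u).1) hW.memLp fun u x hx => by
      refine (abs_smoothMixed_le W u x).trans ?_
      rw [iteratedFDerivWithin_eq_iteratedFDeriv (uniqueDiffOn_unitCube m)
        (hW.contDiff.contDiffAt.of_le (by exact_mod_cast le_top)) hx]
      exact hW.bound x hx _ (by simpa using Finset.card_le_univ u)
  have h1 := hrate ℓ W _ hS
  rw [rms] at h1
  have h2 := (Real.sqrt_le_left (by
    have : 0 ≤ sobolevNorm γ (smoothMixed W) := Real.sqrt_nonneg _
    positivity)).1 h1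
  simp_rw [sq_abs] at h2
  refine h2.trans ?_
  rw [mul_pow, mul_pow]
  calc _ ≤ C ^ 2 * ((2 : ℝ) ^ (-(r * ℓ))) ^ 2 * ((∑ u, 1 / γ u) * ∫ x in unitCube m, R x ^ 2) := by
        gcongr
    _ = _ := by ring

/-- A difference of consecutive rules is the difference of their errors. Passing from level `ℓ - 1`
to `ℓ` costs the factor `2^r`; at level `0` the integral itself, with `I² ≤ ∫ R²`, accounts for the
`c + 1`. -/
lemma HasRate.exists_latticeDiff_sq_le {m : ℕ} {γ : Finset (Fin m) → ℝ} (hγ : ∀ u, 0 < γ u)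
    {z : GenVec m} {r : ℝ} (hz : HasRate z γ r) :
    ∃ c, 0 ≤ c ∧ ∀ W R : (Fin m → ℝ) → ℝ, SmoothBoundedBy W R → ∀ ℓ : ℕ,
      ∫ Δ, latticeDiff z ℓ Δ W ^ 2 ∂uniformCube m ≤
        c * ((2 : ℝ) ^ (-(r * ℓ))) ^ 2 * ∫ x in unitCube m, R x ^ 2 := by
  obtain ⟨c, hc, h⟩ := hz.exists_error_sq_le hγ
  refine ⟨2 * (c + 1) * (1 + ((2 : ℝ) ^ r) ^ 2), by positivity, fun W R hW ℓ => ?_⟩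
  set I := ∫ x in unitCube m, W x with hI
  set J := ∫ x in unitCube m, R x ^ 2 with hJ
  have hJ0 : 0 ≤ J := integral_nonneg fun x => sq_nonneg _
  have hint : ∀ ℓ, Integrable (fun Δ => (I - latticeRule z ℓ Δ W) ^ 2) (uniformCube m) :=
    fun ℓ => ((memLp_const I).sub (hW.memLp_latticeRule z ℓ)).integrable_sq
  have key : ∀ (X Y : (Fin m → ℝ) → ℝ), Integrable (fun Δ => X Δ ^ 2) (uniformCube m) →
      Integrable (fun Δ => Y Δ ^ 2) (uniformCube m) →
      ∫ Δ, (X Δ - Y Δ) ^ 2 ∂uniformCube m ≤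
        2 * (∫ Δ, X Δ ^ 2 ∂uniformCube m) + 2 * ∫ Δ, Y Δ ^ 2 ∂uniformCube m := by
    intro X Y hX hY
    rw [← integral_const_mul, ← integral_const_mul, ← integral_add (hX.const_mul 2) (hY.const_mul 2)]
    exact integral_mono_of_nonneg (Eventually.of_forall fun _ => sq_nonneg _)
      ((hX.const_mul 2).add (hY.const_mul 2))
      (Eventually.of_forall fun Δ => by
        simp only; nlinarith [sq_nonneg (X Δ + Y Δ)])
  rcases Nat.eq_zero_or_pos ℓ with rfl | hℓ
  · have h1 : ∀ Δ, latticeDiff z 0 Δ W = I - (I - latticeRule z 0 Δ W) := fun Δ => by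
      simp [latticeDiff]
    simp_rw [h1]
    refine (key (fun _ => I) _ (integrable_const _) (hint 0)).trans ?_
    have h2 := h W R hW 0
    have h3 : I ^ 2 ≤ J := hW.sq_integral_le
    simp only [Nat.cast_zero, mul_zero, neg_zero, Real.rpow_zero, one_pow, mul_one,
      integral_const, probReal_univ, one_smul] at h2 ⊢
    have : 0 ≤ (c + 1) * J * ((2 : ℝ) ^ r) ^ 2 := by positivity
    nlinarith
  · obtain ⟨n, rfl⟩ : ∃ n, ℓ = n + 1 := ⟨ℓ - 1, by omega⟩
    have h1 : ∀ Δ, latticeDiff z (n + 1) Δ W =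
        (I - latticeRule z n Δ W) - (I - latticeRule z (n + 1) Δ W) := fun Δ => by
      simp [latticeDiff]
    simp_rw [h1]
    refine (key _ _ (hint n) (hint (n + 1))).trans ?_
    have h2 := h W R hW n
    have h3 := h W R hW (n + 1)
    have h4 : (2 : ℝ) ^ (-(r * n)) = 2 ^ r * (2 : ℝ) ^ (-(r * (n + 1 : ℕ))) := by
      rw [← Real.rpow_add two_pos]; congr 1; push_cast; ring
    rw [h4] at h2
    set ρ := (2 : ℝ) ^ (-(r * (n + 1 : ℕ)))
    set τ := (2 : ℝ) ^ r
    have : 0 ≤ ρ ^ 2 * J * (1 + τ ^ 2) := by positivity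
    nlinarith

/-! ### The sparse tensor product error on the unit cube -/

section SparseError

variable {k s : ℕ} {A : ℕ → ℝ} {H : (Fin s → ℝ) → Fin k → ℝ}

lemma IsAdmissible.continuous_integral (hH : IsAdmissible A H) {φ : (Fin k → ℝ) → ℝ}
    (hφ : ContDiff ℝ ∞ φ) : Continuous fun x => ∫ t in unitCube s, φ (x - H t) := by
  have := hH.isProbabilityMeasure_uniformImage
  simp_rw [← hH.integral_uniformImage hφ.continuous]
  exact (contDiff_integral_sub hH.ae_uniformImage hφ).continuous

lemma IsAdmissible.measurable_latticeRule_comp (hH : IsAdmissible A H) {φ : (Fin k → ℝ) → ℝ}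
    (hφ : Continuous φ) (z : GenVec s) (ℓ : ℕ) {X : Type*} [MeasurableSpace X]
    {x : X → Fin k → ℝ} {D : X → Fin s → ℝ} (hx : Measurable x) (hD : Measurable D) :
    Measurable fun p => latticeRule z ℓ (D p) fun t => φ (x p - H t) :=
  measurable_latticeRule z ℓ hD (F := fun p t => φ (x p - H t)) (hφ.measurable.comp
    ((hx.comp measurable_fst).sub (hH.continuous.measurable.comp measurable_snd)))

lemma IsAdmissible.measurable_innerError (hH : IsAdmissible A H) {φ : (Fin k → ℝ) → ℝ}
    (hφ : ContDiff ℝ ∞ φ) (z : GenVec s) (ℓ : ℕ) {X : Type*} [MeasurableSpace X]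
    {x : X → Fin k → ℝ} {D : X → Fin s → ℝ} (hx : Measurable x) (hD : Measurable D) :
    Measurable fun p => innerError z ℓ φ H (x p) (D p) :=
  ((hH.continuous_integral hφ).measurable.comp hx).sub
    (hH.measurable_latticeRule_comp hφ.continuous z ℓ hx hD)

lemma exists_abs_innerError_le (A : ℕ → ℝ) {φ : (Fin k → ℝ) → ℝ} (hφ : Continuous φ) :
    ∃ B, ∀ H : (Fin s → ℝ) → Fin k → ℝ, IsAdmissible A H → ∀ x ∈ unitCube k,
      ∀ (z : GenVec s) (ℓ : ℕ) (Δ : Fin s → ℝ), |innerError z ℓ φ H x Δ| ≤ B := by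
  obtain ⟨B, hB⟩ := (isCompact_closedBall (0 : Fin k → ℝ) (1 + A 0)).exists_bound_of_continuousOn
    hφ.continuousOn
  refine ⟨B + B, fun H hH x hx z ℓ Δ => (abs_sub _ _).trans (add_le_add ?_ ?_)⟩
  · have hb : ∀ t ∈ unitCube s, ‖φ (x - H t)‖ ≤ B := fun t ht => hB _ (by
      rw [mem_closedBall_zero_iff]
      exact (norm_sub_le _ _).trans (add_le_add (norm_le_one_of_mem_unitCube hx) (hH.norm_le ht)))
    have := norm_setIntegral_le_of_norm_le_const (μ := volume) (s := unitCube s)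
      (by simp [volume_unitCube]) hb
    simpa [volume_unitCube, Measure.real] using this
  · exact abs_latticeRule_le z ℓ Δ fun t ht => hB _ (by
      rw [mem_closedBall_zero_iff]
      exact (norm_sub_le _ _).trans (add_le_add (norm_le_one_of_mem_unitCube hx) (hH.norm_le ht)))

/-- The mean square, over shifts and outer variables, of the sum of the inner errors. -/
lemma exists_integral_sum_innerError_sq_le {γ : Finset (Fin s) → ℝ} (hγ : ∀ u, 0 < γ u)
    {z : GenVec s} {r : ℝ} (hz : HasRate z γ r) (A : ℕ → ℝ) {ι : Type*} [Fintype ι]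
    {φ : ι → (Fin k → ℝ) → ℝ} (hφ : ∀ j, ContDiff ℝ ∞ (φ j)) :
    ∃ c, 0 ≤ c ∧ ∀ H : (Fin s → ℝ) → Fin k → ℝ, IsAdmissible A H → ∀ ℓ : ℕ,
      MemLp (fun p : (Fin s → ℝ) × (Fin k → ℝ) => ∑ j, |innerError z ℓ (φ j) H p.2 p.1|) 2
        ((uniformCube s).prod (volume.restrict (unitCube k))) ∧
      (∀ Δ, MemLp (fun x => ∑ j, |innerError z ℓ (φ j) H x Δ|) 2 (volume.restrict (unitCube k))) ∧
      ∫ Δ, (∫ x in unitCube k, (∑ j, |innerError z ℓ (φ j) H x Δ|) ^ 2) ∂uniformCube s ≤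
        c * ((2 : ℝ) ^ (-(r * ℓ))) ^ 2 := by
  choose c hc0 hc using fun j => exists_innerError_sq_le (k := k) hγ hz A (hφ j)
  choose B hB using fun j => exists_abs_innerError_le (s := s) A (hφ j).continuous
  refine ⟨Fintype.card ι * ∑ j, c j,
    mul_nonneg (Nat.cast_nonneg _) (Finset.sum_nonneg fun j _ => hc0 j), fun H hH ℓ => ?_⟩
  have hae : ∀ᵐ p ∂((uniformCube s).prod (volume.restrict (unitCube k))), p.2 ∈ unitCube k :=
    Measure.quasiMeasurePreserving_snd.ae (ae_restrict_mem (measurableSet_unitCube k))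
  have hb : ∀ x ∈ unitCube k, ∀ Δ, ‖∑ j, |innerError z ℓ (φ j) H x Δ|‖ ≤ ∑ j, B j := by
    intro x hx Δ
    rw [Real.norm_eq_abs, abs_of_nonneg (Finset.sum_nonneg fun _ _ => abs_nonneg _)]
    exact Finset.sum_le_sum fun j _ => hB j H hH x hx z ℓ Δ
  have hm := fun j => hH.measurable_innerError (hφ j) z ℓ
    (X := (Fin s → ℝ) × (Fin k → ℝ)) measurable_snd measurable_fst
  have h1 : MemLp (fun p : (Fin s → ℝ) × (Fin k → ℝ) => ∑ j, |innerError z ℓ (φ j) H p.2 p.1|) 2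
      ((uniformCube s).prod (volume.restrict (unitCube k))) := by
    refine MemLp.of_bound (Finset.measurable_sum _ fun j _ =>
      (hm j).norm).aestronglyMeasurable (∑ j, B j) ?_
    filter_upwards [hae] with p hp using hb _ hp _
  have hj : ∀ j, MemLp (fun p : (Fin s → ℝ) × (Fin k → ℝ) => innerError z ℓ (φ j) H p.2 p.1) 2
      ((uniformCube s).prod (volume.restrict (unitCube k))) := fun j => by
    refine MemLp.of_bound (hm j).aestronglyMeasurable (B j) ?_
    filter_upwards [hae] with p hp using hB j H hH _ hp z ℓ _
  refine ⟨h1, fun Δ => ?_, ?_⟩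
  · refine MemLp.of_bound (Finset.measurable_sum _ fun j _ =>
      (hH.measurable_innerError (hφ j) z ℓ measurable_id measurable_const).norm).aestronglyMeasurable
      (∑ j, B j) ?_
    filter_upwards [ae_restrict_mem (measurableSet_unitCube k)] with x hx using hb x hx Δ
  · rw [← integral_prod (fun p : (Fin s → ℝ) × (Fin k → ℝ) =>
      (∑ j, |innerError z ℓ (φ j) H p.2 p.1|) ^ 2) h1.integrable_sq]
    calc _ ≤ ∫ p, Fintype.card ι * ∑ j, innerError z ℓ (φ j) H p.2 p.1 ^ 2
            ∂((uniformCube s).prod (volume.restrict (unitCube k))) := by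
          refine integral_mono h1.integrable_sq
            ((integrable_finsetSum _ fun j _ => (hj j).integrable_sq).const_mul _) fun p => ?_
          have := sq_sum_le_card_mul_sum_sq (s := (Finset.univ : Finset ι))
            (f := fun j => |innerError z ℓ (φ j) H p.2 p.1|)
          simpa [sq_abs] using this
      _ = Fintype.card ι * ∑ j, ∫ x in unitCube k,
            (∫ Δ, innerError z ℓ (φ j) H x Δ ^ 2 ∂uniformCube s) := by
          rw [integral_const_mul, integral_finsetSum _ fun j _ => (hj j).integrable_sq]
          simp_rw [integral_prod_symm _ (hj _).integrable_sq]
      _ ≤ Fintype.card ι * ∑ j, c j * ((2 : ℝ) ^ (-(r * ℓ))) ^ 2 := by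
          refine mul_le_mul_of_nonneg_left (Finset.sum_le_sum fun j _ => ?_) (Nat.cast_nonneg _)
          have := setIntegral_mono_on (μ := volume) (s := unitCube k)
            (hj j).integrable_sq.integral_prod_right (integrable_const _)
            (measurableSet_unitCube k) fun x hx => hc j H hH x hx ℓ
          simpa [volume_unitCube, Measure.real] using this
      _ = _ := by rw [← Finset.sum_mul]; ring

end SparseError

/-! ### Product rates for the mixed terms and the sparse error -/

section SparseRate

variable {k s : ℕ} {A : ℕ → ℝ} {H : (Fin s → ℝ) → Fin k → ℝ} {Ψ : (Fin k → ℝ) → ℝ} {g : ℝ → ℝ}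

/-- The outer integrand with exact inner integral. -/
noncomputable def outerIntegrand (g : ℝ → ℝ) (Ψ : (Fin k → ℝ) → ℝ) (H : (Fin s → ℝ) → Fin k → ℝ)
    (x : Fin k → ℝ) : ℝ :=
  g (∫ t in unitCube s, Ψ (x - H t))

/-- The outer integrand with the inner integral replaced by a shifted lattice rule. -/
noncomputable def outerIntegrandApprox (z : GenVec s) (ℓ : ℕ) (g : ℝ → ℝ) (Ψ : (Fin k → ℝ) → ℝ)
    (H : (Fin s → ℝ) → Fin k → ℝ) (Δ : Fin s → ℝ) (x : Fin k → ℝ) : ℝ :=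
  g (latticeRule z ℓ Δ fun t => Ψ (x - H t))

lemma exists_smoothBoundedBy_outerIntegrand (s : ℕ) (hΨ : ContDiff ℝ ∞ Ψ) (hΨ0 : ∀ x, 0 < Ψ x)
    (hg : ContDiffOn ℝ ∞ g (Set.Ioi 0)) (A : ℕ → ℝ) :
    ∃ M, ∀ H : (Fin s → ℝ) → Fin k → ℝ, IsAdmissible A H →
      SmoothBoundedBy (outerIntegrand g Ψ H) fun _ => M := by
  obtain ⟨M, -, hM⟩ := exists_comp_integral_sub_bound hΨ hΨ0 1 (A 0) hg
  refine ⟨M, fun H hH => ?_⟩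
  have := hH.isProbabilityMeasure_uniformImage
  have he : outerIntegrand g Ψ H = fun x => g (∫ w, Ψ (x - w) ∂uniformImage H) := by
    ext x; rw [outerIntegrand, hH.integral_uniformImage hΨ.continuous]
  rw [he]
  exact ⟨hg.comp_contDiff (contDiff_integral_sub hH.ae_uniformImage hΨ) fun x =>
      integral_sub_pos hΨ.continuous hΨ0 _ hH.ae_uniformImage x, memLp_const M, fun x hx n hn =>
      hM _ hH.ae_uniformImage x (norm_le_one_of_mem_unitCube hx) n hn⟩

/-- All dependence of the bound on the inner shift sits in the inner errors of the derivatives of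
`Ψ`; `M` is independent of shift, level and `H`. -/
lemma exists_smoothBoundedBy_sub (s : ℕ) (hΨ : ContDiff ℝ ∞ Ψ) (hΨ0 : ∀ x, 0 < Ψ x)
    (hg : ContDiffOn ℝ ∞ g (Set.Ioi 0)) (A : ℕ → ℝ) :
    ∃ M, ∀ H : (Fin s → ℝ) → Fin k → ℝ, IsAdmissible A H → ∀ (z : GenVec s) (ℓ : ℕ)
      (Δ : Fin s → ℝ),
      MemLp (fun x => ∑ j : DirIndex k, |innerError z ℓ (dirDeriv Ψ j) H x Δ|) 2
        (volume.restrict (unitCube k)) →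
      SmoothBoundedBy (fun x => outerIntegrand g Ψ H x - outerIntegrandApprox z ℓ g Ψ H Δ x)
        fun x => M * ∑ j : DirIndex k, |innerError z ℓ (dirDeriv Ψ j) H x Δ| := by
  obtain ⟨M, -, hM⟩ := exists_comp_integral_sub_sub_bound hΨ hΨ0 1 (A 0) hg
  refine ⟨M, fun H hH z ℓ Δ hmem => ?_⟩
  have := hH.isProbabilityMeasure_uniformImage
  have := isProbabilityMeasure_latticeImage z ℓ Δ H
  have he : (fun x => outerIntegrand g Ψ H x - outerIntegrandApprox z ℓ g Ψ H Δ x) =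
      fun x => g (∫ w, Ψ (x - w) ∂uniformImage H) - g (∫ w, Ψ (x - w) ∂latticeImage z ℓ Δ H) := by
    ext x
    rw [outerIntegrand, hH.integral_uniformImage hΨ.continuous, outerIntegrandApprox,
      integral_latticeImage]
  rw [he]
  refine ⟨?_, hmem.const_mul M, fun x hx n hn => ?_⟩
  · exact (hg.comp_contDiff (contDiff_integral_sub hH.ae_uniformImage hΨ) fun x =>
      integral_sub_pos hΨ.continuous hΨ0 _ hH.ae_uniformImage x).sub
      (hg.comp_contDiff (contDiff_integral_sub (hH.ae_latticeImage z ℓ Δ) hΨ) fun x =>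
      integral_sub_pos hΨ.continuous hΨ0 _ (hH.ae_latticeImage z ℓ Δ) x)
  · refine (hM _ _ hH.ae_uniformImage (hH.ae_latticeImage z ℓ Δ) x
      (norm_le_one_of_mem_unitCube hx) n hn).trans_eq ?_
    simp_rw [hH.integral_uniformImage (contDiff_dirDeriv hΨ _).continuous, integral_latticeImage]
    rfl

lemma exists_abs_outerIntegrandApprox_le (s : ℕ) (hΨ : ContDiff ℝ ∞ Ψ) (hΨ0 : ∀ x, 0 < Ψ x)
    (hg : ContDiffOn ℝ ∞ g (Set.Ioi 0)) (A : ℕ → ℝ) :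
    ∃ M, ∀ H : (Fin s → ℝ) → Fin k → ℝ, IsAdmissible A H → ∀ (z : GenVec s) (ℓ : ℕ)
      (Δ : Fin s → ℝ), ∀ x ∈ unitCube k, |outerIntegrandApprox z ℓ g Ψ H Δ x| ≤ M := by
  obtain ⟨M, -, hM⟩ := exists_comp_integral_sub_bound hΨ hΨ0 1 (A 0) hg
  refine ⟨M, fun H hH z ℓ Δ x hx => ?_⟩
  have := isProbabilityMeasure_latticeImage z ℓ Δ H
  have := hM _ (hH.ae_latticeImage z ℓ Δ) x (norm_le_one_of_mem_unitCube hx) 0 (Nat.zero_le _)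
  rwa [norm_iteratedFDeriv_zero, Real.norm_eq_abs, integral_latticeImage] at this

/-- The mixed terms of the error decomposition converge at the product of the two rates. -/
lemma exists_latticeDiff_sub_sq_le {γ₁ : Finset (Fin k) → ℝ} (hγ₁ : ∀ u, 0 < γ₁ u)
    {γ₂ : Finset (Fin s) → ℝ} (hγ₂ : ∀ u, 0 < γ₂ u) {z₁ : GenVec k} {z₂ : GenVec s} {r : ℝ}
    (hz₁ : HasRate z₁ γ₁ r) (hz₂ : HasRate z₂ γ₂ r) (hΨ : ContDiff ℝ ∞ Ψ) (hΨ0 : ∀ x, 0 < Ψ x)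
    (hg : ContDiffOn ℝ ∞ g (Set.Ioi 0)) (hgm : Measurable g) (A : ℕ → ℝ) :
    ∃ c, 0 ≤ c ∧ ∀ H : (Fin s → ℝ) → Fin k → ℝ, IsAdmissible A H → ∀ ℓ₁ ℓ₂ : ℕ,
      MemLp (fun Δ : (Fin k → ℝ) × (Fin s → ℝ) => latticeDiff z₁ ℓ₁ Δ.1 fun x =>
          outerIntegrand g Ψ H x - outerIntegrandApprox z₂ ℓ₂ g Ψ H Δ.2 x) 2
        ((uniformCube k).prod (uniformCube s)) ∧
      ∫ Δ, (latticeDiff z₁ ℓ₁ Δ.1 fun x =>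
          outerIntegrand g Ψ H x - outerIntegrandApprox z₂ ℓ₂ g Ψ H Δ.2 x) ^ 2
          ∂((uniformCube k).prod (uniformCube s)) ≤
        c * ((2 : ℝ) ^ (-(r * (ℓ₁ + ℓ₂ : ℕ)))) ^ 2 := by
  obtain ⟨c₁, hc₁, h₁⟩ := hz₁.exists_latticeDiff_sq_le hγ₁
  obtain ⟨c₂, hc₂, h₂⟩ := exists_integral_sum_innerError_sq_le (k := k) hγ₂ hz₂ A
    (fun j : DirIndex k => contDiff_dirDeriv hΨ j)
  obtain ⟨M, hM⟩ := exists_smoothBoundedBy_sub s hΨ hΨ0 hg A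
  obtain ⟨B₁, hB₁⟩ := exists_smoothBoundedBy_outerIntegrand s hΨ hΨ0 hg A
  obtain ⟨B₂, hB₂⟩ := exists_abs_outerIntegrandApprox_le s hΨ hΨ0 hg A
  refine ⟨c₁ * M ^ 2 * c₂, by positivity, fun H hH ℓ₁ ℓ₂ => ?_⟩
  obtain ⟨hE, hEΔ, hEb⟩ := h₂ H hH ℓ₂
  have hmem : MemLp (fun Δ : (Fin k → ℝ) × (Fin s → ℝ) => latticeDiff z₁ ℓ₁ Δ.1 fun x =>
          outerIntegrand g Ψ H x - outerIntegrandApprox z₂ ℓ₂ g Ψ H Δ.2 x) 2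
        ((uniformCube k).prod (uniformCube s)) := by
    refine MemLp.of_bound (measurable_latticeDiff z₁ ℓ₁ measurable_fst
      (F := fun (Δ : (Fin k → ℝ) × (Fin s → ℝ)) x =>
        outerIntegrand g Ψ H x - outerIntegrandApprox z₂ ℓ₂ g Ψ H Δ.2 x) ?_).aestronglyMeasurable
      (2 * (B₁ + B₂)) (Eventually.of_forall fun Δ => abs_latticeDiff_le z₁ ℓ₁ _ fun x hx => ?_)
    · refine ((hB₁ H hH).contDiff.continuous.measurable.comp measurable_snd).sub
        (hgm.comp (hH.measurable_latticeRule_comp hΨ.continuous z₂ ℓ₂ measurable_snd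
          (measurable_snd.comp measurable_fst)))
    · have := (hB₁ H hH).bound x hx 0 (Nat.zero_le _)
      rw [norm_iteratedFDeriv_zero, Real.norm_eq_abs] at this
      exact (abs_sub _ _).trans (add_le_add this (hB₂ H hH z₂ ℓ₂ _ x hx))
  refine ⟨hmem, ?_⟩
  -- For a fixed inner shift the integrand is a deterministic smooth function, so the outer rate
  -- applies; averaging its bound over the inner shift brings in the inner rate.
  rw [integral_prod_symm _ hmem.integrable_sq]
  calc _ ≤ ∫ Δ, c₁ * ((2 : ℝ) ^ (-(r * ℓ₁))) ^ 2 * (M ^ 2 * ∫ x in unitCube k,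
          (∑ j : DirIndex k, |innerError z₂ ℓ₂ (dirDeriv Ψ j) H x Δ|) ^ 2) ∂uniformCube s := by
        refine integral_mono hmem.integrable_sq.integral_prod_right
          ((hE.integrable_sq.integral_prod_left.const_mul _).const_mul _) fun Δ => ?_
        refine (h₁ _ _ (hM H hH z₂ ℓ₂ Δ (hEΔ Δ)) ℓ₁).trans_eq ?_
        simp_rw [mul_pow M]
        rw [integral_const_mul]
    _ ≤ c₁ * ((2 : ℝ) ^ (-(r * ℓ₁))) ^ 2 * (M ^ 2 * (c₂ * ((2 : ℝ) ^ (-(r * ℓ₂))) ^ 2)) := by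
        rw [integral_const_mul, integral_const_mul]
        gcongr
    _ = _ := by
        have : (2 : ℝ) ^ (-(r * (ℓ₁ + ℓ₂ : ℕ))) = 2 ^ (-(r * ℓ₁)) * (2 : ℝ) ^ (-(r * ℓ₂)) := by
          rw [← Real.rpow_add two_pos]; congr 1; push_cast; ring
        rw [this]; ring

lemma sq_sum_error_le (a : ℝ) (e : ℕ → ℝ) (L : ℕ) :
    (a + ∑ i ∈ Finset.range (L + 1), e i) ^ 2 ≤
      2 * a ^ 2 + 2 * (L + 1) * ∑ i ∈ Finset.range (L + 1), e i ^ 2 := by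
  have h := sq_sum_le_card_mul_sum_sq (s := Finset.range (L + 1)) (f := e)
  rw [Finset.card_range] at h
  push_cast at h
  nlinarith [sq_nonneg (a - ∑ i ∈ Finset.range (L + 1), e i)]

/-- The mean square error of the sparse tensor product rule on the unit cube. -/
theorem exists_sparse_error_sq_le {γ₁ : Finset (Fin k) → ℝ} (hγ₁ : ∀ u, 0 < γ₁ u)
    {γ₂ : Finset (Fin s) → ℝ} (hγ₂ : ∀ u, 0 < γ₂ u) {z₁ : GenVec k} {z₂ : GenVec s} {r : ℝ}
    (hz₁ : HasRate z₁ γ₁ r) (hz₂ : HasRate z₂ γ₂ r) (hΨ : ContDiff ℝ ∞ Ψ) (hΨ0 : ∀ x, 0 < Ψ x)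
    (hg : ContDiffOn ℝ ∞ g (Set.Ioi 0)) (hgm : Measurable g) (A : ℕ → ℝ) :
    ∃ c, 0 ≤ c ∧ ∀ H : (Fin s → ℝ) → Fin k → ℝ, IsAdmissible A H → ∀ L : ℕ,
      MemLp (fun Δ : (Fin k → ℝ) × (Fin s → ℝ) => (∫ x in unitCube k, outerIntegrand g Ψ H x) -
          ∑ i ∈ Finset.range (L + 1),
            latticeDiff z₁ i Δ.1 (outerIntegrandApprox z₂ (L - i) g Ψ H Δ.2)) 2
        ((uniformCube k).prod (uniformCube s)) ∧
      ∫ Δ, ((∫ x in unitCube k, outerIntegrand g Ψ H x) - ∑ i ∈ Finset.range (L + 1),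
            latticeDiff z₁ i Δ.1 (outerIntegrandApprox z₂ (L - i) g Ψ H Δ.2)) ^ 2
          ∂((uniformCube k).prod (uniformCube s)) ≤
        c * ((2 : ℝ) ^ (-(r * L))) ^ 2 * (L + 1) ^ 2 := by
  obtain ⟨c₁, hc₁, h₁⟩ := hz₁.exists_error_sq_le hγ₁
  obtain ⟨c₂, hc₂, h₂⟩ := exists_latticeDiff_sub_sq_le hγ₁ hγ₂ hz₁ hz₂ hΨ hΨ0 hg hgm A
  obtain ⟨M, hM⟩ := exists_smoothBoundedBy_outerIntegrand s hΨ hΨ0 hg A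
  refine ⟨2 * (c₁ * M ^ 2) + 2 * c₂, by positivity, fun H hH L => ?_⟩
  set I := ∫ x in unitCube k, outerIntegrand g Ψ H x
  set e : ℕ → (Fin k → ℝ) × (Fin s → ℝ) → ℝ := fun i Δ => latticeDiff z₁ i Δ.1 fun x =>
    outerIntegrand g Ψ H x - outerIntegrandApprox z₂ (L - i) g Ψ H Δ.2 x with he
  set a : (Fin k → ℝ) × (Fin s → ℝ) → ℝ :=
    fun Δ => I - latticeRule z₁ L Δ.1 (outerIntegrand g Ψ H) with ha
  -- The outer differences of the exact integrand telescope to `Q_L`, which is subtracted in `a` and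
  -- restored in the sum of the `e i`.
  have hdec : (fun Δ : (Fin k → ℝ) × (Fin s → ℝ) => I - ∑ i ∈ Finset.range (L + 1),
      latticeDiff z₁ i Δ.1 (outerIntegrandApprox z₂ (L - i) g Ψ H Δ.2)) =
      fun Δ => a Δ + ∑ i ∈ Finset.range (L + 1), e i Δ := by
    ext Δ
    simp only [he, ha]
    simp_rw [latticeDiff_sub]
    rw [Finset.sum_sub_distrib, sum_latticeDiff]
    ring
  have ha2 : MemLp a 2 ((uniformCube k).prod (uniformCube s)) :=
    ((memLp_const I).sub ((hM H hH).memLp_latticeRule z₁ L)).comp_fst _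
  have he2 : ∀ i, MemLp (e i) 2 ((uniformCube k).prod (uniformCube s)) :=
    fun i => (h₂ H hH i (L - i)).1
  have hsum := ha2.add (memLp_finsetSum (Finset.range (L + 1)) fun i _ => he2 i)
  rw [hdec]
  refine ⟨hsum, ?_⟩
  have hpt := fun Δ => congrFun hdec Δ
  simp_rw [hpt]
  have hi1 : Integrable (fun Δ => 2 * a Δ ^ 2) ((uniformCube k).prod (uniformCube s)) :=
    ha2.integrable_sq.const_mul 2
  have hi2 : Integrable (fun Δ => 2 * ((L : ℝ) + 1) * ∑ i ∈ Finset.range (L + 1), e i Δ ^ 2)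
      ((uniformCube k).prod (uniformCube s)) :=
    (integrable_finsetSum _ fun i _ => (he2 i).integrable_sq).const_mul _
  have haI : ∫ Δ, a Δ ^ 2 ∂((uniformCube k).prod (uniformCube s)) ≤
      c₁ * M ^ 2 * ((2 : ℝ) ^ (-(r * L))) ^ 2 := by
    have h3 := integral_fun_fst (μ := uniformCube k) (ν := uniformCube s)
      fun Δ => (I - latticeRule z₁ L Δ (outerIntegrand g Ψ H)) ^ 2
    simp only [probReal_univ, one_smul] at h3
    rw [ha, h3]
    refine (h₁ _ _ (hM H hH) L).trans_eq ?_
    simp [Measure.real]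
    ring
  calc _ ≤ ∫ Δ, (2 * a Δ ^ 2 + 2 * (L + 1) * ∑ i ∈ Finset.range (L + 1), e i Δ ^ 2)
          ∂((uniformCube k).prod (uniformCube s)) :=
        integral_mono hsum.integrable_sq (hi1.add hi2) fun Δ => sq_sum_error_le _ (fun i => e i Δ) L
    _ = 2 * (∫ Δ, a Δ ^ 2 ∂((uniformCube k).prod (uniformCube s))) + 2 * (L + 1) *
          ∑ i ∈ Finset.range (L + 1), ∫ Δ, e i Δ ^ 2 ∂((uniformCube k).prod (uniformCube s)) := by
        rw [integral_add hi1 hi2, integral_const_mul, integral_const_mul,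
          integral_finsetSum _ fun i _ => (he2 i).integrable_sq]
    _ ≤ 2 * (c₁ * M ^ 2 * ((2 : ℝ) ^ (-(r * L))) ^ 2) + 2 * (L + 1) *
          ∑ i ∈ Finset.range (L + 1), c₂ * ((2 : ℝ) ^ (-(r * L))) ^ 2 := by
        gcongr with i hi
        have := (h₂ H hH i (L - i)).2
        rwa [show i + (L - i) = L by have := Finset.mem_range.1 hi; omega] at this
    _ ≤ _ := by
        rw [Finset.sum_const, Finset.card_range, nsmul_eq_mul]
        push_cast
        have h4 : (1 : ℝ) ≤ (L + 1) ^ 2 := by nlinarith [(Nat.cast_nonneg L : (0 : ℝ) ≤ L)]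
        have h5 : 0 ≤ c₁ * M ^ 2 * ((2 : ℝ) ^ (-(r * L))) ^ 2 := by positivity
        nlinarith [mul_le_mul_of_nonneg_left h4 h5]

end SparseRate

open scoped Pointwise

/-! ### Transport of the model problem to the unit cube -/

/-- Covers both `[-K,K]^k`, with `R = 2K` and `a = K`, and `Θ_s`, with `R = 1` and `a = 1/2`. -/
lemma setIntegral_Icc_eq_unitCube {m : ℕ} {R a c d : ℝ} (hR : 0 < R) (hc : c = -a)
    (hd : d = R - a) (F : (Fin m → ℝ) → ℝ) :
    ∫ y in Set.Icc (fun _ : Fin m => c) (fun _ => d), F y =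
      R ^ m * ∫ x in unitCube m, F fun j => R * x j - a := by
  have h1 := Measure.setIntegral_comp_smul_of_pos (volume : Measure (Fin m → ℝ))
    (fun y => F (y - fun _ => a)) (unitCube m) hR
  have h2 := (measurePreserving_sub_right (volume : Measure (Fin m → ℝ))
    (fun _ => a)).setIntegral_preimage_emb (measurableEmbedding_subRight _) F
    (Set.Icc (fun _ : Fin m => c) fun _ => d)
  have h3 : (fun y : Fin m → ℝ => y - fun _ => a) ⁻¹' Set.Icc (fun _ : Fin m => c) (fun _ => d) =
      R • unitCube m := by
    ext y
    rw [Set.mem_smul_set_iff_inv_smul_mem₀ hR.ne', hc, hd]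
    simp only [unitCube, Set.mem_preimage, Set.mem_Icc, Pi.le_def, Pi.sub_apply, Pi.smul_apply,
      smul_eq_mul, Pi.zero_apply, Pi.one_apply, inv_mul_le_iff₀ hR, mul_one, sub_le_sub_iff_right]
    refine and_congr_left fun _ => forall_congr' fun i => ?_
    rw [mul_nonneg_iff_of_pos_left (inv_pos.2 hR)]
    constructor <;> intro h <;> linarith
  rw [h3] at h2
  rw [← h2]
  have h4 : (fun x : Fin m → ℝ => F fun j => R * x j - a) = fun x => F (R • x - fun _ => a) := rfl
  rw [h4, h1, Module.finrank_fin_fun, smul_eq_mul, mul_inv_cancel_left₀ (by positivity)]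

lemma contDiffOn_entropyFun : ContDiffOn ℝ ∞ entropyFun (Set.Ioi 0) :=
  contDiffOn_id.mul (contDiffOn_id.log fun _ hx => (Set.mem_Ioi.1 hx).ne')

lemma measurable_entropyFun : Measurable entropyFun := measurable_id.mul Real.measurable_log

/-- The Gaussian noise density, with the argument scaled by `R`. -/
noncomputable def scaledGaussian {k : ℕ} (Γ : Matrix (Fin k) (Fin k) ℝ) (R : ℝ)
    (v : Fin k → ℝ) : ℝ :=
  1 / √(((2 * Real.pi) • Γ).det) * Real.exp (-(1 / 2) * noiseNorm Γ (fun i => R * v i) ^ 2)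

/-- Positive definiteness cancels the square root in `noiseNorm` and leaves a polynomial in the
exponent. -/
lemma contDiff_scaledGaussian {k : ℕ} {Γ : Matrix (Fin k) (Fin k) ℝ} (hΓ : Γ.PosDef) (R : ℝ) :
    ContDiff ℝ ∞ (scaledGaussian Γ R) := by
  have h : ∀ x : Fin k → ℝ, noiseNorm Γ x ^ 2 = ∑ i, x i * ∑ j, Γ⁻¹ i j * x j := fun x => by
    rw [noiseNorm, Real.sq_sqrt (by simpa using hΓ.inv.posSemidef.dotProduct_mulVec_nonneg x)]
    rfl
  unfold scaledGaussian
  simp_rw [h]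
  fun_prop

lemma scaledGaussian_pos {k : ℕ} {Γ : Matrix (Fin k) (Fin k) ℝ} (hΓ : Γ.PosDef) (R : ℝ)
    (v : Fin k → ℝ) : 0 < scaledGaussian Γ R v := by
  have : 0 < ((2 * Real.pi) • Γ).det := (hΓ.smul Real.two_pi_pos).det_pos
  unfold scaledGaussian
  positivity

/-- The affine map from `[-K,K]^k` to the unit cube. -/
noncomputable def toUnitCube {k : ℕ} (K : ℝ) (v : EuclideanSpace ℝ (Fin k)) (i : Fin k) : ℝ :=
  (K + v i) / (2 * K)

lemma contDiff_toUnitCube {k : ℕ} (K : ℝ) : ContDiff ℝ ∞ (toUnitCube (k := k) K) := by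
  unfold toUnitCube
  fun_prop

/-- The forward model in unit cube coordinates; it is extended from the unit cube by clamping the
coordinates. -/
noncomputable def unitModel {k s : ℕ} (K : ℝ) (G : (Fin s → ℝ) → EuclideanSpace ℝ (Fin k))
    (t : Fin s → ℝ) : Fin k → ℝ :=
  toUnitCube K (G fun j => max 0 (min 1 (t j)) - 1 / 2)

lemma unitModel_eqOn {k s : ℕ} (K : ℝ) (G : (Fin s → ℝ) → EuclideanSpace ℝ (Fin k)) :
    Set.EqOn (unitModel K G) (toUnitCube K ∘ fun t => G (t - fun _ => 1 / 2)) (unitCube s) := by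
  intro t ht
  have : (fun j => max 0 (min 1 (t j)) - 1 / 2) = t - fun _ => 1 / 2 := by
    ext j
    have h0 : 0 ≤ t j := ht.1 j
    have h1 : t j ≤ 1 := ht.2 j
    rw [min_eq_right h1, max_eq_right h0]
    rfl
  rw [unitModel, this]
  rfl

/-- This is the convolution structure: `y` and `G(θ)` are rescaled by the same affine map, whose
shift cancels in `y - G(θ)`. -/
lemma likelihood_eq_scaledGaussian {k s : ℕ} (Γ : Matrix (Fin k) (Fin k) ℝ) {K : ℝ} (hK : 0 < K)
    (G : (Fin s → ℝ) → EuclideanSpace ℝ (Fin k)) (x : Fin k → ℝ) {t : Fin s → ℝ}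
    (ht : t ∈ unitCube s) :
    likelihood Γ G (fun j => t j - 1 / 2) (fun j => 2 * K * x j - K) =
      scaledGaussian Γ (2 * K) (x - unitModel K G t) := by
  rw [unitModel_eqOn K G ht, likelihood, scaledGaussian]
  congr 5
  ext i
  have : (fun j => t j - 1 / 2) = t - fun _ => 1 / 2 := rfl
  rw [this]
  simp only [Function.comp_apply, toUnitCube, Pi.sub_apply]
  field_simp
  ring

lemma vadd_unitCube (s : ℕ) : (-fun _ => 1 / 2 : Fin s → ℝ) +ᵥ unitCube s = paramCube s := by
  ext t
  rw [Set.mem_vadd_set_iff_neg_vadd_mem, neg_neg]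
  simp only [unitCube, paramCube, Set.mem_Icc, Pi.le_def, vadd_eq_add, Pi.add_apply,
    Pi.zero_apply, Pi.one_apply]
  exact and_congr (forall_congr' fun i => by constructor <;> intro h <;> linarith)
    (forall_congr' fun i => by constructor <;> intro h <;> linarith)

lemma exists_isAdmissible_unitModel (s k : ℕ) (C β : ℝ) (b : ℕ → ℝ) (K : ℝ) :
    ∃ A, ∀ G : (Fin s → ℝ) → EuclideanSpace ℝ (Fin k), GevreyBound C β b G →
      IsAdmissible A (unitModel K G) := by
  obtain ⟨B, hB⟩ := GevreyBound.exists_norm_bound s k C β b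
  have hex := fun n : ℕ => exists_iteratedFDerivWithin_comp_bound (E := Fin s → ℝ)
    (contDiff_toUnitCube (k := k) K).contDiffOn uniqueDiffOn_univ
    (isCompact_closedBall (0 : EuclideanSpace ℝ (Fin k)) (B 0)) (Set.subset_univ _) n
    (∑ i ∈ Finset.range (n + 1), |B i|)
  choose A hA0 hA using hex
  refine ⟨A, fun G hG => ?_⟩
  have hmaps : Set.MapsTo (fun t : Fin s → ℝ => t - fun _ => (1 / 2 : ℝ)) (unitCube s)
      (paramCube s) := fun t ht => by
    rw [← vadd_unitCube]
    exact ⟨t, ht, by simp [sub_eq_add_neg, add_comm]⟩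
  have hX : ContDiffOn ℝ ∞ (fun t => G (t - fun _ => (1 / 2 : ℝ))) (unitCube s) :=
    hG.1.comp (contDiff_id.sub contDiff_const).contDiffOn hmaps
  have hder : ∀ i, ∀ t ∈ unitCube s, ‖iteratedFDerivWithin ℝ i
      (fun t => G (t - fun _ => (1 / 2 : ℝ))) (unitCube s) t‖ ≤ B i := fun i t ht => by
    rw [iteratedFDerivWithin_comp_sub, vadd_unitCube]
    exact hB G hG i _ (hmaps ht)
  refine ⟨?_, ?_, fun n t ht => ?_⟩
  · refine (contDiff_toUnitCube K).continuous.comp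
      (hG.1.continuousOn.comp_continuous (by fun_prop) fun t => ⟨fun j => ?_, fun j => ?_⟩)
    · have := le_max_left (0 : ℝ) (min 1 (t j))
      show -(1 / 2 : ℝ) ≤ _
      linarith
    · have := max_le zero_le_one (min_le_left (1 : ℝ) (t j))
      show _ ≤ (1 / 2 : ℝ)
      linarith
  · exact ((contDiff_toUnitCube K).comp_contDiffOn hX).congr (unitModel_eqOn K G)
  · rw [iteratedFDerivWithin_congr (unitModel_eqOn K G) ht]
    refine hA n _ _ (uniqueDiffOn_unitCube s) hX (Set.mapsTo_univ _ _) t ht ?_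
      (fun i _ hi => (hder i t ht).trans ((le_abs_self _).trans ?_)) n le_rfl
    · simpa using hder 0 t ht
    · exact Finset.single_le_sum (f := fun i => |B i|) (fun _ _ => abs_nonneg _)
        (Finset.mem_range.2 (by omega))

lemma truncatedIntegral_eq {k s : ℕ} (Γ : Matrix (Fin k) (Fin k) ℝ) {K : ℝ} (hK : 0 < K)
    (G : (Fin s → ℝ) → EuclideanSpace ℝ (Fin k)) :
    truncatedIntegral Γ G K = (2 * K) ^ k *
      ∫ x in unitCube k, outerIntegrand entropyFun (scaledGaussian Γ (2 * K)) (unitModel K G) x := by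
  rw [truncatedIntegral, setIntegral_Icc_eq_unitCube (R := 2 * K) (a := K) (by positivity) rfl
    (by ring)]
  congr 1
  refine integral_congr_ae (Eventually.of_forall fun x => ?_)
  have : ∫ θ in paramCube s, likelihood Γ G θ (fun j => 2 * K * x j - K) =
      ∫ t in unitCube s, scaledGaussian Γ (2 * K) (x - unitModel K G t) := by
    rw [paramCube, setIntegral_Icc_eq_unitCube (R := 1) (a := 1 / 2) one_pos rfl (by norm_num),
      one_pow, one_mul]
    refine setIntegral_congr_fun (measurableSet_unitCube s) fun t ht => ?_
    simp only [one_mul]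
    exact likelihood_eq_scaledGaussian Γ hK G x ht
  simp only [outerIntegrand, entropyFun]
  rw [this, mul_comm]

lemma outerDiff_eq {k : ℕ} (z : GenVec k) (K : ℝ) (ℓ : ℕ) (Δ : Fin k → ℝ)
    (F : (Fin k → ℝ) → ℝ) :
    outerDiff z K ℓ Δ F = (2 * K) ^ k * latticeDiff z ℓ Δ fun x => F fun j => 2 * K * x j - K := by
  unfold outerDiff latticeDiff outerRule
  split_ifs
  · rfl
  · ring

lemma latticeDiff_sum {m : ℕ} (z : GenVec m) (ℓ : ℕ) (Δ : Fin m → ℝ) {ι : Type*} (t : Finset ι)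
    (F : ι → (Fin m → ℝ) → ℝ) :
    ∑ i ∈ t, latticeDiff z ℓ Δ (F i) = latticeDiff z ℓ Δ fun x => ∑ i ∈ t, F i x := by
  have h : ∀ ℓ, latticeRule z ℓ Δ (fun x => ∑ i ∈ t, F i x) = ∑ i ∈ t, latticeRule z ℓ Δ (F i) :=
    fun ℓ => by simp only [latticeRule, Finset.mul_sum]; exact Finset.sum_comm
  unfold latticeDiff
  split_ifs
  · exact (h 0).symm
  · rw [h, h, Finset.sum_sub_distrib]

lemma sum_innerDiff {s : ℕ} (z : GenVec s) (ℓ₀ n : ℕ) (Δ : Fin s → ℝ) (H : (Fin s → ℝ) → ℝ) :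
    ∑ i ∈ Finset.range (n + 1), innerDiff z ℓ₀ i Δ H = entropyFun (innerRule z ℓ₀ n Δ H) := by
  induction n with
  | zero => simp [innerDiff]
  | succ n ih => rw [Finset.sum_range_succ, ih]; simp [innerDiff]

/-- For `σ = 1` the index set is the triangle `ℓ₁ + ℓ₂ ≤ L`. The outer differences are linear, so
for a fixed `ℓ₁` the inner ones can be summed inside and telescope to level `L - ℓ₁`. -/
lemma sparseCubature_eq {k s : ℕ} (z₁ : GenVec k) (z₂ : GenVec s) (Γ : Matrix (Fin k) (Fin k) ℝ)
    {K : ℝ} (hK : 0 < K) (G : (Fin s → ℝ) → EuclideanSpace ℝ (Fin k)) (L : ℕ) (Δ₁ : Fin k → ℝ)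
    (Δ₂ : Fin s → ℝ) :
    sparseCubature z₁ z₂ K 0 1 L Δ₁ Δ₂ (likelihood Γ G) = (2 * K) ^ k *
      ∑ i ∈ Finset.range (L + 1), latticeDiff z₁ i Δ₁
        (outerIntegrandApprox z₂ (L - i) entropyFun (scaledGaussian Γ (2 * K)) (unitModel K G)
          Δ₂) := by
  rw [sparseCubature, Finset.sum_filter, Finset.sum_product, Finset.mul_sum, div_one, one_mul,
    Nat.floor_natCast]
  refine Finset.sum_congr rfl fun i hi => ?_
  have hi' : i ≤ L := Nat.lt_succ_iff.1 (Finset.mem_range.1 hi)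
  have hset : (Finset.range (L + 1)).filter (fun j : ℕ => (1 : ℝ) * i + j / 1 ≤ L) =
      Finset.range (L - i + 1) := by
    ext j
    rw [Finset.mem_filter, one_mul, div_one, ← Nat.cast_add, Nat.cast_le, Finset.mem_range,
      Finset.mem_range]
    omega
  rw [← Finset.sum_filter, hset]
  simp_rw [outerDiff_eq]
  rw [← Finset.mul_sum, latticeDiff_sum]
  simp_rw [sum_innerDiff]
  congr 2
  ext x
  rw [outerIntegrandApprox, innerRule, add_zero]
  congr 1
  exact latticeRule_congr _ _ _ fun t ht => likelihood_eq_scaledGaussian Γ hK G x ht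

end QMC

/-! ### Conclusion on the original domains -/

theorem mainTheorem1
    -- data of the model: dimension, noise covariance, design space, forward models
    {k : ℕ} (Γ : Matrix (Fin k) (Fin k) ℝ) (hΓ : Γ.PosDef)
    {Ξ : Type*} (G : (s : ℕ) → (Fin s → ℝ) → Ξ → EuclideanSpace ℝ (Fin k))
    -- regularity of the forward models
    (C β p : ℝ) (b : ℕ → ℝ) (hC : 1 ≤ C) (hβ : 1 ≤ β)
    (hp₀ : 0 < p) (hp : p ≤ min (2 / 3) (1 / β)) (hpβ : p ≠ 1 / β)
    (hb₀ : ∀ j, 0 ≤ b j) (hb : Summable fun j => b j ^ p)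
    (hG : ∀ s, 1 ≤ s → ∀ ξ : Ξ, QMC.GevreyBound C β b fun θ => G s θ ξ)
    -- lower bound on the smallest eigenvalue of the covariance
    (μmin : ℝ) (hμ₀ : 0 < μmin) (hμ₁ : μmin ≤ 1)
    (hμ : ∀ i, μmin ≤ hΓ.isHermitian.eigenvalues i)
    -- truncation parameter, parameter dimension, weights
    (K : ℝ) (hK : 0 < K) (s : ℕ) (hs : 1 ≤ s)
    (γ₁ : Finset (Fin k) → ℝ) (hγ₁ : ∀ u, 0 < γ₁ u)
    (γ₂ : Finset (Fin s) → ℝ) (hγ₂ : ∀ u, 0 < γ₂ u) :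
    -- lattice rules of order arbitrarily close to one exist for the outer and the inner integral
    (∃ (z₁ : QMC.GenVec k) (z₂ : QMC.GenVec s), ∀ δ : ℝ, 0 < δ →
      QMC.HasRate z₁ γ₁ (1 - δ) ∧ QMC.HasRate z₂ γ₂ (1 - δ)) ∧
    -- and for any such rules the sparse tensor product cubature converges as claimed
    (∀ (z₁ : QMC.GenVec k) (z₂ : QMC.GenVec s) (δ : ℝ), 0 < δ →
      QMC.HasRate z₁ γ₁ (1 - δ) → QMC.HasRate z₂ γ₂ (1 - δ) →
      ∃ (ℓ₀ : ℕ) (C' : ℝ), 0 < C' ∧ ∀ (ξ : Ξ) (L : ℕ),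
        MemLp (fun Δ : (Fin k → ℝ) × (Fin s → ℝ) =>
            QMC.truncatedIntegral Γ (fun θ => G s θ ξ) K
              - QMC.sparseCubature z₁ z₂ K ℓ₀ 1 L Δ.1 Δ.2
                  (QMC.likelihood Γ fun θ => G s θ ξ))
          2 ((QMC.uniformCube k).prod (QMC.uniformCube s)) ∧
        QMC.rms ((QMC.uniformCube k).prod (QMC.uniformCube s))
          (fun Δ => QMC.truncatedIntegral Γ (fun θ => G s θ ξ) K
            - QMC.sparseCubature z₁ z₂ K ℓ₀ 1 L Δ.1 Δ.2
                (QMC.likelihood Γ fun θ => G s θ ξ))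
          ≤ C' * ((2 : ℝ) ^ L) ^ (-1 + δ) * (L + 1)) := by
  obtain ⟨z₁, hz₁⟩ := QMC.exists_hasRate k
  obtain ⟨z₂, hz₂⟩ := QMC.exists_hasRate s
  refine ⟨⟨z₁, z₂, fun δ hδ => ⟨hz₁ γ₁ hγ₁ δ hδ, hz₂ γ₂ hγ₂ δ hδ⟩⟩, fun z₁ z₂ δ _ hz₁ hz₂ => ?_⟩
  obtain ⟨A, hA⟩ := QMC.exists_isAdmissible_unitModel s k C β b K
  obtain ⟨c, hc, h⟩ := QMC.exists_sparse_error_sq_le hγ₁ hγ₂ hz₁ hz₂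
    (QMC.contDiff_scaledGaussian hΓ (2 * K)) (QMC.scaledGaussian_pos hΓ (2 * K))
    QMC.contDiffOn_entropyFun QMC.measurable_entropyFun A
  -- No offset is needed: inner lattice averages of the positive likelihood stay away from `0`
  -- already at level `0`. The factor `(2 * K) ^ k` comes from rescaling the outer cube, and `√c +
  -- 1` is positive even when `c = 0`.
  refine ⟨0, (2 * K) ^ k * (√c + 1), by positivity, fun ξ L => ?_⟩
  obtain ⟨hmem, hle⟩ := h _ (hA _ (hG s hs ξ)) L
  simp_rw [QMC.truncatedIntegral_eq Γ hK, QMC.sparseCubature_eq z₁ z₂ Γ hK, ← mul_sub]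
  refine ⟨hmem.const_mul _, ?_⟩
  have hpow : ((2 : ℝ) ^ L) ^ (-1 + δ) = 2 ^ (-((1 - δ) * L)) := by
    rw [← Real.rpow_natCast, ← Real.rpow_mul zero_le_two]
    congr 1
    ring
  rw [QMC.rms, hpow]
  refine Real.sqrt_le_iff.2 ⟨by positivity, ?_⟩
  simp_rw [sq_abs, mul_pow ((2 * K) ^ k)]
  rw [integral_const_mul]
  refine (mul_le_mul_of_nonneg_left hle (by positivity)).trans ?_
  have hsq : c ≤ (√c + 1) ^ 2 := by nlinarith [Real.sq_sqrt hc, Real.sqrt_nonneg c]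
  calc ((2 * K) ^ k) ^ 2 * (c * ((2 : ℝ) ^ (-((1 - δ) * L))) ^ 2 * (L + 1) ^ 2)
      ≤ ((2 * K) ^ k) ^ 2 * ((√c + 1) ^ 2 * ((2 : ℝ) ^ (-((1 - δ) * L))) ^ 2 * (L + 1) ^ 2) := by
        gcongr
    _ = _ := by ring
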